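/- **Theorem (upwind structure-preserving LDG scheme).** *Setting.* Let $\mathcal T_h$ be a finite family of closed axis-parallel boxes or non-degenerate closed tetrahedra $R\subset\mathbb R^3$ with pairwise disjoint interiors, $\Omega$ the interior of $\bigcup_R R$, $\Gamma=\partial\Omega$, $k\ge 0$, and let $\mathcal W_h$ be the space of functions whose restriction to each $R$ is a polynomial of degree at most $k$ in each variable. Write $(g,h)_\Omega=\sum_R\int_R gh\,d\mathbf p$ (with the dot product for vector fields). On $\partial R$ let $\mathbf n^-$ be the outward unit normal of $R$, $g^-$ the trace of $g$ from $R$, and $g^+,\mathbf n^+$ the trace from, and the outward normal of, the neighbouring element; $[[g]]=g^-\mathbf n^-+g^+\mathbf n^+$. Fix a reference direction $\mathbf u\in\mathbb R^3$. The discrete gradient $\nabla_h g\in\mathcal W_h^3$ of $g\in\mathcal W_h$ is defined by $$(\nabla_h g,V)_\Omega=-\sum_R\int_R g\,\nabla\!\cdot V\,d\mathbf p+\sum_R\int_{\partial R}\check g\,V^-\!\cdot\mathbf n^-\,ds\qquad\forall V\in\mathcal W_h^3,$$ where $\check g=g^-$ on $\Gamma$ and where $\mathbf n^-\!\cdot\mathbf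 u<0$, and $\check g=g^+$ otherwise. Let $\mathcal E(\mathbf p)=|\mathbf p|^2/2$ (non-relativistic) or $\mathcal E(\mathbf p)=\sqrt{1+|\mathbf p|^2}$ (relativistic). For $\mathbf v,\mathbf w\in\mathbb R^3$ put $\mathbf a=\mathbf v-\mathbf w$, $\mathbf z=(\mathbf v+\mathbf w)/2$, and let $\mathbb S(\mathbf v,\mathbf w)=|\mathbf a|^2 I-\mathbf a\otimes\mathbf a$ (non-relativistic) or $|\mathbf a|^2I-\mathbf a\otimes\mathbf a-(\mathbf z\times\mathbf a)\otimes(\mathbf z\times\mathbf a)$ (relativistic). Let $\Lambda(\mathbf p,\mathbf q)=\Lambda(\mathbf q,\mathbf p)$ be real-valued and $C^1$ on $\{\mathbf p\ne\mathbf q\}$, and suppose that there are $C$ and $\gamma>-4$ with $|\Lambda|\le C|\mathbf p-\mathbf q|^{\gamma}$ and $|\nabla_p\Lambda|\le C|\mathbf p-\mathbf q|^{\gamma-1}$ for $\mathbf p\neq\mathbf q$ in $\overline\Omega$ (for example $\Lambda=|\mathbf p-\mathbf q|^\gamma$ with $\gamma>-4$). Suppose there is a linear projection $\Pi_h$ onto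 $\mathcal W_h\cap C^1(\overline\Omega)$, defined on a space of functions containing $1$, the coordinates $p_1,p_2,p_3$ and $\mathcal E$; thus $\Pi_h g\in\mathcal W_h\cap C^1(\overline\Omega)$ for all $g$ in its domain, and $\Pi_hg=g$ if $g|_{\overline\Omega}\in\mathcal W_h\cap C^1(\overline\Omega)$. Put $$\Phi_h(\mathbf p,\mathbf q)=\Lambda(\mathbf p,\mathbf q)\,\mathbb S\big(\nabla_h\Pi_h\mathcal E(\mathbf p),\nabla_h\Pi_h\mathcal E(\mathbf q)\big).$$ Let $f_h(\cdot,t)\in\mathcal W_h$, $t\in I$, be differentiable in $t$ with $\partial_tf_h\in\mathcal W_h$, put $\mathcal D_h(\mathbf p)=\int_\Omega\Phi_h(\mathbf p,\mathbf q)f_h(\mathbf q)\,d\mathbf q$ and $\mathcal U_h(\mathbf p)=\int_\Omega\Phi_h(\mathbf p,\mathbf q)\nabla_hf_h(\mathbf q)\,d\mathbf q$, and suppose that for all $t\in I$ and all $\varphi_h\in\mathcal W_h$ $$(\partial_tf_h,\varphi_h)_\Omega+(\nabla_hf_h,\mathcal D_h\nabla_h\varphi_h)_\Omega=\sum_R\int_R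 f_h\,\mathcal U_h\cdot\nabla\varphi_h\,d\mathbf p-\sum_R\int_{\partial R\setminus\Gamma}\big(\widehat{\widehat{\mathcal U_hf_h}}\cdot\mathbf n^-\big)\varphi_h^-\,ds,$$ with the upwind flux $\widehat{\widehat{\mathcal U_hf_h}}\cdot\mathbf n^-=(\mathcal U_h\cdot\mathbf n^-)f_h^-$ if $\mathcal U_h\cdot\mathbf n^->0$ and $(\mathcal U_h\cdot\mathbf n^-)f_h^+$ otherwise. *Conclusion.* For all $t\in I$: 1. $\partial_t(f_h,\Pi_h1)_\Omega=0$, $\partial_t(f_h,\Pi_hp_i)_\Omega=0$ for $i=1,2,3$, and $\partial_t(f_h,\Pi_h\mathcal E)_\Omega=0$. 2. $\mathcal U_h$ is continuous on $\overline\Omega$ and is differentiable in the interior of each element, with integrable divergence, and $$\tfrac12\partial_t(f_h,f_h)_\Omega+(\nabla_hf_h,\mathcal D_h\nabla_hf_h)_\Omega+\big(\tfrac12\nabla\!\cdot\mathcal U_h,f_h^2\big)_\Omega-\int_\Gamma\tfrac12\,\mathcal U_h\!\cdot\mathbf n^-\,(f_h^-)^2\,ds=-\sum_{e}\int_e\frac{|\mathcal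 U_h\cdot\mathbf n|}{2}\,[[f_h]]\cdot[[f_h]]\,ds\le0,$$ where the sum runs over the interfaces $e$ between two elements, each counted once, and $\mathbf n$ is a unit normal of $e$. -/

import Mathlib

open MeasureTheory InnerProductSpace
open scoped Gradient RealInnerProductSpace

noncomputable section

namespace USP

/-- Momentum space `ℝ³` with the Euclidean norm. -/
abbrev P3 : Type := EuclideanSpace ℝ (Fin 3)

/-! ### Energy and collision tensor -/

/-- The two variants of the Fokker-Planck-Landau equation. -/
inductive Regime
  | nonrelativistic
  | relativistic

/-- Single particle kinetic energy: `|p|² / 2`, respectively `√(1 + |p|²)`. -/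
def energy : Regime → P3 → ℝ
  | .nonrelativistic, p => ‖p‖ ^ 2 / 2
  | .relativistic, p => Real.sqrt (1 + ‖p‖ ^ 2)

/-- Cross product on `P3`. -/
def cross (a b : P3) : P3 := WithLp.toLp 2 (crossProduct a.ofLp b.ofLp)

/-- The tensor `S(v, w)`, as a linear operator. With `u = v - w` and `z = (v + w) / 2` it is
`|u|² I - u ⊗ u`, from which `(z × u) ⊗ (z × u)` is subtracted in the relativistic case. -/
def tensorS : Regime → P3 → P3 → (P3 →L[ℝ] P3)
  | .nonrelativistic, v, w =>
      ⟪v - w, v - w⟫ • ContinuousLinearMap.id ℝ P3 - rankOne ℝ (v - w) (v - w)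
  | .relativistic, v, w =>
      ⟪v - w, v - w⟫ • ContinuousLinearMap.id ℝ P3 - rankOne ℝ (v - w) (v - w)
        - rankOne ℝ (cross ((2 : ℝ)⁻¹ • (v + w)) (v - w))
            (cross ((2 : ℝ)⁻¹ • (v + w)) (v - w))

/-! ### Meshes -/

/-- Axis-parallel closed boxes with non-empty interior. -/
def IsCartesianElement (K : Set P3) : Prop :=
  ∃ a b : P3, (∀ i, a i < b i) ∧ K = {x | ∀ i, a i ≤ x i ∧ x i ≤ b i}

/-- Closed non-degenerate tetrahedra. -/
def IsSimplexElement (K : Set P3) : Prop :=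
  ∃ v : Fin 4 → P3, AffineIndependent ℝ v ∧ K = convexHull ℝ (Set.range v)

/-- A finite mesh: Cartesian elements or simplices, indexed by `ι`, that do not overlap.
Hanging nodes are allowed. -/
structure Mesh (ι : Type*) where
  elem : ι → Set P3
  isElement : ∀ R, IsCartesianElement (elem R) ∨ IsSimplexElement (elem R)
  disjoint_interior : ∀ R R', R ≠ R' → Disjoint (interior (elem R)) (interior (elem R'))

/-- The outward unit normal of a convex body `K` at a boundary point `x`, wherever it is unique.
It is set to `0` elsewhere, which for polytopes only concerns the edges, a set of area zero. -/
def outwardNormal (K : Set P3) (x : P3) : P3 :=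
  open Classical in
  if h : ∃! n : P3, ‖n‖ = 1 ∧ ∀ y ∈ K, ⟪n, y - x⟫ ≤ 0 then h.choose else 0

/-- Divergence of a vector field on `ℝ³`. -/
def div (V : P3 → P3) (x : P3) : ℝ :=
  ∑ i, (fderiv ℝ V x (EuclideanSpace.single i 1)) i

/-- Polynomial functions of degree at most `k` in each variable. -/
def IsQk (k : ℕ) (g : P3 → ℝ) : Prop :=
  ∃ P ∈ MvPolynomial.restrictDegree (Fin 3) ℝ k, ∀ x : P3, g x = MvPolynomial.eval x.ofLp P

namespace Mesh

variable {ι : Type*} [Fintype ι] [DecidableEq ι] (M : Mesh ι)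

/-- The closed computational domain. -/
def closedDomain : Set P3 := ⋃ R, M.elem R

/-- The domain `Ω` that the mesh partitions. -/
def domain : Set P3 := interior M.closedDomain

/-- `Γ = ∂Ω`. -/
def bdry : Set P3 := frontier M.domain

/-- The interface between two elements: their common boundary points that are not on `Γ`.
(It has area zero unless the two elements share a piece of a face.) -/
def interface (R R' : ι) : Set P3 := (M.elem R ∩ M.elem R') \ M.bdry

/-- The outward unit normal `n⁻` of the element `R`. -/
def normal (R : ι) (x : P3) : P3 := outwardNormal (M.elem R) x

/-! Piecewise functions are families `g` indexed by the elements: `g R` is the restriction of `g`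
to the element `R`, up to its boundary (and, for piecewise polynomials, its polynomial extension).
On `R ∩ R'`, seen from `R`, the traces are `g⁻ = g R` and `g⁺ = g R'`. -/

/-- The discrete test space `W_h`: piecewise `Q^k`. -/
def InW (_M : Mesh ι) (k : ℕ) (g : ι → P3 → ℝ) : Prop := ∀ R, IsQk k (g R)

/-- `W_h³`. -/
def InW3 (k : ℕ) (V : ι → P3 → P3) : Prop := ∀ i, M.InW k (fun R x => V R x i)

/-- The piecewise smooth function `g` is in `C¹(closure Ω)`: values and gradients of
the pieces agree wherever elements meet. -/
def IsC1 (g : ι → P3 → ℝ) : Prop :=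
  ∀ R R', ∀ x ∈ M.elem R ∩ M.elem R', g R x = g R' x ∧ ∇ (g R) x = ∇ (g R') x

/-- `(g, h)_Ω = ∑_R (g, h)_R` for scalar functions. -/
def ip (g h : ι → P3 → ℝ) : ℝ := ∑ R, ∫ x in M.elem R, g R x * h R x

/-- `(V, W)_Ω = ∑_R (V, W)_R` for vector fields. -/
def ipv (V W : ι → P3 → P3) : ℝ := ∑ R, ∫ x in M.elem R, ⟪V R x, W R x⟫

/-- Sum over all elements `R` of the surface integrals of `F R` over `∂R ∩ Γ`. -/
def sumBdry (F : ι → P3 → ℝ) : ℝ := ∑ R, ∫ x in frontier (M.elem R) ∩ M.bdry, F R x ∂μHE[2]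

/-- Sum over all elements `R` of the surface integrals over `∂R \ Γ`, where `F R R'` is the
integrand on the part of `∂R` that is shared with `R'`. Every interface is visited twice, once
from each side. -/
def sumInterfaces (F : ι → ι → P3 → ℝ) : ℝ :=
  ∑ R, ∑ R' ∈ Finset.univ.erase R, ∫ x in M.interface R R', F R R' x ∂μHE[2]

/-- The alternating flux of `f` on the part of `∂R` shared with `R'`, for the reference
direction `u`: `f⁻` if `n⁻ · u < 0`, and `f⁺` otherwise. -/
def altFlux (u : P3) (f : ι → P3 → ℝ) (R R' : ι) (x : P3) : ℝ :=
  open Classical in if ⟪M.normal R x, u⟫ < 0 then f R x else f R' x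

/-- `G` is the discrete gradient of `f`. On `Γ` the flux of `f` is `f⁻`. -/
def IsDiscreteGrad (k : ℕ) (u : P3) (f : ι → P3 → ℝ) (G : ι → P3 → P3) : Prop :=
  M.InW3 k G ∧ ∀ V : ι → P3 → P3, M.InW3 k V →
    M.ipv G V = - M.ip f (fun R => div (V R))
      + (M.sumBdry (fun R x => f R x * ⟪V R x, M.normal R x⟫)
        + M.sumInterfaces (fun R R' x => M.altFlux u f R R' x * ⟪V R x, M.normal R x⟫))

/-- The discrete gradient operator `∇_h`. -/
def dgrad (k : ℕ) (u : P3) (f : ι → P3 → ℝ) : ι → P3 → P3 :=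
  open Classical in if h : ∃ G, M.IsDiscreteGrad k u f G then h.choose else 0

/-- The jump `[[f]] = f⁻ n⁻ + f⁺ n⁺`. -/
def jump (f : ι → P3 → ℝ) (R R' : ι) (x : P3) : P3 :=
  f R x • M.normal R x + f R' x • M.normal R' x

/-! ### The kernel and the scheme -/

/-- Assumptions on the scalar factor of the collision kernel: it is symmetric, continuously
differentiable off the diagonal, and on the bounded computational domain at most as singular
at the diagonal as `|p - q| ^ γ` for some `γ > -4`. All powers `|p - q| ^ γ` with `γ > -4` are
included, in particular the Coulomb case `γ = -3`. -/
structure AdmissibleFactor (Λ : P3 → P3 → ℝ) : Prop where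
  symm : ∀ p q, Λ p q = Λ q p
  contDiffOn : ContDiffOn ℝ 1 (fun z : P3 × P3 => Λ z.1 z.2) {z | z.1 ≠ z.2}
  growth : ∃ C γ : ℝ, -4 < γ ∧ ∀ p ∈ M.closedDomain, ∀ q ∈ M.closedDomain, p ≠ q →
    |Λ p q| ≤ C * dist p q ^ γ ∧ ‖fderiv ℝ (fun p' => Λ p' q) p‖ ≤ C * dist p q ^ (γ - 1)

/-- The kernel `Φ_h(p, q) = Λ(p, q) S(∇_h e(p), ∇_h e(q))` for `p ∈ R`, `q ∈ R'`, where `e` is the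
discrete energy. -/
def kernel (rg : Regime) (k : ℕ) (u : P3) (Λ : P3 → P3 → ℝ) (e : ι → P3 → ℝ)
    (R R' : ι) (p q : P3) : P3 →L[ℝ] P3 :=
  Λ p q • tensorS rg (M.dgrad k u e R p) (M.dgrad k u e R' q)

/-- `D_h(p) = ∫_Ω Φ_h(p, q) f(q) dq` for `p ∈ R`. -/
def diffusion (rg : Regime) (k : ℕ) (u : P3) (Λ : P3 → P3 → ℝ) (e f : ι → P3 → ℝ)
    (R : ι) (p : P3) : P3 →L[ℝ] P3 :=
  ∑ R', ∫ q in M.elem R', f R' q • M.kernel rg k u Λ e R R' p q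

/-- `U_h(p) = ∫_Ω Φ_h(p, q) ∇_h f(q) dq` for `p ∈ R`. -/
def advection (rg : Regime) (k : ℕ) (u : P3) (Λ : P3 → P3 → ℝ) (e f : ι → P3 → ℝ)
    (R : ι) (p : P3) : P3 :=
  ∑ R', ∫ q in M.elem R', M.kernel rg k u Λ e R R' p q (M.dgrad k u f R' q)

/-- Normal component, with respect to `n⁻`, of the upwind flux of `U f` on the part of `∂R` shared
with `R'`: `(U · n⁻) f⁻` if `U · n⁻ > 0` and `(U · n⁻) f⁺` if `U · n⁻ < 0` (and `0` if
`U · n⁻ = 0`). -/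
def upwindFlux (U : ι → P3 → P3) (f : ι → P3 → ℝ) (R R' : ι) (x : P3) : ℝ :=
  open Classical in
  if 0 < ⟪U R x, M.normal R x⟫ then ⟪U R x, M.normal R x⟫ * f R x
  else ⟪U R x, M.normal R x⟫ * f R' x

/-- `f` solves the upwind semi-discrete scheme on the time interval `I`, with discrete energy `e`;
`f'` is the time derivative of `f`. -/
structure IsSolution (rg : Regime) (k : ℕ) (u : P3) (Λ : P3 → P3 → ℝ) (e : ι → P3 → ℝ)
    (I : Set ℝ) (f f' : ℝ → ι → P3 → ℝ) : Prop where
  mem : ∀ t ∈ I, M.InW k (f t)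
  deriv_mem : ∀ t ∈ I, M.InW k (f' t)
  hasDeriv : ∀ t ∈ I, ∀ R x, HasDerivWithinAt (fun s => f s R x) (f' t R x) I t
  weak_form : ∀ t ∈ I, ∀ φ : ι → P3 → ℝ, M.InW k φ →
    M.ip (f' t) φ
      + M.ipv (M.dgrad k u (f t))
          (fun R p => M.diffusion rg k u Λ e (f t) R p (M.dgrad k u φ R p))
    = M.ipv (fun R p => f t R p • M.advection rg k u Λ e (f t) R p) (fun R => ∇ (φ R))
      - M.sumInterfaces (fun R R' x =>
          M.upwindFlux (M.advection rg k u Λ e (f t)) (f t) R R' x * φ R x)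

/-- A linear projection onto `W_h ∩ C¹(closure Ω)`, defined on some space of functions. -/
structure C1Projection (k : ℕ) where
  dom : Submodule ℝ (P3 → ℝ)
  toFun : dom →ₗ[ℝ] (ι → P3 → ℝ)
  mem : ∀ g, M.InW k (toFun g)
  isC1 : ∀ g, M.IsC1 (toFun g)
  reproduces : ∀ w : ι → P3 → ℝ, M.InW k w → M.IsC1 w →
    ∀ g : dom, (∀ R, ∀ x ∈ M.elem R, g.1 x = w R x) → toFun g = w

end Mesh

end USP

end

noncomputable section

namespace USP

/-! ### Surface measure of planes -/

/-! Conservation. Let φ be a C¹ function in W_h such that Φ_h(p,q) annihilates ∇φ(p) − ∇φ(q).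
Testing with φ, the interface terms cancel in pairs, because U_h and hence the upwind flux is
single-valued (`sumInterfaces_upwindFlux_eq_zero`). Diffusion and advection become double integrals
of f(q) ∇_h f(p)·Φ_h ∇φ(p) and of f(p) ∇_h f(q)·Φ_h ∇φ(p). Exchanging p and q in one of them, and
using the symmetry of Φ_h and the annihilation property, shows that they agree
(`diffusion_eq_advection`), so (f_h, φ) is constant in time. For mass and momentum ∇φ is constant.
For the energy, the discrete gradient of a C¹ piecewise polynomial is its gradient
(`dgrad_eq_gradient`), and S(v,w)(v − w) = 0.

Energy identity. Test with f_h, write f∇f = ∇(f²/2) and integrate by parts on each element. On an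
interface the traces of f²/2 cancel the central part of the upwind flux, and the |U·n| part leaves
the squared jump (`upwind_energy`).

The analytic difficulty is that U_h must have in each element a derivative that is continuous up to
the boundary, although |∇Λ| may grow like r^(γ−1) with γ near −4, where r = |p − q|. The tensor S
vanishes to second order where its arguments agree, and ∇_hΠ_hE is Lipschitz across elements. So the
kernel is O(r^(γ+2)) and its derivative O(r^(γ+1)), which is integrable in ℝ³
(`exists_kernel_bound`), and one may differentiate under the integral
(`hasFDerivAt_singularIntegral`). As the domain need not be convex, the Lipschitz bound needs an
argument: two polytopes meet linearly regularly, so nearby points of two elements can be joined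
through a common point at comparable distance (`exists_linear_regularity`).

The divergence theorem on a polytope comes from Fubini along a coordinate axis
(`integral_partial_eq`). The intrinsically defined normal equals the face normal almost everywhere
on the boundary, and the normals of two neighbours are opposite (`normal_eq_neg`). -/

/-- The Euclidean plane. -/
abbrev P2 : Type := EuclideanSpace ℝ (Fin 2)

/-- The point of `ℝ³` with `i`-th coordinate `s` and remaining coordinates `y`. -/
def ins (i : Fin 3) (s : ℝ) (y : P2) : P3 := WithLp.toLp 2 (i.insertNth (α := fun _ => ℝ) s y.ofLp)

@[simp] lemma ins_same (i : Fin 3) (s : ℝ) (y : P2) : ins i s y i = s := by simp [ins]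

@[simp] lemma ins_succAbove (i : Fin 3) (s : ℝ) (y : P2) (j : Fin 2) :
    ins i s y (i.succAbove j) = y j := by simp [ins]

lemma inner_eq_sum_succAbove (i : Fin 3) (n x : P3) :
    ⟪n, x⟫ = n i * x i + ∑ j : Fin 2, n (i.succAbove j) * x (i.succAbove j) := by
  rw [PiLp.inner_apply, Fin.sum_univ_succAbove _ i]
  simp [mul_comm]

lemma ins_ext (i : Fin 3) {x y : P3} (h : x i = y i)
    (h' : ∀ j, x (i.succAbove j) = y (i.succAbove j)) : x = y := by
  ext k
  rcases Fin.eq_self_or_eq_succAbove i k with rfl | ⟨j, rfl⟩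
  · exact h
  · exact h' j

/-- Dropping the `i`-th coordinate. -/
def drop (i : Fin 3) (x : P3) : P2 := WithLp.toLp 2 (fun j => x (i.succAbove j))

@[simp] lemma drop_apply (i : Fin 3) (x : P3) (j : Fin 2) : drop i x j = x (i.succAbove j) := rfl

@[simp] lemma drop_ins (i : Fin 3) (s : ℝ) (y : P2) : drop i (ins i s y) = y := by
  ext j; simp

lemma measurePreserving_ins (i : Fin 3) :
    MeasurePreserving (fun z : P2 × ℝ => ins i z.2 z.1) (volume.prod volume) volume := by
  have h1 : MeasurePreserving (Prod.swap : P2 × ℝ → ℝ × P2) (volume.prod volume)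
      (volume.prod volume) := Measure.measurePreserving_swap
  have h2 := (MeasurePreserving.id (volume : Measure ℝ)).prod (PiLp.volume_preserving_ofLp (Fin 2))
  have h3 := (volume_preserving_piFinSuccAbove (fun _ : Fin 3 => ℝ) i).symm
  have h4 := PiLp.volume_preserving_toLp (Fin 3)
  exact h4.comp (h3.comp (h2.comp h1))

lemma continuous_ins (i : Fin 3) : Continuous (fun z : P2 × ℝ => ins i z.2 z.1) := by
  unfold ins
  fun_prop

lemma measurableEmbedding_ins (i : Fin 3) :
    MeasurableEmbedding (fun z : P2 × ℝ => ins i z.2 z.1) := by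
  refine (continuous_ins i).measurableEmbedding ?_
  intro a b h
  have h1 := congrArg (drop i) h
  have h2 := congrArg (fun x : P3 => x i) h
  simp only [drop_ins, ins_same] at h1 h2
  exact Prod.ext h1 h2

lemma integral_eq_integral_ins (i : Fin 3) {g : P3 → ℝ} (hg : Integrable g) :
    ∫ x, g x = ∫ y : P2, ∫ s : ℝ, g (ins i s y) := by
  have h := (measurePreserving_ins i).integral_comp (measurableEmbedding_ins i) g
  rw [← h, integral_prod]
  exact ((measurePreserving_ins i).integrable_comp_emb (measurableEmbedding_ins i)).2 hg

/-- The height over `y` of the plane `⟪n, x⟫ = c`, in the direction of the `i`-th axis. -/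
def height (i : Fin 3) (h : P3 × ℝ) (y : P2) : ℝ :=
  (h.2 - ∑ j : Fin 2, h.1 (i.succAbove j) * y j) / h.1 i

/-- The plane with unit normal `h.1` and offset `h.2`. -/
def plane (h : P3 × ℝ) : Set P3 := {x | ⟪h.1, x⟫ = h.2}

/-- The plane `plane h` as a graph over the coordinates other than `i`. -/
def graph (i : Fin 3) (h : P3 × ℝ) (y : P2) : P3 := ins i (height i h y) y

lemma graph_mem_plane {i : Fin 3} {h : P3 × ℝ} (hi : h.1 i ≠ 0) (y : P2) :
    graph i h y ∈ plane h := by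
  simp only [plane, Set.mem_ofPred_eq, graph]
  rw [inner_eq_sum_succAbove i]
  simp only [ins_same, ins_succAbove, height]
  field_simp
  ring

lemma graph_drop {i : Fin 3} {h : P3 × ℝ} (hi : h.1 i ≠ 0) {x : P3} (hx : x ∈ plane h) :
    graph i h (drop i x) = x := by
  refine ins_ext i ?_ (by simp [graph])
  simp only [plane, Set.mem_ofPred_eq] at hx
  rw [inner_eq_sum_succAbove i] at hx
  simp only [graph, ins_same, height, drop_apply]
  rw [div_eq_iff hi]
  linarith

lemma range_graph {i : Fin 3} {h : P3 × ℝ} (hi : h.1 i ≠ 0) : Set.range (graph i h) = plane h := by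
  ext x
  exact ⟨fun ⟨y, hy⟩ => hy ▸ graph_mem_plane hi y, fun hx => ⟨drop i x, graph_drop hi hx⟩⟩

lemma graph_injective (i : Fin 3) (h : P3 × ℝ) : Function.Injective (graph i h) := by
  intro y z hyz
  simpa [graph] using congrArg (drop i) hyz

lemma continuous_graph (i : Fin 3) (h : P3 × ℝ) : Continuous (graph i h) := by
  have : Continuous (height i h) := by unfold height; fun_prop
  exact (continuous_ins i).comp (continuous_id.prodMk this)

lemma measurableEmbedding_graph (i : Fin 3) (h : P3 × ℝ) : MeasurableEmbedding (graph i h) :=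
  (continuous_graph i h).measurableEmbedding (graph_injective i h)

/-- The linear part of `graph i h`. -/
def graphLin (i : Fin 3) (n : P3) : P2 →ₗ[ℝ] P3 where
  toFun y := graph i (n, 0) y
  map_add' y z := by
    refine ins_ext i ?_ (by simp [graph])
    simp only [graph, ins_same, height, PiLp.add_apply, mul_add, Finset.sum_add_distrib]
    ring
  map_smul' a y := by
    refine ins_ext i ?_ (by simp [graph])
    simp only [graph, ins_same, height, PiLp.smul_apply, smul_eq_mul, RingHom.id_apply]
    simp only [Fin.sum_univ_two]
    ring

/-- With m the vector of slopes, the Gram matrix of the tangent vectors is I + m mᵀ. Its determinant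
1 + |m|² equals 1 / n_i² since n is a unit vector. -/
lemma normDet_graphLin {i : Fin 3} {n : P3} (hn : ‖n‖ = 1) (hi : n i ≠ 0) :
    (graphLin i n).normDet = |n i|⁻¹ := by
  have h := (graphLin i n).normDet_sq_eq_det_gram (EuclideanSpace.basisFun (Fin 2) ℝ)
  have hn' : n i * n i + ∑ j : Fin 2, n (i.succAbove j) * n (i.succAbove j) = 1 := by
    rw [← inner_eq_sum_succAbove, real_inner_self_eq_norm_sq, hn]; norm_num
  rw [Fin.sum_univ_two] at hn'
  have h2 : (graphLin i n).normDet ^ 2 = (|n i|⁻¹) ^ 2 := by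
    rw [inv_pow, sq_abs]
    have h' : (graphLin i n).normDet ^ 2 = _ := h
    rw [h', Matrix.det_fin_two]
    simp only [Matrix.gram_apply, inner_eq_sum_succAbove i, graphLin, LinearMap.coe_mk,
      AddHom.coe_mk, graph, ins_same, ins_succAbove, height, Fin.sum_univ_two]
    simp only [EuclideanSpace.basisFun_apply, PiLp.single_apply]
    simp
    field_simp
    linear_combination (n i ^ 2) * hn'
  exact (sq_eq_sq₀ (LinearMap.normDet_nonneg _) (by positivity)).1 h2

/-- The graph is a translate of its linear part, whose area factor is the Gram determinant above. -/
lemma volume_graph_image {i : Fin 3} {h : P3 × ℝ} (hn : ‖h.1‖ = 1) (hi : h.1 i ≠ 0) (A : Set P2) :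
    μHE[2] (graph i h '' A) = ENNReal.ofReal |h.1 i|⁻¹ * volume A := by
  have h1 := (graphLin i h.1).euclideanHausdorffMeasure_image_eq_normDet_mul_volume A
  rw [normDet_graphLin hn hi, finrank_euclideanSpace_fin] at h1
  rw [← h1]
  have h2 : graph i h '' A = (fun x => ins i (h.2 / h.1 i) 0 + x) '' (graphLin i h.1 '' A) := by
    rw [Set.image_image]
    refine Set.image_congr fun y _ => ins_ext i ?_ ?_
    · simp only [graph, graphLin, LinearMap.coe_mk, AddHom.coe_mk, ins_same, height,
        PiLp.add_apply]
      ring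
    · simp [graph, graphLin]
  rw [h2]
  exact (isometry_add_left _).euclideanHausdorffMeasure_image _

lemma map_graph {i : Fin 3} {h : P3 × ℝ} (hn : ‖h.1‖ = 1) (hi : h.1 i ≠ 0) :
    Measure.map (graph i h) volume
      = ENNReal.ofReal |h.1 i| • (μHE[2] : Measure P3).restrict (plane h) := by
  ext B hB
  rw [(measurableEmbedding_graph i h).map_apply, Measure.smul_apply, Measure.restrict_apply hB,
    ← range_graph hi, ← Set.image_preimage_eq_inter_range, volume_graph_image hn hi, smul_eq_mul,
    ← mul_assoc, ← ENNReal.ofReal_mul (abs_nonneg _), mul_inv_cancel₀ (abs_ne_zero.2 hi)]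
  simp

lemma measurableSet_plane (h : P3 × ℝ) : MeasurableSet (plane h) :=
  (isClosed_eq (by fun_prop) (by fun_prop)).measurableSet

/-- The relation |n_i| dS = dy, by which boundary integrals are compared with integrals over the
projection. No regularity of `g` is needed because the graph map is a measurable embedding. -/
lemma setIntegral_plane {i : Fin 3} {h : P3 × ℝ} (hn : ‖h.1‖ = 1) (hi : h.1 i ≠ 0) {K : Set P3}
    (hK : MeasurableSet K) (g : P3 → ℝ) :
    |h.1 i| * ∫ x in K ∩ plane h, g x ∂μHE[2] = ∫ y in graph i h ⁻¹' K, g (graph i h y) := by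
  rw [← (measurableEmbedding_graph i h).setIntegral_map g K, map_graph hn hi,
    Measure.restrict_smul, integral_smul_measure, Measure.restrict_restrict hK,
    ENNReal.toReal_ofReal (abs_nonneg _), smul_eq_mul]

lemma exists_coord_ne_zero {n : P3} (hn : ‖n‖ = 1) : ∃ i, n i ≠ 0 := by
  by_contra! h
  have : n = 0 := by ext i; simpa using h i
  simp [this] at hn

lemma hausdorff_plane_inter_lt_top {h : P3 × ℝ} (hn : ‖h.1‖ = 1) {K : Set P3}
    (hK : Bornology.IsBounded K) : μHE[2] (K ∩ plane h) < ⊤ := by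
  obtain ⟨i, hi⟩ := exists_coord_ne_zero hn
  rw [← range_graph hi, ← Set.image_preimage_eq_inter_range, volume_graph_image hn hi]
  refine ENNReal.mul_lt_top ENNReal.ofReal_lt_top ?_
  have hsub : graph i h ⁻¹' K ⊆ drop i '' K := fun y hy => ⟨_, hy, by simp [graph]⟩
  refine (measure_mono hsub).trans_lt (Bornology.IsBounded.measure_lt_top ?_)
  have hl : LipschitzWith 1 (drop i) := by
    refine LipschitzWith.of_dist_le_mul fun x y => ?_
    rw [NNReal.coe_one, one_mul, EuclideanSpace.dist_eq, EuclideanSpace.dist_eq]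
    refine Real.sqrt_le_sqrt ?_
    rw [Fin.sum_univ_succAbove (fun k => dist (x k) (y k) ^ 2) i]
    simp only [drop_apply]
    nlinarith [sq_nonneg (dist (x i) (y i))]
  exact hl.isBounded_image hK

/-! ### Convex polytopes -/

/-- `K` is a compact polytope with non-empty interior, cut out by the half spaces
`⟪n, x⟫ ≤ c`, `(n, c) ∈ H`, with unit vectors `n`. -/
structure IsPolytope (H : Finset (P3 × ℝ)) (K : Set P3) : Prop where
  unit : ∀ h ∈ H, ‖h.1‖ = 1
  mem_iff : ∀ x, x ∈ K ↔ ∀ h ∈ H, ⟪h.1, x⟫ ≤ h.2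
  isCompact : IsCompact K
  nonempty_interior : (interior K).Nonempty

/-- The unit outward normal of `K` at `x` exists and is unique. -/
def IsSmoothAt (K : Set P3) (x : P3) : Prop :=
  ∃! n : P3, ‖n‖ = 1 ∧ ∀ y ∈ K, ⟪n, y - x⟫ ≤ 0

lemma outwardNormal_spec {K : Set P3} {x : P3} (h : IsSmoothAt K x) :
    ‖outwardNormal K x‖ = 1 ∧ ∀ y ∈ K, ⟪outwardNormal K x, y - x⟫ ≤ 0 := by
  have h' : ∃! n : P3, ‖n‖ = 1 ∧ ∀ y ∈ K, ⟪n, y - x⟫ ≤ 0 := h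
  rw [outwardNormal, dif_pos h']
  exact h'.choose_spec.1

lemma outwardNormal_eq {K : Set P3} {x n : P3} (h : IsSmoothAt K x) (hn : ‖n‖ = 1)
    (hn' : ∀ y ∈ K, ⟪n, y - x⟫ ≤ 0) : outwardNormal K x = n :=
  h.unique (outwardNormal_spec h) ⟨hn, hn'⟩

lemma volume_affine_eq_zero {m : P2} {d : ℝ} (h : m ≠ 0 ∨ d ≠ 0) :
    volume {y : P2 | ⟪m, y⟫ = d} = 0 := by
  by_cases hm : m = 0
  · have hd : d ≠ 0 := by simpa [hm] using h
    have : {y : P2 | ⟪m, y⟫ = d} = ∅ := by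
      ext y; simp [hm, hd.symm]
    simp [this]
  · have hm2 : ⟪m, m⟫ ≠ 0 := inner_self_ne_zero.2 hm
    have hker : LinearMap.ker (innerₛₗ ℝ m : P2 →ₗ[ℝ] ℝ) ≠ ⊤ := by
      intro hk
      have : m ∈ LinearMap.ker (innerₛₗ ℝ m : P2 →ₗ[ℝ] ℝ) := by rw [hk]; trivial
      exact hm2 (by simpa using this)
    have h0 := Measure.addHaar_submodule (volume : Measure P2) _ hker
    -- The affine line is the kernel of ⟪m, ·⟫ translated by the multiple of m on which this
    -- functional takes the value d.
    rw [← measure_preimage_add_right volume (-((d / ⟪m, m⟫) • m))] at h0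
    convert h0 using 2
    ext y
    simp only [Set.mem_ofPred_eq, Set.mem_preimage, SetLike.mem_coe, LinearMap.mem_ker,
      innerₛₗ_apply_apply, inner_add_right, inner_neg_right, inner_smul_right,
      div_mul_cancel₀ _ hm2]
    constructor <;> intro h <;> linarith

namespace IsPolytope

variable {H : Finset (P3 × ℝ)} {K : Set P3}

lemma mem_interior_of_lt (hK : IsPolytope H K)
    {x : P3} (hx : ∀ h ∈ H, ⟪h.1, x⟫ < h.2) : x ∈ interior K := by
  have ho : IsOpen (⋂ h ∈ H, {x : P3 | ⟪h.1, x⟫ < h.2}) :=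
    isOpen_biInter_finset fun h _ => isOpen_lt (by fun_prop) (by fun_prop)
  refine mem_interior.2 ⟨_, ?_, ho, by simpa using hx⟩
  intro y hy
  simp only [Set.mem_iInter, Set.mem_ofPred_eq] at hy
  exact (hK.mem_iff y).2 fun h hh => (hy h hh).le

/-- From an interior point one can move a little along the normal without leaving K, so the
constraint has slack. -/
lemma lt_of_mem_interior (hK : IsPolytope H K)
    {x : P3} (hx : x ∈ interior K) : ∀ h ∈ H, ⟪h.1, x⟫ < h.2 := by
  intro h hh
  have hc : Continuous (fun t : ℝ => x + t • h.1) := by fun_prop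
  have h0 : ∀ᶠ t in nhds (0 : ℝ), x + t • h.1 ∈ interior K := by
    refine hc.continuousAt.eventually_mem (isOpen_interior.mem_nhds ?_)
    simpa using hx
  obtain ⟨t, ht, ht0⟩ := ((h0.filter_mono nhdsWithin_le_nhds).and
    (self_mem_nhdsWithin : Set.Ioi (0 : ℝ) ∈ nhdsWithin 0 (Set.Ioi 0))).exists
  have h1 := (hK.mem_iff _).1 (interior_subset ht) h hh
  rw [inner_add_right, inner_smul_right, real_inner_self_eq_norm_sq, hK.unit h hh] at h1
  have : 0 < t := ht0
  linarith

lemma isClosed (hK : IsPolytope H K) : IsClosed K := hK.isCompact.isClosed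

lemma frontier_eq (hK : IsPolytope H K) : frontier K = ⋃ h : H, K ∩ plane h.1 := by
  ext x
  rw [hK.isClosed.frontier_eq]
  simp only [Set.mem_sdiff, Set.mem_iUnion, Set.mem_inter_iff, plane, Set.mem_ofPred_eq]
  constructor
  · rintro ⟨hx, hx'⟩
    by_contra! hcon
    exact hx' (hK.mem_interior_of_lt fun h hh =>
      lt_of_le_of_ne ((hK.mem_iff x).1 hx h hh) (hcon ⟨h, hh⟩ hx))
  · rintro ⟨h, hx, hx'⟩
    exact ⟨hx, fun hint => (hK.lt_of_mem_interior hint _ h.2).ne hx'⟩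

lemma convex (hK : IsPolytope H K) : Convex ℝ K := by
  intro x hx y hy a b ha hb hab
  refine (hK.mem_iff _).2 fun h hh => ?_
  rw [inner_add_right, inner_smul_right, inner_smul_right]
  have h1 := (hK.mem_iff x).1 hx h hh
  have h2 := (hK.mem_iff y).1 hy h hh
  calc a * ⟪h.1, x⟫ + b * ⟪h.1, y⟫ ≤ a * h.2 + b * h.2 := by gcongr
    _ = h.2 := by rw [← add_mul, hab, one_mul]

/-- Different faces lie in different planes, so that their intersection projects to a null set. -/
lemma volume_graph_mem_plane (hK : IsPolytope H K)
    {i : Fin 3} {h h' : P3 × ℝ} (hh : h ∈ H) (hh' : h' ∈ H) (hne : h ≠ h')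
    (hi : h.1 i ≠ 0) : volume {y : P2 | graph i h y ∈ plane h'} = 0 := by
  set r : ℝ := h'.1 i / h.1 i with hr
  have hri : r * h.1 i = h'.1 i := div_mul_cancel₀ _ hi
  set m : P2 := WithLp.toLp 2 (fun j => h'.1 (i.succAbove j) - r * h.1 (i.succAbove j)) with hm
  have hset : {y : P2 | graph i h y ∈ plane h'} = {y : P2 | ⟪m, y⟫ = h'.2 - r * h.2} := by
    ext y
    simp only [Set.mem_ofPred_eq, plane, graph]
    rw [inner_eq_sum_succAbove i, PiLp.inner_apply]
    simp only [ins_same, ins_succAbove, height, Fin.sum_univ_two, hm]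
    simp only [RCLike.inner_apply, conj_trivial]
    rw [← hri]
    have : r * h.1 i * ((h.2 - (h.1 (i.succAbove 0) * y 0 + h.1 (i.succAbove 1) * y 1)) / h.1 i)
        = r * (h.2 - (h.1 (i.succAbove 0) * y 0 + h.1 (i.succAbove 1) * y 1)) := by
      field_simp
    rw [this]
    constructor <;> intro h <;> linarith
  rw [hset]
  apply volume_affine_eq_zero
  by_contra! hcon
  obtain ⟨hm0, hd0⟩ := hcon
  have hn : h'.1 = r • h.1 := by
    refine ins_ext i (by simp [hri]) fun j => ?_
    have : m j = 0 := by rw [hm0]; rfl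
    simp only [hm] at this
    simp only [PiLp.smul_apply, smul_eq_mul]
    linarith
  have hr1 : |r| = 1 := by
    have h1 := hK.unit h' hh'
    rw [hn, norm_smul, hK.unit h hh, mul_one, Real.norm_eq_abs] at h1
    exact h1
  -- The two planes coincide. Equal normals would make the two constraints equal; opposite normals
  -- would confine K to the plane, against its non-empty interior.
  rcases (abs_eq zero_le_one).1 hr1 with h1 | h1
  · refine hne (Prod.ext ?_ ?_)
    · rw [hn, h1, one_smul]
    · rw [h1] at hd0; linarith
  · obtain ⟨x, hx⟩ := hK.nonempty_interior
    have e1 := hK.lt_of_mem_interior hx h hh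
    have e2 := hK.lt_of_mem_interior hx h' hh'
    rw [hn, h1, inner_smul_left] at e2
    rw [h1] at hd0
    simp only [conj_trivial] at e2
    linarith

lemma hausdorff_plane_inter_plane (hK : IsPolytope H K)
    {h h' : P3 × ℝ} (hh : h ∈ H) (hh' : h' ∈ H) (hne : h ≠ h') :
    μHE[2] (plane h ∩ plane h') = 0 := by
  obtain ⟨i, hi⟩ := exists_coord_ne_zero (hK.unit h hh)
  have := hK.volume_graph_mem_plane hh hh' hne hi
  rw [Set.inter_comm, ← range_graph hi, ← Set.image_preimage_eq_inter_range,
    volume_graph_image (hK.unit h hh) hi]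
  have h0 : volume (graph i h ⁻¹' plane h') = 0 := this
  rw [h0, mul_zero]

/-- With a single active constraint, K contains a short segment from x in every direction of its
half space. An outward normal m is therefore nonpositive on the whole half space, which leaves only
the face normal. -/
lemma isSmoothAt_of_unique_plane (hK : IsPolytope H K)
    {h : P3 × ℝ} (hh : h ∈ H) {x : P3} (hx : x ∈ K)
    (hxh : x ∈ plane h) (huniq : ∀ h' ∈ H, h' ≠ h → x ∉ plane h') :
    IsSmoothAt K x ∧ outwardNormal K x = h.1 := by
  have hmem : ‖h.1‖ = 1 ∧ ∀ y ∈ K, ⟪h.1, y - x⟫ ≤ 0 := by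
    refine ⟨hK.unit h hh, fun y hy => ?_⟩
    have h1 := (hK.mem_iff y).1 hy h hh
    have h2 : ⟪h.1, x⟫ = h.2 := hxh
    rw [inner_sub_right]; linarith
  have hdir : ∀ m : P3, (∀ y ∈ K, ⟪m, y - x⟫ ≤ 0) → ∀ w : P3, ⟪h.1, w⟫ ≤ 0 → ⟪m, w⟫ ≤ 0 := by
    intro m hm w hw
    have hev : ∀ᶠ t in nhdsWithin (0 : ℝ) (Set.Ioi 0), x + t • w ∈ K := by
      have : ∀ᶠ t in nhdsWithin (0 : ℝ) (Set.Ioi 0), ∀ h' ∈ H, ⟪h'.1, x + t • w⟫ ≤ h'.2 := by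
        rw [Filter.eventually_all_finset]
        intro h' hh'
        by_cases he : h' = h
        · subst he
          filter_upwards [self_mem_nhdsWithin] with t ht
          have h2 : ⟪h'.1, x⟫ = h'.2 := hxh
          rw [inner_add_right, inner_smul_right, h2]
          have : 0 < t := ht
          nlinarith
        · have hlt : ⟪h'.1, x + (0 : ℝ) • w⟫ < h'.2 := by
            rw [zero_smul, add_zero]
            exact lt_of_le_of_ne ((hK.mem_iff x).1 hx h' hh') (huniq h' hh' he)
          have hc : Continuous (fun t : ℝ => ⟪h'.1, x + t • w⟫) := by fun_prop
          exact ((hc.continuousAt.eventually_lt continuousAt_const hlt).filter_mono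
            nhdsWithin_le_nhds).mono fun t ht => ht.le
      filter_upwards [this] with t ht
      exact (hK.mem_iff _).2 ht
    obtain ⟨t, ht, ht0⟩ := (hev.and self_mem_nhdsWithin).exists
    have h1 := hm _ ht
    rw [add_sub_cancel_left, inner_smul_right] at h1
    have : 0 < t := ht0
    by_contra! hcon
    nlinarith [mul_pos this hcon]
  have hsm : IsSmoothAt K x := by
    refine ⟨h.1, hmem, fun m hm => ?_⟩
    have hm1 := real_inner_self_eq_norm_sq m
    have hh1 := real_inner_self_eq_norm_sq h.1
    rw [hm.1] at hm1
    rw [hmem.1] at hh1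
    -- The tangential part of m gives 1 − ⟪h, m⟫² ≤ 0 and the direction −h gives ⟪h, m⟫ ≥ 0.
    -- Together with Cauchy–Schwarz, ⟪h, m⟫ = 1.
    have e1 := hdir m hm.2 (m - ⟪h.1, m⟫ • h.1) (by
      rw [inner_sub_right, inner_smul_right, hh1]; simp)
    have e2 := hdir m hm.2 (-h.1) (by rw [inner_neg_right, hh1]; simp)
    rw [inner_sub_right, inner_smul_right, hm1, real_inner_comm h.1 m] at e1
    rw [inner_neg_right, real_inner_comm h.1 m] at e2
    have e3 : ⟪h.1, m⟫ = 1 := by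
      have hle : ⟪h.1, m⟫ ≤ 1 := by
        have := real_inner_le_norm h.1 m
        rwa [hm.1, hmem.1, one_mul] at this
      nlinarith
    have e4 : ‖m - h.1‖ ^ 2 = 0 := by
      rw [norm_sub_sq_real, hm.1, hmem.1, real_inner_comm h.1 m, e3]; norm_num
    exact sub_eq_zero.1 (norm_eq_zero.1 (pow_eq_zero_iff two_ne_zero |>.1 e4))
  exact ⟨hsm, outwardNormal_eq hsm hmem.1 hmem.2⟩

/-- At almost every point of a face no other face is active. -/
lemma ae_face (hK : IsPolytope H K) {h : P3 × ℝ} (hh : h ∈ H) :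
    ∀ᵐ x ∂(μHE[2] : Measure P3).restrict (K ∩ plane h),
      IsSmoothAt K x ∧ outwardNormal K x = h.1 := by
  have h0 : ∀ᵐ x ∂(μHE[2] : Measure P3), ∀ h' ∈ H, h' ≠ h → x ∉ plane h ∩ plane h' := by
    rw [Filter.eventually_all_finset]
    intro h' hh'
    rw [Filter.eventually_imp_distrib_left]
    intro hne
    exact measure_eq_zero_iff_ae_notMem.1 (hK.hausdorff_plane_inter_plane hh hh' hne.symm)
  rw [ae_restrict_iff' (hK.isClosed.measurableSet.inter (measurableSet_plane h))]
  filter_upwards [h0] with x hx hxK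
  exact hK.isSmoothAt_of_unique_plane hh hxK.1 hxK.2
    fun h' hh' hne hx' => hx h' hh' hne ⟨hxK.2, hx'⟩

lemma ae_isSmoothAt (hK : IsPolytope H K)
    : ∀ᵐ x ∂(μHE[2] : Measure P3).restrict (frontier K), IsSmoothAt K x := by
  rw [hK.frontier_eq, ae_restrict_iUnion_iff]
  exact fun h => (hK.ae_face h.2).mono fun x hx => hx.1

/-- Faces overlap in edges only, which have area zero. -/
lemma restrict_frontier (hK : IsPolytope H K) : (μHE[2] : Measure P3).restrict (frontier K)
    = Measure.sum fun h : H => (μHE[2] : Measure P3).restrict (K ∩ plane h.1) := by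
  rw [hK.frontier_eq]
  refine Measure.restrict_iUnion_ae ?_ fun h =>
    (hK.isClosed.measurableSet.inter (measurableSet_plane h.1)).nullMeasurableSet
  intro h h' hne
  refine measure_mono_null ?_
    (hK.hausdorff_plane_inter_plane h.2 h'.2 fun he => hne (Subtype.ext he))
  exact fun x hx => ⟨hx.1.2, hx.2.2⟩

lemma hausdorff_frontier_lt_top (hK : IsPolytope H K) : μHE[2] (frontier K) < ⊤ := by
  rw [hK.frontier_eq]
  refine (measure_iUnion_fintype_le _ _).trans_lt (ENNReal.sum_lt_top.2 fun h _ => ?_)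
  exact hausdorff_plane_inter_lt_top (hK.unit _ h.2) hK.isCompact.isBounded

/-- The normal is defined by choice; it is measurable because it is almost everywhere constant on
each of the finitely many faces. -/
lemma aestronglyMeasurable_outwardNormal (hK : IsPolytope H K) :
    AEStronglyMeasurable (outwardNormal K) ((μHE[2] : Measure P3).restrict (frontier K)) := by
  rw [hK.frontier_eq, aestronglyMeasurable_iUnion_iff]
  intro h
  exact (aestronglyMeasurable_const (b := h.1.1)).congr
    ((hK.ae_face h.2).mono fun x hx => hx.2.symm)

lemma integrableOn_frontier (hK : IsPolytope H K) {g : P3 → ℝ} (hg : ContinuousOn g K) :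
    IntegrableOn g (frontier K) μHE[2] := by
  obtain ⟨C, hC⟩ := hK.isCompact.exists_bound_of_continuousOn hg
  have hs : frontier K ⊆ K := hK.isClosed.frontier_subset
  refine IntegrableOn.of_bound hK.hausdorff_frontier_lt_top
    ((hg.mono hs).aestronglyMeasurable isClosed_frontier.measurableSet) C ?_
  exact (ae_restrict_mem isClosed_frontier.measurableSet).mono fun x hx => hC x (hs hx)

lemma ae_norm_outwardNormal_le (hK : IsPolytope H K) :
    ∀ᵐ x ∂(μHE[2] : Measure P3).restrict (frontier K), ‖outwardNormal K x‖ ≤ 1 :=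
  hK.ae_isSmoothAt.mono fun _ hx => (outwardNormal_spec hx).1.le

lemma integrableOn_frontier_mul (hK : IsPolytope H K)
    {g : P3 → ℝ} (hg : ContinuousOn g K) (i : Fin 3) :
    IntegrableOn (fun x => g x * outwardNormal K x i) (frontier K) μHE[2] := by
  refine (hK.integrableOn_frontier hg).mul_bdd (c := 1) ?_ ?_
  · exact (EuclideanSpace.proj (𝕜 := ℝ) i).continuous.comp_aestronglyMeasurable
      hK.aestronglyMeasurable_outwardNormal
  · exact hK.ae_norm_outwardNormal_le.mono fun x hx => (PiLp.norm_apply_le _ i).trans hx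

lemma integral_frontier_mul (hK : IsPolytope H K) {g : P3 → ℝ} (hg : ContinuousOn g K) (i : Fin 3) :
    ∫ x in frontier K, g x * outwardNormal K x i ∂μHE[2]
      = ∑ h ∈ H, h.1 i * ∫ x in K ∩ plane h, g x ∂μHE[2] := by
  have hint := hK.integrableOn_frontier_mul hg i
  rw [IntegrableOn, hK.restrict_frontier] at hint
  rw [hK.restrict_frontier, integral_sum_measure hint, tsum_fintype,
    ← Finset.sum_coe_sort H (fun h : P3 × ℝ => h.1 i * ∫ x in K ∩ plane h, g x ∂μHE[2])]
  refine Finset.sum_congr rfl fun h _ => ?_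
  rw [← integral_const_mul]
  refine integral_congr_ae ((hK.ae_face h.2).mono fun x hx => ?_)
  simp only [hx.2, mul_comm]

end IsPolytope

/-! ### The divergence theorem on a polytope -/

lemma inner_ins (i : Fin 3) (n : P3) (s : ℝ) (y : P2) :
    ⟪n, ins i s y⟫ = n i * s + ∑ j : Fin 2, n (i.succAbove j) * y j := by
  rw [inner_eq_sum_succAbove i]; simp

lemma graph_eq_ins {i : Fin 3} {h : P3 × ℝ} (hi : h.1 i ≠ 0) {s : ℝ} {y : P2}
    (hs : ins i s y ∈ plane h) : graph i h y = ins i s y := by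
  have := graph_drop hi hs
  rwa [drop_ins] at this

lemma hasDerivAt_comp_ins {g : P3 → ℝ} {g' : P3 →L[ℝ] ℝ} (i : Fin 3) {s : ℝ} {y : P2}
    (h : HasFDerivAt g g' (ins i s y)) :
    HasDerivAt (fun t => g (ins i t y)) (g' (EuclideanSpace.single i 1)) s := by
  have h1 : ∀ t, ins i t y = ins i 0 y + t • EuclideanSpace.single i (1 : ℝ) := by
    intro t
    refine ins_ext i (by simp) fun j => ?_
    simp [Fin.succAbove_ne i j]
  have h2 : HasDerivAt (fun t => ins i t y) (EuclideanSpace.single i (1 : ℝ)) s := by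
    have := ((hasDerivAt_id s).smul_const (EuclideanSpace.single i (1 : ℝ))).const_add (ins i 0 y)
    rw [one_smul] at this
    exact this.congr_of_eventuallyEq (Filter.Eventually.of_forall fun t => h1 t)
  exact h.comp_hasDerivAt s h2

namespace IsPolytope

variable {H : Finset (P3 × ℝ)} {K : Set P3}

/-- Where the line through `ins i b y` in the direction of the `i`-th axis leaves `K`, a face with
positive `i`-th normal component is active. -/
lemma exists_top (hK : IsPolytope H K) {i : Fin 3} {y : P2} {b : ℝ} (hb : ins i b y ∈ K)
    (hmax : ∀ s, ins i s y ∈ K → s ≤ b) : ∃ h ∈ H, 0 < h.1 i ∧ ins i b y ∈ plane h := by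
  by_contra! hcon
  -- Moving upwards only helps the constraints with nonpositive i-th component. If those with
  -- positive component were all inactive, the line would stay in K beyond b.
  have hev : ∀ᶠ s in nhdsWithin b (Set.Ioi b), ins i s y ∈ K := by
    have : ∀ᶠ s in nhdsWithin b (Set.Ioi b), ∀ h ∈ H, ⟪h.1, ins i s y⟫ ≤ h.2 := by
      rw [Filter.eventually_all_finset]
      intro h hh
      have hbh := (hK.mem_iff _).1 hb h hh
      rw [inner_ins] at hbh
      by_cases hp : 0 < h.1 i
      · have hlt : ⟪h.1, ins i b y⟫ < h.2 :=
          lt_of_le_of_ne ((hK.mem_iff _).1 hb h hh) (hcon h hh hp)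
        have hc : Continuous (fun s : ℝ => ⟪h.1, ins i s y⟫) := by
          simp only [inner_ins]; fun_prop
        exact ((hc.continuousAt.eventually_lt continuousAt_const hlt).filter_mono
          nhdsWithin_le_nhds).mono fun t ht => ht.le
      · filter_upwards [self_mem_nhdsWithin] with s hs
        have : b < s := hs
        rw [inner_ins]
        nlinarith
    filter_upwards [this] with t ht
    exact (hK.mem_iff _).2 ht
  obtain ⟨s, hs, hs'⟩ := (hev.and self_mem_nhdsWithin).exists
  exact absurd (hmax s hs) (not_le.2 hs')

lemma exists_bottom (hK : IsPolytope H K) {i : Fin 3} {y : P2} {a : ℝ} (ha : ins i a y ∈ K)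
    (hmin : ∀ s, ins i s y ∈ K → a ≤ s) : ∃ h ∈ H, h.1 i < 0 ∧ ins i a y ∈ plane h := by
  by_contra! hcon
  have hev : ∀ᶠ s in nhdsWithin a (Set.Iio a), ins i s y ∈ K := by
    have : ∀ᶠ s in nhdsWithin a (Set.Iio a), ∀ h ∈ H, ⟪h.1, ins i s y⟫ ≤ h.2 := by
      rw [Filter.eventually_all_finset]
      intro h hh
      have hbh := (hK.mem_iff _).1 ha h hh
      rw [inner_ins] at hbh
      by_cases hp : h.1 i < 0
      · have hlt : ⟪h.1, ins i a y⟫ < h.2 :=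
          lt_of_le_of_ne ((hK.mem_iff _).1 ha h hh) (hcon h hh hp)
        have hc : Continuous (fun s : ℝ => ⟪h.1, ins i s y⟫) := by
          simp only [inner_ins]; fun_prop
        exact ((hc.continuousAt.eventually_lt continuousAt_const hlt).filter_mono
          nhdsWithin_le_nhds).mono fun t ht => ht.le
      · filter_upwards [self_mem_nhdsWithin] with s hs
        have : s < a := hs
        rw [inner_ins]
        nlinarith
    filter_upwards [this] with t ht
    exact (hK.mem_iff _).2 ht
  obtain ⟨s, hs, hs'⟩ := (hev.and self_mem_nhdsWithin).exists
  exact absurd (hmin s hs) (not_le.2 hs')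

/-- For almost every line parallel to the `i`-th axis, no two faces are active at the same
point, and no face parallel to the line is active. -/
lemma ae_transversal (hK : IsPolytope H K) (i : Fin 3) : ∀ᵐ y : P2,
    (∀ h ∈ H, ∀ h' ∈ H, h ≠ h' → h.1 i ≠ 0 → graph i h y ∉ plane h') ∧
    (∀ h ∈ H, h.1 i = 0 → ∀ s, ins i s y ∉ plane h) := by
  refine Filter.Eventually.and ?_ ?_
  · rw [Filter.eventually_all_finset]
    intro h hh
    rw [Filter.eventually_all_finset]
    intro h' hh'
    rw [Filter.eventually_imp_distrib_left]
    intro hne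
    rw [Filter.eventually_imp_distrib_left]
    intro hi
    exact measure_eq_zero_iff_ae_notMem.1 (hK.volume_graph_mem_plane hh hh' hne hi)
  · rw [Filter.eventually_all_finset]
    intro h hh
    rw [Filter.eventually_imp_distrib_left]
    intro hi
    have hne : drop i h.1 ≠ 0 := by
      intro h0
      have : h.1 = 0 := ins_ext i (by simpa using hi) fun j => by
        have := congrArg (fun v : P2 => v j) h0
        simpa using this
      have h1 := hK.unit h hh
      simp [this] at h1
    filter_upwards [measure_eq_zero_iff_ae_notMem.1
      (volume_affine_eq_zero (m := drop i h.1) (d := h.2) (Or.inl hne))] with y hy s hs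
    apply hy
    have hs' : ⟪h.1, ins i s y⟫ = h.2 := hs
    rw [inner_ins, hi, zero_mul, zero_add] at hs'
    rw [PiLp.inner_apply, ← hs']
    simp [mul_comm]

lemma fiber_eq_Icc (hK : IsPolytope H K) {i : Fin 3} {y : P2} (hne : ∃ s, ins i s y ∈ K) :
    ∃ a b : ℝ, ∀ s, ins i s y ∈ K ↔ s ∈ Set.Icc a b := by
  set S : Set ℝ := {s | ins i s y ∈ K} with hS
  have hcont : Continuous (fun s : ℝ => ins i s y) :=
    (continuous_ins i).comp (continuous_const.prodMk continuous_id)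
  have hclosed : IsClosed S := hK.isClosed.preimage hcont
  have hbdd : Bornology.IsBounded S := by
    have h1 : S ⊆ (fun x : P3 => x i) '' K := fun s hs => ⟨_, hs, by simp⟩
    exact (hK.isCompact.image (by fun_prop : Continuous (fun x : P3 => x i))).isBounded.subset h1
  have hcomp : IsCompact S := Metric.isCompact_of_isClosed_isBounded hclosed hbdd
  have hconv : Convex ℝ S := by
    intro s hs t ht a b ha hb hab
    have h1 : ins i (a • s + b • t) y = a • ins i s y + b • ins i t y := by
      refine ins_ext i (by simp) fun j => ?_
      simp only [ins_succAbove, PiLp.add_apply, PiLp.smul_apply, smul_eq_mul]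
      rw [← add_mul, hab, one_mul]
    change ins i (a • s + b • t) y ∈ K
    rw [h1]
    exact hK.convex hs ht ha hb hab
  have hconn : IsConnected S := ⟨hne, hconv.isPreconnected⟩
  refine ⟨sInf S, sSup S, fun s => ?_⟩
  have := eq_Icc_of_connected_compact hconn hcomp
  change s ∈ S ↔ _
  rw [← this]

/-- The one-dimensional fundamental theorem of calculus on the fibers of `K`. -/
lemma fiber_integral (hK : IsPolytope H K)
    {g : P3 → ℝ} {g' : P3 → P3 →L[ℝ] ℝ} (hg : ContinuousOn g K)
    (hg' : ContinuousOn g' K) (hd : ∀ x ∈ interior K, HasFDerivAt g (g' x) x) (i : Fin 3) {y : P2}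
    (h1 : ∀ h ∈ H, ∀ h' ∈ H, h ≠ h' → h.1 i ≠ 0 → graph i h y ∉ plane h')
    (h2 : ∀ h ∈ H, h.1 i = 0 → ∀ s, ins i s y ∉ plane h) :
    ∫ s : ℝ, K.indicator (fun x => g' x (EuclideanSpace.single i 1)) (ins i s y)
      = ∑ h ∈ H, h.1 i / |h.1 i| *
          (graph i h ⁻¹' K).indicator (fun y => g (graph i h y)) y := by
  by_cases hne : ∃ s, ins i s y ∈ K
  swap
  · push Not at hne
    rw [Finset.sum_eq_zero]
    · simp [Set.indicator_of_notMem, hne]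
    · intro h _
      rw [Set.indicator_of_notMem, mul_zero]
      exact hne _
  obtain ⟨a, b, hab⟩ := hK.fiber_eq_Icc hne
  have hle : a ≤ b := by
    obtain ⟨s, hs⟩ := hne
    exact ((hab s).1 hs).1.trans ((hab s).1 hs).2
  have hbK : ins i b y ∈ K := (hab b).2 ⟨hle, le_rfl⟩
  have haK : ins i a y ∈ K := (hab a).2 ⟨le_rfl, hle⟩
  obtain ⟨t, htH, htpos, htp⟩ := hK.exists_top hbK fun s hs => ((hab s).1 hs).2
  obtain ⟨o, hoH, honeg, hop⟩ := hK.exists_bottom haK fun s hs => ((hab s).1 hs).1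
  have hto : t ≠ o := fun h => by rw [h] at htpos; exact absurd htpos honeg.le.not_gt
  have hgt : graph i t y = ins i b y := graph_eq_ins htpos.ne' htp
  have hgo : graph i o y = ins i a y := graph_eq_ins honeg.ne hop
  -- If a = b, a top face and a bottom face would be active at the same point, which transversality
  -- excludes.
  have hlt : a < b := by
    refine lt_of_le_of_ne hle fun he => ?_
    apply h1 t htH o hoH hto htpos.ne'
    rw [hgt, ← he]; exact hop
  have hint : ∀ s ∈ Set.Ioo a b, ins i s y ∈ interior K := by
    intro s hs
    refine hK.mem_interior_of_lt fun h hh => ?_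
    have hb' := (hK.mem_iff _).1 hbK h hh
    have ha' := (hK.mem_iff _).1 haK h hh
    have hs' := (hK.mem_iff _).1 ((hab s).2 ⟨hs.1.le, hs.2.le⟩) h hh
    rcases lt_trichotomy (h.1 i) 0 with hi | hi | hi
    · rw [inner_ins] at *
      nlinarith [hs.1]
    · exact lt_of_le_of_ne hs' (h2 h hh hi s)
    · rw [inner_ins] at *
      nlinarith [hs.2]
  have hcont : Continuous (fun s : ℝ => ins i s y) :=
    (continuous_ins i).comp (continuous_const.prodMk continuous_id)
  have hmaps : Set.MapsTo (fun s : ℝ => ins i s y) (Set.Icc a b) K := fun s hs => (hab s).2 hs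
  have hL : ∫ s : ℝ, K.indicator (fun x => g' x (EuclideanSpace.single i 1)) (ins i s y)
      = g (ins i b y) - g (ins i a y) := by
    have e1 : (fun s : ℝ => K.indicator (fun x => g' x (EuclideanSpace.single i 1)) (ins i s y))
        = (Set.Icc a b).indicator (fun s => g' (ins i s y) (EuclideanSpace.single i 1)) := by
      funext s
      by_cases hs : ins i s y ∈ K
      · rw [Set.indicator_of_mem hs, Set.indicator_of_mem ((hab s).1 hs)]
      · rw [Set.indicator_of_notMem hs, Set.indicator_of_notMem fun h => hs ((hab s).2 h)]
    rw [e1, integral_indicator measurableSet_Icc, integral_Icc_eq_integral_Ioc,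
      ← intervalIntegral.integral_of_le hle]
    refine intervalIntegral.integral_eq_sub_of_hasDerivAt_of_le
      (f := fun s => g (ins i s y)) hle (hg.comp hcont.continuousOn hmaps)
      (fun s hs => hasDerivAt_comp_ins i (hd _ (hint s hs))) ?_
    refine ContinuousOn.intervalIntegrable ?_
    rw [Set.uIcc_of_le hle]
    exact (hg'.comp hcont.continuousOn hmaps).clm_apply continuousOn_const
  -- Only the exit face t, with sign +1, and the entry face o, with sign −1, contribute. The
  -- coefficient of a face parallel to the line is 0 / 0 = 0. Any other face whose graph point over
  -- y lies in K would meet the fiber at an endpoint, hence on t or o, against transversality.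
  rw [hL, Finset.sum_eq_add_of_mem t o htH hoH hto]
  · have m1 : y ∈ graph i t ⁻¹' K := by rw [Set.mem_preimage, hgt]; exact hbK
    have m2 : y ∈ graph i o ⁻¹' K := by rw [Set.mem_preimage, hgo]; exact haK
    rw [Set.indicator_of_mem m1, Set.indicator_of_mem m2, hgt, hgo, abs_of_pos htpos,
      abs_of_neg honeg, div_self htpos.ne', div_neg, div_self honeg.ne]
    ring
  · rintro h hh ⟨hnt, hno⟩
    by_cases hi : h.1 i = 0
    · simp [hi]
    rw [Set.indicator_of_notMem, mul_zero]
    intro hmem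
    have hmem' : ins i (height i h y) y ∈ K := hmem
    have hgp : ⟪h.1, ins i (height i h y) y⟫ = h.2 := graph_mem_plane hi y
    have hI := (hab _).1 hmem'
    rcases lt_or_gt_of_ne hi with hi' | hi'
    · have ha' := (hK.mem_iff _).1 haK h hh
      rw [← hgp, inner_ins, inner_ins] at ha'
      have : height i h y = a := le_antisymm (by nlinarith) hI.1
      refine h1 h hh o hoH hno hi ?_
      rw [graph, this]; exact hop
    · have hb' := (hK.mem_iff _).1 hbK h hh
      rw [← hgp, inner_ins, inner_ins] at hb'
      have : height i h y = b := le_antisymm hI.2 (by nlinarith)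
      refine h1 h hh t htH hnt hi ?_
      rw [graph, this]; exact htp

/-- Fubini along the i-th axis and the fundamental theorem of calculus on each fiber leave the
integral of ± g over the projections of the faces, and n_i / |n_i| dy = n_i dS. Differentiability is
asked for in the interior only, with a derivative that extends continuously to K, because nothing
more is known of the advection field. -/
theorem integral_partial_eq (hK : IsPolytope H K)
    {g : P3 → ℝ} {g' : P3 → P3 →L[ℝ] ℝ} (hg : ContinuousOn g K)
    (hg' : ContinuousOn g' K) (hd : ∀ x ∈ interior K, HasFDerivAt g (g' x) x) (i : Fin 3) :
    ∫ x in K, g' x (EuclideanSpace.single i 1)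
      = ∫ x in frontier K, g x * outwardNormal K x i ∂μHE[2] := by
  have hKm : MeasurableSet K := hK.isClosed.measurableSet
  have hcont : ContinuousOn (fun x => g' x (EuclideanSpace.single i 1)) K :=
    hg'.clm_apply continuousOn_const
  have hint : Integrable (K.indicator fun x => g' x (EuclideanSpace.single i 1)) :=
    (integrable_indicator_iff hKm).2 (hcont.integrableOn_compact hK.isCompact)
  rw [← integral_indicator hKm, integral_eq_integral_ins i hint]
  have hae : (fun y : P2 => ∫ s : ℝ,
      K.indicator (fun x => g' x (EuclideanSpace.single i 1)) (ins i s y)) =ᵐ[volume]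
      fun y => ∑ h ∈ H, h.1 i / |h.1 i| *
          (graph i h ⁻¹' K).indicator (fun y => g (graph i h y)) y :=
    (hK.ae_transversal i).mono fun y hy => hK.fiber_integral hg hg' hd i hy.1 hy.2
  rw [integral_congr_ae hae, hK.integral_frontier_mul hg, integral_finsetSum]
  · refine Finset.sum_congr rfl fun h hh => ?_
    rw [integral_const_mul, integral_indicator ((continuous_graph i h).measurable hKm)]
    by_cases hi : h.1 i = 0
    · simp [hi]
    rw [← setIntegral_plane (hK.unit h hh) hi hKm, ← mul_assoc,
      div_mul_cancel₀ _ (abs_ne_zero.2 hi)]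
  · intro h hh
    by_cases hi : h.1 i = 0
    · simp [hi]
    refine Integrable.const_mul ?_ _
    rw [integrable_indicator_iff ((continuous_graph i h).measurable hKm)]
    -- The parameter domain is the projection of a compact face.
    have hcomp : IsCompact (graph i h ⁻¹' K) := by
      have e : graph i h ⁻¹' K = drop i '' (K ∩ plane h) := by
        ext y
        constructor
        · intro hy
          exact ⟨graph i h y, ⟨hy, graph_mem_plane hi y⟩, by simp [graph]⟩
        · rintro ⟨x, ⟨hx, hxp⟩, rfl⟩
          rw [Set.mem_preimage, graph_drop hi hxp]; exact hx
      rw [e]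
      refine (hK.isCompact.inter_right ?_).image ?_
      · exact isClosed_eq (by fun_prop) (by fun_prop)
      · unfold drop; fun_prop
    exact (hg.comp (continuous_graph i h).continuousOn fun y hy => hy).integrableOn_compact hcomp

end IsPolytope

/-! ### Elements of the mesh -/

/-- A box is the convex hull of its corners, since convex hulls commute with products. Elements are
needed in two forms: by vertices for linear regularity and by half spaces for the divergence
theorem. -/
lemma IsCartesianElement.exists_convexHull {K : Set P3} (hK : IsCartesianElement K) :
    ∃ S : Finset P3, K = convexHull ℝ (S : Set P3) := by
  obtain ⟨a, b, hab, rfl⟩ := hK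
  set T : Set (Fin 3 → ℝ) := Set.univ.pi fun i => {a i, b i} with hT
  have hfin : T.Finite := Set.Finite.pi' (t := fun i => {a i, b i}) (fun i => by simp) |>.subset
    (fun x hx i => hx i trivial)
  set L : (Fin 3 → ℝ) →ₗ[ℝ] P3 := (WithLp.linearEquiv 2 ℝ (Fin 3 → ℝ)).symm.toLinearMap with hL
  refine ⟨(hfin.image L).toFinset, ?_⟩
  rw [Set.Finite.coe_toFinset, ← LinearMap.image_convexHull, hT, convexHull_pi]
  ext x
  simp only [Set.mem_ofPred_eq, Set.mem_image, Set.mem_pi, Set.mem_univ, true_imp_iff,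
    convexHull_pair, fun i => segment_eq_Icc (hab i).le, Set.mem_Icc]
  constructor
  · intro hx
    exact ⟨x.ofLp, hx, rfl⟩
  · rintro ⟨y, hy, rfl⟩
    exact hy

lemma IsSimplexElement.exists_convexHull {K : Set P3} (hK : IsSimplexElement K) :
    ∃ S : Finset P3, K = convexHull ℝ (S : Set P3) := by
  obtain ⟨v, _, rfl⟩ := hK
  exact ⟨(Set.finite_range v).toFinset, by rw [Set.Finite.coe_toFinset]⟩

lemma IsCartesianElement.exists_isPolytope {K : Set P3} (hK : IsCartesianElement K) :
    ∃ H, IsPolytope H K := by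
  obtain ⟨S, hS⟩ := hK.exists_convexHull
  have hcomp : IsCompact K := hS ▸ S.finite_toSet.isCompact_convexHull ℝ
  obtain ⟨a, b, hab, rfl⟩ := hK
  refine ⟨Finset.univ.image (fun i : Fin 3 => ((EuclideanSpace.single i (1 : ℝ) : P3), b i)) ∪
    Finset.univ.image (fun i : Fin 3 => (-(EuclideanSpace.single i (1 : ℝ) : P3), -a i)),
    ?_, ?_, hcomp, ?_⟩
  · intro h hh
    simp only [Finset.mem_union, Finset.mem_image, Finset.mem_univ, true_and] at hh
    rcases hh with ⟨i, rfl⟩ | ⟨i, rfl⟩ <;> simp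
  · intro x
    simp only [Finset.mem_union, Finset.mem_image, Finset.mem_univ, true_and, Set.mem_ofPred_eq]
    constructor
    · rintro hx h (⟨i, rfl⟩ | ⟨i, rfl⟩)
      · simpa [EuclideanSpace.inner_single_left] using (hx i).2
      · simpa [EuclideanSpace.inner_single_left] using (hx i).1
    · intro hx i
      have h1 := hx _ (Or.inl ⟨i, rfl⟩)
      have h2 := hx _ (Or.inr ⟨i, rfl⟩)
      simp [EuclideanSpace.inner_single_left] at h1 h2
      exact ⟨h2, h1⟩
  · have ho : IsOpen {x : P3 | ∀ i, a i < x i ∧ x i < b i} := by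
      simp only [Set.ofPred_forall]
      exact isOpen_iInter_of_finite fun i => IsOpen.and
        (isOpen_lt continuous_const (by fun_prop)) (isOpen_lt (by fun_prop) continuous_const)
    refine ⟨(2 : ℝ)⁻¹ • (a + b), mem_interior.2 ⟨_, ?_, ho, ?_⟩⟩
    · exact fun x hx i => ⟨(hx i).1.le, (hx i).2.le⟩
    · intro i
      have := hab i
      simp only [PiLp.smul_apply, PiLp.add_apply, smul_eq_mul]
      constructor <;> linarith

/-- The simplex is the set where all barycentric coordinates are nonnegative. These are affine
functions, so the half spaces come from their normalized gradients, with the sign reversed. -/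
lemma IsSimplexElement.exists_isPolytope {K : Set P3} (hK : IsSimplexElement K) :
    ∃ H, IsPolytope H K := by
  obtain ⟨v, hv, rfl⟩ := hK
  have htot : affineSpan ℝ (Set.range v) = ⊤ := by
    rw [hv.affineSpan_eq_top_iff_card_eq_finrank_add_one]; simp
  let B : AffineBasis (Fin 4) ℝ P3 := ⟨v, hv, htot⟩
  have hB : (B : Fin 4 → P3) = v := rfl
  let n : Fin 4 → P3 := fun i =>
    (InnerProductSpace.toDual ℝ P3).symm (B.coord i).linear.toContinuousLinearMap
  have hn : ∀ i x, B.coord i x = ⟪n i, x⟫ + B.coord i 0 := by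
    intro i x
    have h1 : ⟪n i, x⟫ = (B.coord i).linear x := by
      simp only [n, InnerProductSpace.toDual_symm_apply]; rfl
    rw [h1]
    have := (B.coord i).map_vadd 0 x
    simpa using this
  -- The i-th barycentric coordinate is 1 at the i-th vertex and 0 at the others, hence not
  -- constant.
  have hn0 : ∀ i, ‖n i‖ ≠ 0 := by
    intro i h0
    have hz : n i = 0 := norm_eq_zero.1 h0
    obtain ⟨j, hj⟩ := exists_ne i
    have h1 := hn i (B i)
    have h2 := hn i (B j)
    rw [B.coord_apply_eq, hz, inner_zero_left] at h1
    rw [B.coord_apply_ne hj.symm, hz, inner_zero_left] at h2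
    linarith
  refine ⟨Finset.univ.image fun i : Fin 4 => (-(‖n i‖⁻¹ • n i), ‖n i‖⁻¹ * B.coord i 0),
    ?_, ?_, (Set.finite_range v).isCompact_convexHull ℝ, ?_⟩
  · intro h hh
    simp only [Finset.mem_image, Finset.mem_univ, true_and] at hh
    obtain ⟨i, rfl⟩ := hh
    simp only [norm_neg, norm_smul, norm_inv, norm_norm]
    exact inv_mul_cancel₀ (hn0 i)
  · intro x
    rw [← hB, B.convexHull_eq_nonneg_coord]
    simp only [Finset.mem_image, Finset.mem_univ, true_and, Set.mem_ofPred_eq,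
      forall_exists_index, forall_apply_eq_imp_iff]
    refine forall_congr' fun i => ?_
    have hpos : 0 < ‖n i‖⁻¹ := inv_pos.2 (lt_of_le_of_ne (norm_nonneg _) (hn0 i).symm)
    rw [hn i x, inner_neg_left, real_inner_smul_left, neg_le_iff_add_nonneg, add_comm,
      ← mul_add, mul_nonneg_iff_of_pos_left hpos]
  · rw [← hB]
    exact ⟨_, B.centroid_mem_interior_convexHull⟩

/-! ### Linear regularity of pairs of polytopes -/

/-- A nonnegative combination of `y` can be reduced, by subtracting a relation between the `y j`,
to one whose total weight is controlled by its norm. -/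
lemma exists_relation_le {J : Type*} [Fintype J] (y : J → P3) :
    ∃ δ > (0 : ℝ), ∀ w : J → ℝ, (∀ j, 0 ≤ w j) → ∃ m : J → ℝ, (∀ j, 0 ≤ m j) ∧ (∀ j, m j ≤ w j) ∧
      ∑ j, m j • y j = 0 ∧ δ * ∑ j, (w j - m j) ≤ ‖∑ j, w j • y j‖ := by
  classical
  -- The faces of the standard simplex. There are finitely many, so one δ bounds the norm of the
  -- combination from below on all faces on which it does not vanish.
  let Δ : Finset J → Set (J → ℝ) := fun s => stdSimplex ℝ J ∩ {c | ∀ j, j ∉ s → c j = 0}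
  have hΔ : ∀ s, IsCompact (Δ s) := by
    intro s
    refine (isCompact_stdSimplex ℝ J).inter_right ?_
    simp only [Set.ofPred_forall]
    exact isClosed_iInter fun j => isClosed_iInter fun _ =>
      isClosed_eq (continuous_apply j) continuous_const
  have hcont : Continuous (fun c : J → ℝ => ∑ j, c j • y j) := by fun_prop
  have hδs : ∀ s : Finset J, (∀ c ∈ Δ s, ∑ j, c j • y j ≠ 0) →
      ∃ d > (0 : ℝ), ∀ c ∈ Δ s, d ≤ ‖∑ j, c j • y j‖ := by
    intro s hs
    rcases (Δ s).eq_empty_or_nonempty with he | hne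
    · exact ⟨1, one_pos, by simp [he]⟩
    · obtain ⟨c, hc, hmin⟩ := (hΔ s).exists_isMinOn hne hcont.norm.continuousOn
      exact ⟨_, norm_pos_iff.2 (hs c hc), fun c' hc' => hmin hc'⟩
  have hδ : ∃ d > (0 : ℝ), ∀ s : Finset J, (∀ c ∈ Δ s, ∑ j, c j • y j ≠ 0) →
      ∀ c ∈ Δ s, d ≤ ‖∑ j, c j • y j‖ := by
    have hev : ∀ᶠ d in nhdsWithin (0 : ℝ) (Set.Ioi 0), ∀ s : Finset J,
        (∀ c ∈ Δ s, ∑ j, c j • y j ≠ 0) → ∀ c ∈ Δ s, d ≤ ‖∑ j, c j • y j‖ := by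
      rw [Filter.eventually_all]
      intro s
      rw [Filter.eventually_imp_distrib_left]
      intro hs
      obtain ⟨d, hd, hd'⟩ := hδs s hs
      filter_upwards [Ioo_mem_nhdsGT hd] with e he c hc
      exact he.2.le.trans (hd' c hc)
    obtain ⟨d, hd, hd'⟩ := (hev.and self_mem_nhdsWithin).exists
    exact ⟨d, hd', hd⟩
  obtain ⟨δ, hδ0, hδ⟩ := hδ
  refine ⟨δ, hδ0, fun w hw => ?_⟩
  -- Let m be a relation below w of maximal total weight. Then no relation is supported where w − m
  -- > 0, since a small multiple of it could be added to m. So the bound δ applies to the normalized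
  -- remainder w − m.
  have hcompact : IsCompact (Set.Icc (0 : J → ℝ) w ∩ {m | ∑ j, m j • y j = 0}) :=
    isCompact_Icc.inter_right (isClosed_eq hcont continuous_const)
  obtain ⟨m, ⟨hm, hm0⟩, hmax⟩ := hcompact.exists_isMaxOn ⟨0, ⟨le_rfl, hw⟩, by simp⟩
    (f := fun m : J → ℝ => ∑ j, m j) (by fun_prop)
  have hm0' : ∑ j, m j • y j = 0 := hm0
  refine ⟨m, hm.1, hm.2, hm0', ?_⟩
  set s : Finset J := Finset.univ.filter fun j => 0 < w j - m j with hs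
  have hnot : ∀ c ∈ Δ s, ∑ j, c j • y j ≠ 0 := by
    rintro c ⟨hc, hcs⟩ h0
    have hev : ∀ᶠ e in nhdsWithin (0 : ℝ) (Set.Ioi 0), ∀ j, e * c j ≤ w j - m j := by
      rw [Filter.eventually_all]
      intro j
      by_cases hj : j ∈ s
      · have hj' : 0 < w j - m j := (Finset.mem_filter.1 hj).2
        have hcj : Filter.Tendsto (fun e : ℝ => e * c j) (nhds 0) (nhds (0 * c j)) :=
          (continuous_id.mul continuous_const).tendsto 0
        rw [zero_mul] at hcj
        exact ((hcj.eventually_lt_const hj').filter_mono nhdsWithin_le_nhds).mono fun _ h => h.le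
      · simp only [hcs j hj, mul_zero]
        exact Filter.Eventually.of_forall fun _ => sub_nonneg.2 (hm.2 j)
    obtain ⟨e, he, he0⟩ := (hev.and self_mem_nhdsWithin).exists
    have he0' : 0 < e := he0
    have hmem : (fun j => m j + e * c j) ∈
        Set.Icc (0 : J → ℝ) w ∩ {m | ∑ j, m j • y j = 0} := by
      refine ⟨⟨fun j => add_nonneg (hm.1 j) (mul_nonneg he0'.le (hc.1 j)), fun j => ?_⟩, ?_⟩
      · have := he j
        change m j + e * c j ≤ w j
        linarith
      · change ∑ j, (m j + e * c j) • y j = 0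
        simp only [add_smul, mul_smul, Finset.sum_add_distrib, ← Finset.smul_sum, hm0', h0]
        simp
    have h1 : ∑ j, (m j + e * c j) ≤ ∑ j, m j := hmax hmem
    rw [Finset.sum_add_distrib, ← Finset.mul_sum, hc.2] at h1
    linarith
  have heq : ∑ j, w j • y j = ∑ j, (w j - m j) • y j := by
    simp only [sub_smul, Finset.sum_sub_distrib, hm0', sub_zero]
  rw [heq]
  set N := ∑ j, (w j - m j) with hN
  have hN0 : 0 ≤ N := Finset.sum_nonneg fun j _ => sub_nonneg.2 (hm.2 j)
  rcases hN0.eq_or_lt with h0 | hpos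
  · rw [← h0, mul_zero]; exact norm_nonneg _
  have hmem : (fun j => N⁻¹ * (w j - m j)) ∈ Δ s := by
    refine ⟨⟨fun j => mul_nonneg (inv_nonneg.2 hN0) (sub_nonneg.2 (hm.2 j)), ?_⟩, fun j hj => ?_⟩
    · rw [← Finset.mul_sum]; exact inv_mul_cancel₀ hpos.ne'
    · have : ¬ 0 < w j - m j := fun h => hj (Finset.mem_filter.2 ⟨Finset.mem_univ _, h⟩)
      have h2 : w j - m j = 0 := le_antisymm (not_lt.1 this) (sub_nonneg.2 (hm.2 j))
      simp only [h2, mul_zero]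
  have h1 := hδ s hnot _ hmem
  simp only [mul_smul] at h1
  rw [← Finset.smul_sum, norm_smul, Real.norm_of_nonneg (inv_nonneg.2 hN0)] at h1
  rw [inv_mul_eq_div, le_div_iff₀ hpos] at h1
  exact h1

/-- Two polytopes meet linearly regularly: points of them that are close to each other are
equally close to a common point. -/
lemma exists_linear_regularity (S T : Finset P3) :
    ∃ C : ℝ, 0 ≤ C ∧ ∀ p ∈ convexHull ℝ (S : Set P3), ∀ q ∈ convexHull ℝ (T : Set P3),
      (∃ r ∈ convexHull ℝ (S : Set P3) ∩ convexHull ℝ (T : Set P3),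
        dist p r ≤ C * dist p q ∧ dist r q ≤ C * dist p q) ∨ 1 ≤ C * dist p q := by
  classical
  -- With product weights, p − q is a convex combination of the differences of vertices x − y. A
  -- relation among these differences is a pair of equal combinations, which becomes a common point
  -- after normalization.
  obtain ⟨δ, hδ, hrel⟩ := exists_relation_le (J := S × T) (fun j => j.1.1 - j.2.1)
  obtain ⟨M, hM⟩ : ∃ M : ℝ, ∀ x ∈ S ∪ T, ‖x‖ ≤ M := by
    obtain ⟨M, hM⟩ := ((S ∪ T).finite_toSet.isBounded).exists_norm_le
    exact ⟨M, fun x hx => hM x hx⟩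
  refine ⟨max (2 * |M| / δ) (1 / δ), le_max_of_le_left (by positivity), fun p hp q hq => ?_⟩
  obtain ⟨a, ha0, ha1, rfl⟩ := Finset.mem_convexHull'.1 hp
  obtain ⟨b, hb0, hb1, rfl⟩ := Finset.mem_convexHull'.1 hq
  rw [← Finset.sum_coe_sort S] at ha1
  rw [← Finset.sum_coe_sort T] at hb1
  rw [← Finset.sum_coe_sort S (fun y => a y • y), ← Finset.sum_coe_sort T (fun y => b y • y)]
  set w : S × T → ℝ := fun j => a j.1 * b j.2 with hw
  have hw0 : ∀ j, 0 ≤ w j := fun j => mul_nonneg (ha0 _ j.1.2) (hb0 _ j.2.2)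
  have hp' : ∑ i : S, a i • (i : P3) = ∑ j, w j • (j.1 : P3) := by
    rw [Fintype.sum_prod_type]
    refine Finset.sum_congr rfl fun i _ => ?_
    simp only [hw, ← Finset.sum_smul, ← Finset.mul_sum, hb1, mul_one]
  have hq' : ∑ i : T, b i • (i : P3) = ∑ j, w j • (j.2 : P3) := by
    rw [Fintype.sum_prod_type_right]
    refine Finset.sum_congr rfl fun i _ => ?_
    simp only [hw, ← Finset.sum_smul, ← Finset.sum_mul, ha1, one_mul]
  have hw1 : ∑ j, w j = 1 := by
    rw [Fintype.sum_prod_type]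
    simp only [hw, ← Finset.mul_sum, hb1, mul_one, ha1]
  obtain ⟨m, hm0, hmw, hmy, hle⟩ := hrel w hw0
  rw [hp', hq', dist_eq_norm, ← Finset.sum_sub_distrib]
  simp only [smul_sub] at hle hmy
  rw [Finset.sum_sub_distrib, hw1] at hle
  set D := ‖∑ j, (w j • (j.1 : P3) - w j • (j.2 : P3))‖ with hD
  have hD0 : 0 ≤ D := norm_nonneg _
  set N := ∑ j, m j with hN
  have hN0 : 0 ≤ N := Finset.sum_nonneg fun j _ => hm0 j
  rcases hN0.eq_or_lt with h0 | hpos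
  -- No part of the combination is a relation, so p and q are at distance at least δ.
  · right
    rw [← h0, sub_zero, mul_one] at hle
    calc (1 : ℝ) = 1 / δ * δ := by field_simp
      _ ≤ max (2 * |M| / δ) (1 / δ) * D := by gcongr; exact le_max_right _ _
  left
  -- The common point: the relation `hmy` allows it to be computed from the vertices of either
  -- polytope.
  set r := ∑ j, (N⁻¹ * m j) • (j.1 : P3) with hr
  have hr' : r = ∑ j, (N⁻¹ * m j) • (j.2 : P3) := by
    rw [Finset.sum_sub_distrib, sub_eq_zero] at hmy
    simp only [hr, mul_smul, ← Finset.smul_sum, hmy]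
  have hwt0 : ∀ j, 0 ≤ N⁻¹ * m j := fun j => mul_nonneg (inv_nonneg.2 hN0) (hm0 j)
  have hwt1 : ∑ j, N⁻¹ * m j = 1 := by rw [← Finset.mul_sum]; exact inv_mul_cancel₀ hpos.ne'
  have hN1 : N ≤ 1 := by rw [← hw1]; exact Finset.sum_le_sum fun j _ => hmw j
  have hbound : ∀ x : S × T → P3, (∀ j, ‖x j‖ ≤ |M|) →
      ‖∑ j, w j • x j - ∑ j, (N⁻¹ * m j) • x j‖ ≤ max (2 * |M| / δ) (1 / δ) * D := by
    intro x hx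
    -- Both the removed part w − m and the excess from dividing m by N have total weight 1 − N, and
    -- δ(1 − N) ≤ dist p q. This is the origin of the constant 2|M| / δ.
    have e1 : ∑ j, w j • x j - ∑ j, (N⁻¹ * m j) • x j
        = ∑ j, (w j - m j) • x j - ∑ j, ((N⁻¹ - 1) * m j) • x j := by
      rw [← Finset.sum_sub_distrib, ← Finset.sum_sub_distrib]
      refine Finset.sum_congr rfl fun j _ => ?_
      rw [← sub_smul, ← sub_smul]; congr 1; ring
    have hinv : 0 ≤ N⁻¹ - 1 := sub_nonneg.2 ((one_le_inv₀ hpos).2 hN1)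
    have e2 : ‖∑ j, (w j - m j) • x j‖ ≤ (1 - N) * |M| := by
      have : (1 - N) = ∑ j, (w j - m j) := by rw [Finset.sum_sub_distrib, hw1]
      rw [this, Finset.sum_mul]
      refine norm_sum_le_of_le _ fun j _ => ?_
      rw [norm_smul, Real.norm_of_nonneg (sub_nonneg.2 (hmw j))]
      exact mul_le_mul_of_nonneg_left (hx j) (sub_nonneg.2 (hmw j))
    have e3 : ‖∑ j, ((N⁻¹ - 1) * m j) • x j‖ ≤ (1 - N) * |M| := by
      have : (1 - N) = ∑ j, (N⁻¹ - 1) * m j := by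
        rw [← Finset.mul_sum, ← hN]; field_simp
      rw [this, Finset.sum_mul]
      refine norm_sum_le_of_le _ fun j _ => ?_
      have h0 := mul_nonneg hinv (hm0 j)
      rw [norm_smul, Real.norm_of_nonneg h0]
      exact mul_le_mul_of_nonneg_left (hx j) h0
    rw [e1]
    calc _ ≤ (1 - N) * |M| + (1 - N) * |M| := (norm_sub_le _ _).trans (add_le_add e2 e3)
      _ = 2 * |M| / δ * (δ * (1 - N)) := by field_simp; ring
      _ ≤ max (2 * |M| / δ) (1 / δ) * D := by
        refine mul_le_mul (le_max_left _ _) hle ?_ (le_max_of_le_left (by positivity))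
        exact mul_nonneg hδ.le (by linarith)
  refine ⟨r, ⟨?_, ?_⟩, ?_, ?_⟩
  · exact (convex_convexHull ℝ _).sum_mem (fun j _ => hwt0 j) hwt1
      fun j _ => subset_convexHull ℝ _ j.1.2
  · rw [hr']
    exact (convex_convexHull ℝ _).sum_mem (fun j _ => hwt0 j) hwt1
      fun j _ => subset_convexHull ℝ _ j.2.2
  · rw [dist_eq_norm]
    exact hbound _ fun j => (hM _ (Finset.mem_union_left _ j.1.2)).trans (le_abs_self M)
  · rw [dist_comm, dist_eq_norm, hr']
    exact hbound _ fun j => (hM _ (Finset.mem_union_right _ j.2.2)).trans (le_abs_self M)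

/-! ### Mesh elements as polytopes, and Lipschitz bounds across elements -/

namespace Mesh

variable {ι : Type*} (M : Mesh ι)

lemma exists_isPolytope (R : ι) : ∃ H, IsPolytope H (M.elem R) :=
  (M.isElement R).elim (fun h => h.exists_isPolytope) fun h => h.exists_isPolytope

lemma exists_convexHull (R : ι) : ∃ S : Finset P3, M.elem R = convexHull ℝ (S : Set P3) :=
  (M.isElement R).elim (fun h => h.exists_convexHull) fun h => h.exists_convexHull

lemma isCompact_elem (R : ι) : IsCompact (M.elem R) :=
  (M.exists_isPolytope R).choose_spec.isCompact

lemma isClosed_elem (R : ι) : IsClosed (M.elem R) := (M.isCompact_elem R).isClosed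

lemma measurableSet_elem (R : ι) : MeasurableSet (M.elem R) := (M.isClosed_elem R).measurableSet

lemma convex_elem (R : ι) : Convex ℝ (M.elem R) :=
  (M.exists_isPolytope R).choose_spec.convex

lemma nonempty_interior_elem (R : ι) : (interior (M.elem R)).Nonempty :=
  (M.exists_isPolytope R).choose_spec.nonempty_interior

/-- Piecewise smooth functions that agree wherever elements meet are Lipschitz on the closed
domain. -/
lemma exists_lipschitz [Finite ι] {E : Type*} [NormedAddCommGroup E] [NormedSpace ℝ E]
    {v : ι → P3 → E} (hv : ∀ R, ContDiff ℝ 1 (v R))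
    (hvv : ∀ R R', ∀ x ∈ M.elem R ∩ M.elem R', v R x = v R' x) :
    ∃ L : ℝ, 0 ≤ L ∧ ∀ R R', ∀ p ∈ M.elem R, ∀ q ∈ M.elem R', ‖v R p - v R' q‖ ≤ L * dist p q := by
  have key : ∀ z : ι × ι, ∃ L : ℝ, 0 ≤ L ∧ ∀ p ∈ M.elem z.1, ∀ q ∈ M.elem z.2,
      ‖v z.1 p - v z.2 q‖ ≤ L * dist p q := by
    rintro ⟨R, R'⟩
    obtain ⟨S, hS⟩ := M.exists_convexHull R
    obtain ⟨T, hT⟩ := M.exists_convexHull R'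
    obtain ⟨C, hC0, hC⟩ := exists_linear_regularity S T
    obtain ⟨K1, hK1⟩ := LocallyLipschitzOn.exists_lipschitzOnWith_of_compact
      (M.isCompact_elem R) ((hv R).locallyLipschitz.locallyLipschitzOn)
    obtain ⟨K2, hK2⟩ := LocallyLipschitzOn.exists_lipschitzOnWith_of_compact
      (M.isCompact_elem R') ((hv R').locallyLipschitz.locallyLipschitzOn)
    obtain ⟨B1, hB1⟩ :=
      (M.isCompact_elem R).exists_bound_of_continuousOn (hv R).continuous.continuousOn
    obtain ⟨B2, hB2⟩ :=
      (M.isCompact_elem R').exists_bound_of_continuousOn (hv R').continuous.continuousOn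
    refine ⟨(K1 + K2 + |B1| + |B2|) * C, by positivity, fun p hp q hq => ?_⟩
    have hd : 0 ≤ C * dist p q := mul_nonneg hC0 dist_nonneg
    rw [mul_assoc]
    -- Either one passes through a common point r, where the two pieces agree, or p and q are so far
    -- apart that boundedness of the pieces suffices.
    rcases hC p (hS ▸ hp) q (hT ▸ hq) with ⟨r, hr, h1, h2⟩ | h
    · rw [← hS, ← hT] at hr
      have e1 : ‖v R p - v R r‖ ≤ K1 * (C * dist p q) := by
        rw [← dist_eq_norm]
        exact (hK1.dist_le_mul p hp r hr.1).trans (by gcongr)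
      have e2 : ‖v R' r - v R' q‖ ≤ K2 * (C * dist p q) := by
        rw [← dist_eq_norm]
        exact (hK2.dist_le_mul r hr.2 q hq).trans (by gcongr)
      have e3 : v R p - v R' q = (v R p - v R r) + (v R' r - v R' q) := by
        rw [hvv R R' r hr]; abel
      rw [e3]
      refine (norm_add_le _ _).trans ((add_le_add e1 e2).trans ?_)
      rw [← add_mul]
      refine mul_le_mul_of_nonneg_right ?_ hd
      linarith [abs_nonneg B1, abs_nonneg B2]
    · have e1 := (hB1 p hp).trans (le_abs_self B1)
      have e2 := (hB2 q hq).trans (le_abs_self B2)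
      calc ‖v R p - v R' q‖ ≤ |B1| + |B2| := (norm_sub_le _ _).trans (add_le_add e1 e2)
        _ ≤ (|B1| + |B2|) * (C * dist p q) := le_mul_of_one_le_right (by positivity) h
        _ ≤ _ := by
          refine mul_le_mul_of_nonneg_right ?_ hd
          linarith [K1.coe_nonneg, K2.coe_nonneg]
  choose L hL0 hL using key
  obtain ⟨B, hB⟩ := Set.Finite.bddAbove (Set.finite_range L)
  refine ⟨max B 0, le_max_right _ _, fun R R' p hp q hq => (hL (R, R') p hp q hq).trans ?_⟩
  gcongr
  exact (hB ⟨(R, R'), rfl⟩).trans (le_max_left _ _)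

end Mesh

/-! ### Weakly singular integrals -/

/-- In polar coordinates the integrand is r^(2+α), which is integrable at 0 exactly when α > −3. -/
lemma integrableOn_norm_rpow {α : ℝ} (hα : -3 < α) (r : ℝ) :
    IntegrableOn (fun x : P3 => ‖x‖ ^ α) (Metric.ball 0 r) := by
  rcases le_or_gt r 0 with hr | hr
  · rw [Metric.ball_eq_empty.2 hr]; exact integrableOn_empty
  rw [integrableOn_fun_norm_addHaar volume (f := fun y : ℝ => y ^ α)]
  have h1 : IntegrableOn (fun y : ℝ => y ^ (2 + α)) (Set.Ioo 0 r) :=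
    (intervalIntegral.integrableOn_Ioo_rpow_iff hr).2 (by linarith)
  refine h1.congr_fun (fun y hy => ?_) measurableSet_Ioo
  simp only [finrank_euclideanSpace_fin, smul_eq_mul]
  rw [Real.rpow_add hy.1]
  norm_num

lemma integrable_indicator_norm_rpow {α : ℝ} (hα : -3 < α) (r : ℝ) :
    Integrable ((Metric.ball (0 : P3) r).indicator fun x => ‖x‖ ^ α) :=
  (integrable_indicator_iff Metric.isOpen_ball.measurableSet).2 (integrableOn_norm_rpow hα r)

lemma exists_dist_lt {A B : Set P3} (hA : Bornology.IsBounded A) (hB : Bornology.IsBounded B) :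
    ∃ r : ℝ, ∀ p ∈ A, ∀ q ∈ B, dist p q < r := by
  obtain ⟨a, ha⟩ := hA.exists_norm_le
  obtain ⟨b, hb⟩ := hB.exists_norm_le
  refine ⟨a + b + 1, fun p hp q hq => ?_⟩
  have := dist_le_norm_add_norm p q
  linarith [ha p hp, hb q hq]

/-- Powers `dist p q ^ α` with `α > -3` are integrable in `q`, uniformly in `p`. -/
lemma exists_integral_dist_rpow_le {α : ℝ} (hα : -3 < α) {A B : Set P3}
    (hA : Bornology.IsBounded A) (hB : Bornology.IsBounded B) :
    ∃ N : ℝ, 0 ≤ N ∧ ∀ p ∈ A, IntegrableOn (fun q => dist p q ^ α) B ∧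
      ∫ q in B, dist p q ^ α ≤ N := by
  obtain ⟨r, hr⟩ := exists_dist_lt hA hB
  -- The cutoff radius exceeds all distances between A and B. So q ↦ G(p − q) dominates the power on
  -- B, and its integral N does not depend on p.
  set G : P3 → ℝ := (Metric.ball (0 : P3) r).indicator fun x => ‖x‖ ^ α with hG
  have hG0 : ∀ x, 0 ≤ G x := fun x => Set.indicator_nonneg (fun y _ => by positivity) x
  refine ⟨∫ x, G x, integral_nonneg hG0, fun p hp => ?_⟩
  have hint : Integrable (fun q => G (p - q)) :=
    (integrable_indicator_norm_rpow hα r).comp_sub_left p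
  have hGle : ∀ q, G (p - q) = (Metric.ball p r).indicator (fun q => dist p q ^ α) q := by
    intro q
    simp only [hG, Set.indicator, Metric.mem_ball, dist_zero_right]
    rw [← dist_eq_norm, dist_comm q p]
  have hBs : B ⊆ Metric.ball p r := fun q hq => by
    rw [Metric.mem_ball, dist_comm]; exact hr p hp q hq
  have hball : IntegrableOn (fun q => dist p q ^ α) (Metric.ball p r) := by
    rw [← integrable_indicator_iff Metric.isOpen_ball.measurableSet]
    exact hint.congr (Filter.Eventually.of_forall hGle)
  refine ⟨hball.mono_set hBs, ?_⟩
  calc ∫ q in B, dist p q ^ α ≤ ∫ q in Metric.ball p r, dist p q ^ α :=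
        setIntegral_mono_set hball (Filter.Eventually.of_forall fun q => by positivity)
          (Filter.Eventually.of_forall hBs)
    _ = ∫ q, G (p - q) := by
        rw [← integral_indicator Metric.isOpen_ball.measurableSet]
        exact integral_congr_ae (Filter.Eventually.of_forall fun q => (hGle q).symm)
    _ = ∫ x, G x := integral_sub_left_eq_self G volume p

lemma isOpen_offDiag : IsOpen {z : P3 × P3 | z.1 ≠ z.2} :=
  isOpen_ne_fun continuous_fst continuous_snd

section Singular

variable {E : Type*} [NormedAddCommGroup E]

/-- Nothing is assumed on the diagonal; for fixed p this concerns the single point q = p, a null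
set. -/
lemma aestronglyMeasurable_of_offDiag {h : P3 → P3 → E}
    (hc : ContinuousOn (fun z : P3 × P3 => h z.1 z.2) {z | z.1 ≠ z.2}) (p : P3) :
    AEStronglyMeasurable (h p) volume := by
  have h1 : ContinuousOn (h p) {p}ᶜ :=
    hc.comp (f := fun q => (p, q)) (by fun_prop) fun q hq => fun he => hq (Eq.symm he)
  have h2 := h1.aestronglyMeasurable (μ := volume) (measurableSet_singleton p).compl
  rwa [restrict_compl_singleton] at h2

lemma ae_ne (p : P3) : ∀ᵐ q : P3, p ≠ q := by
  have : ∀ᵐ q : P3, q ∉ ({p} : Set P3) := measure_eq_zero_iff_ae_notMem.1 (measure_singleton p)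
  exact this.mono fun q hq he => hq he.symm

lemma integrableOn_of_singular {h : P3 → P3 → E} {α C : ℝ} (hα : -3 < α)
    (hc : ContinuousOn (fun z : P3 × P3 => h z.1 z.2) {z | z.1 ≠ z.2}) {p : P3} {B : Set P3}
    (hB : Bornology.IsBounded B) (hBm : MeasurableSet B)
    (hb : ∀ q ∈ B, p ≠ q → ‖h p q‖ ≤ C * dist p q ^ α) : IntegrableOn (h p) B := by
  obtain ⟨N, -, hN⟩ := exists_integral_dist_rpow_le hα (A := {p}) Bornology.isBounded_singleton hB
  refine Integrable.mono' ((hN p rfl).1.const_mul C)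
    (aestronglyMeasurable_of_offDiag hc p).restrict ?_
  filter_upwards [ae_restrict_mem hBm, ae_restrict_of_ae (ae_ne p)] with q hq hpq
  exact hb q hq hpq

lemma integral_norm_le_of_singular {h : P3 → P3 → E} {α C : ℝ}
    (hc : ContinuousOn (fun z : P3 × P3 => h z.1 z.2) {z | z.1 ≠ z.2}) {p : P3} {B : Set P3}
    (hint : IntegrableOn (fun q => dist p q ^ α) B) (hBm : MeasurableSet B)
    (hb : ∀ q ∈ B, p ≠ q → ‖h p q‖ ≤ C * dist p q ^ α) :
    ∫ q in B, ‖h p q‖ ≤ C * ∫ q in B, dist p q ^ α := by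
  rw [← integral_const_mul]
  have hae : ∀ᵐ q ∂(volume.restrict B), ‖h p q‖ ≤ C * dist p q ^ α := by
    filter_upwards [ae_restrict_mem hBm, ae_restrict_of_ae (ae_ne p)] with q hq hpq
    exact hb q hq hpq
  refine integral_mono_ae ?_ (hint.const_mul C) hae
  exact Integrable.mono' (hint.const_mul C)
    (aestronglyMeasurable_of_offDiag hc p).norm.restrict (by simpa using hae)

/-- A weakly singular integral over a convex set is a continuous function of the parameter. -/
lemma continuousOn_singularIntegral [NormedSpace ℝ E] {h : P3 → P3 → E} {α C : ℝ} (hα : -3 < α)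
    (hc : ContinuousOn (fun z : P3 × P3 => h z.1 z.2) {z | z.1 ≠ z.2}) {A B : Set P3}
    (hA : Bornology.IsBounded A) (hB : IsCompact B) (hBc : Convex ℝ B)
    (hb : ∀ p ∈ A, ∀ q ∈ B, p ≠ q → ‖h p q‖ ≤ C * dist p q ^ α) :
    ContinuousOn (fun p => ∫ q in B, h p q) A := by
  obtain ⟨r, hr⟩ := exists_dist_lt hA hB.isBounded
  have hBm := hB.measurableSet
  -- The substitution x = p − q fixes the singularity at x = 0, so that |C| ‖x‖^α on a ball
  -- dominates for all p at once. The price is an indicator that moves with p.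
  have hrw : (fun p => ∫ q in B, h p q) = fun p => ∫ x, B.indicator (h p) (p - x) := by
    funext p
    rw [← integral_indicator hBm, integral_sub_left_eq_self (B.indicator (h p)) volume p]
  rw [hrw]
  intro p₀ hp₀
  refine continuousWithinAt_of_dominated
    (bound := fun x => |C| * (Metric.ball (0 : P3) r).indicator (fun x => ‖x‖ ^ α) x) ?_ ?_
    ((integrable_indicator_norm_rpow hα r).const_mul _) ?_
  · refine Filter.Eventually.of_forall fun p => ?_
    have h1 := (aestronglyMeasurable_of_offDiag hc p).indicator hBm
    exact h1.comp_quasiMeasurePreserving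
      (Measure.measurePreserving_sub_left volume p).quasiMeasurePreserving
  · filter_upwards [self_mem_nhdsWithin] with p hp
    filter_upwards [ae_ne 0] with x hx
    by_cases hxB : p - x ∈ B
    · have hne : p ≠ p - x := fun he => hx (sub_eq_self.1 he.symm).symm
      have hd : dist p (p - x) = ‖x‖ := by rw [dist_eq_norm, sub_sub_cancel]
      have hlt := hr p hp _ hxB
      have hle := hb p hp _ hxB hne
      rw [hd] at hlt hle
      rw [Set.indicator_of_mem hxB, Set.indicator_of_mem (by simpa using hlt)]
      exact hle.trans (mul_le_mul_of_nonneg_right (le_abs_self C) (by positivity))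
    · rw [Set.indicator_of_notMem hxB, norm_zero]
      exact mul_nonneg (abs_nonneg _) (Set.indicator_nonneg (fun y _ => by positivity) x)
  -- The moving indicator is locally constant in p unless p₀ − x lies on the boundary of B, a null
  -- set because B is convex.
  · have hfr : ∀ᵐ x : P3, p₀ - x ∉ frontier B :=
      (Measure.measurePreserving_sub_left volume p₀).quasiMeasurePreserving.ae
        (measure_eq_zero_iff_ae_notMem.1 (hBc.addHaar_frontier volume))
    filter_upwards [ae_ne 0, hfr] with x hx hxf
    have hcs : Continuous (fun p : P3 => p - x) := by fun_prop
    have hoff : p₀ ≠ p₀ - x := fun he => hx (sub_eq_self.1 he.symm).symm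
    by_cases hxB : p₀ - x ∈ B
    · have hxi : p₀ - x ∈ interior B := by
        by_contra hcon
        exact hxf (by rw [hB.isClosed.frontier_eq]; exact ⟨hxB, hcon⟩)
      have hcc : ContinuousAt (fun p => h p (p - x)) p₀ := by
        have h1 : ContinuousAt (fun z : P3 × P3 => h z.1 z.2) (p₀, p₀ - x) :=
          hc.continuousAt (isOpen_offDiag.mem_nhds hoff)
        exact ContinuousAt.comp (f := fun p : P3 => (p, p - x)) h1 (by fun_prop)
      refine (hcc.congr ?_).continuousWithinAt
      filter_upwards [hcs.continuousAt.eventually_mem (isOpen_interior.mem_nhds hxi)] with p hp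
      rw [Set.indicator_of_mem (interior_subset hp)]
    · have hev : ∀ᶠ p in nhds p₀, p - x ∈ Bᶜ :=
        hcs.continuousAt.eventually_mem (hB.isClosed.isOpen_compl.mem_nhds hxB)
      have hcc : ContinuousAt (fun _ : P3 => (0 : E)) p₀ := continuousAt_const
      refine (hcc.congr ?_).continuousWithinAt
      filter_upwards [hev] with p hp
      rw [Set.indicator_of_notMem hp]

end Singular

/-! ### Differentiation of weakly singular integrals -/

section Derivative

variable {h : P3 → P3 → P3}

lemma hasFDerivAt_left
    (hC : ContDiffOn ℝ 1 (fun z : P3 × P3 => h z.1 z.2) {z | z.1 ≠ z.2})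
    {p q : P3} (hpq : p ≠ q) :
    HasFDerivAt (fun p' => h p' q)
      ((fderiv ℝ (fun z : P3 × P3 => h z.1 z.2) (p, q)).comp (ContinuousLinearMap.inl ℝ P3 P3))
      p := by
  have h1 : DifferentiableAt ℝ (fun z : P3 × P3 => h z.1 z.2) (p, q) :=
    (hC.differentiableOn one_ne_zero).differentiableAt (isOpen_offDiag.mem_nhds hpq)
  have h2 : HasFDerivAt (fun p' : P3 => (p', q)) (ContinuousLinearMap.inl ℝ P3 P3) p :=
    hasFDerivAt_prodMk_left p q
  exact h1.hasFDerivAt.comp p h2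

lemma continuousOn_fderiv_left
    (hC : ContDiffOn ℝ 1 (fun z : P3 × P3 => h z.1 z.2) {z | z.1 ≠ z.2}) :
    ContinuousOn (fun z : P3 × P3 => fderiv ℝ (fun p' => h p' z.2) z.1) {z | z.1 ≠ z.2} := by
  have h1 : ContinuousOn (fderiv ℝ (fun z : P3 × P3 => h z.1 z.2)) {z | z.1 ≠ z.2} :=
    hC.continuousOn_fderiv_of_isOpen isOpen_offDiag le_rfl
  refine (h1.clm_comp (continuousOn_const (c := ContinuousLinearMap.inl ℝ P3 P3))).congr ?_
  intro z hz
  exact (hasFDerivAt_left hC hz).fderiv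

/-- For almost every q, the line through p with direction w avoids q, so that the integrand is
continuously differentiable along it. -/
lemma volume_line (p w : P3) : volume {q : P3 | ∃ s : ℝ, q = p + s • w} = 0 := by
  have hne : Submodule.span ℝ {w} ≠ (⊤ : Submodule ℝ P3) := by
    intro he
    have h1 := finrank_span_le_card (R := ℝ) ({w} : Set P3)
    rw [he, finrank_top, finrank_euclideanSpace_fin] at h1
    simp at h1
  have h0 := Measure.addHaar_submodule (volume : Measure P3) _ hne
  rw [← measure_preimage_add_right volume (-p)] at h0
  refine measure_mono_null ?_ h0
  rintro q ⟨s, rfl⟩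
  simp only [Set.mem_preimage, SetLike.mem_coe]
  rw [add_neg_cancel_comm]
  exact Submodule.smul_mem _ _ (Submodule.mem_span_singleton_self w)

/-- The fundamental theorem of calculus for a weakly singular integral. -/
lemma singularIntegral_sub
    (hC : ContDiffOn ℝ 1 (fun z : P3 × P3 => h z.1 z.2) {z | z.1 ≠ z.2})
    {α β C : ℝ} (hα : -3 < α) (hβ : -3 < β) {A B : Set P3}
    (hA : Bornology.IsBounded A) (hAc : Convex ℝ A) (hB : IsCompact B)
    (hb : ∀ p ∈ A, ∀ q ∈ B, p ≠ q → ‖h p q‖ ≤ C * dist p q ^ β)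
    (hb' : ∀ p ∈ A, ∀ q ∈ B, p ≠ q → ‖fderiv ℝ (fun p' => h p' q) p‖ ≤ C * dist p q ^ α)
    {p w : P3} (hp : p ∈ A) (hpw : p + w ∈ A) :
    (∫ q in B, h (p + w) q) - ∫ q in B, h p q
      = ∫ s in (0 : ℝ)..1, (∫ q in B, fderiv ℝ (fun p' => h p' q) (p + s • w)) w := by
  classical
  set D : P3 → P3 → P3 →L[ℝ] P3 := fun p q => fderiv ℝ (fun p' => h p' q) p with hD
  have hDc : ContinuousOn (fun z : P3 × P3 => D z.1 z.2) {z | z.1 ≠ z.2} :=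
    continuousOn_fderiv_left hC
  have hBm := hB.measurableSet
  have hseg : ∀ s ∈ Set.Icc (0 : ℝ) 1, p + s • w ∈ A := by
    intro s hs
    have : p + s • w = (1 - s) • p + s • (p + w) := by
      rw [sub_smul, smul_add, one_smul]; abel
    rw [this]
    exact hAc hp hpw (by linarith [hs.2]) hs.1 (by ring)
  obtain ⟨N, hN0, hN⟩ := exists_integral_dist_rpow_le hα hA hB.isBounded
  -- Setting the derivative to 0 on the diagonal gives a Borel function on the whole product, as
  -- Fubini requires, and changes no integral over q.
  set D' : P3 × P3 → P3 →L[ℝ] P3 := {z : P3 × P3 | z.1 ≠ z.2}.piecewise (fun z => D z.1 z.2) 0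
    with hD'
  have hD'm : Measurable D' :=
    hDc.measurable_piecewise continuousOn_const isOpen_offDiag.measurableSet
  have hD'eq : ∀ p q, p ≠ q → D' (p, q) = D p q := fun p q hpq =>
    Set.piecewise_eq_of_mem (s := {z : P3 × P3 | z.1 ≠ z.2}) _ _ hpq
  have hint1 : ∀ x ∈ A, IntegrableOn (D x) B := fun x hx =>
    integrableOn_of_singular hα hDc hB.isBounded hBm (hb' x hx)
  have hint1' : ∀ x ∈ A, IntegrableOn (fun q => D' (x, q)) B := fun x hx =>
    (hint1 x hx).congr (ae_restrict_of_ae ((ae_ne x).mono fun q hq => (hD'eq x q hq).symm))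
  set F : ℝ × P3 → P3 := fun z => D' (p + z.1 • w, z.2) w with hF
  have hFm : Measurable F := by
    have h1 : Measurable (fun z : ℝ × P3 => D' (p + z.1 • w, z.2)) :=
      hD'm.comp (by fun_prop)
    exact (ContinuousLinearMap.apply ℝ P3 w).continuous.measurable.comp h1
  have hFint : Integrable F ((volume.restrict (Set.Ioc (0 : ℝ) 1)).prod (volume.restrict B)) := by
    rw [integrable_prod_iff hFm.aestronglyMeasurable]
    refine ⟨?_, ?_⟩
    · filter_upwards [ae_restrict_mem measurableSet_Ioc] with s hs
      exact (hint1' _ (hseg s (Set.Ioc_subset_Icc_self hs))).apply_continuousLinearMap w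
    · refine Integrable.of_bound (C := |C| * N * ‖w‖)
        hFm.norm.stronglyMeasurable.integral_prod_right.aestronglyMeasurable ?_
      filter_upwards [ae_restrict_mem measurableSet_Ioc] with s hs
      have hs' := hseg s (Set.Ioc_subset_Icc_self hs)
      rw [Real.norm_of_nonneg (integral_nonneg fun _ => norm_nonneg _)]
      calc ∫ q in B, ‖F (s, q)‖ ≤ ∫ q in B, ‖D (p + s • w) q‖ * ‖w‖ := by
            refine integral_mono_ae
              ((hint1' _ hs').apply_continuousLinearMap w).norm ((hint1 _ hs').norm.mul_const _) ?_
            filter_upwards [ae_restrict_of_ae (ae_ne (p + s • w))] with q hq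
            simp only [hF, hD'eq _ _ hq]
            exact ContinuousLinearMap.le_opNorm _ _
        _ = (∫ q in B, ‖D (p + s • w) q‖) * ‖w‖ := integral_mul_const _ _
        _ ≤ |C| * N * ‖w‖ := by
            refine mul_le_mul_of_nonneg_right ?_ (norm_nonneg _)
            refine (integral_norm_le_of_singular hDc (hN _ hs').1 hBm (hb' _ hs')).trans ?_
            have h0 : 0 ≤ ∫ q in B, dist (p + s • w) q ^ α :=
              integral_nonneg fun _ => by positivity
            exact (mul_le_mul_of_nonneg_right (le_abs_self C) h0).trans
              (mul_le_mul_of_nonneg_left (hN _ hs').2 (abs_nonneg _))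
  have hswap := integral_integral_swap (f := fun s q => F (s, q)) hFint
  have hI : ∀ x ∈ A, IntegrableOn (h x) B := fun x hx =>
    integrableOn_of_singular hβ hC.continuousOn hB.isBounded hBm (hb x hx)
  rw [← integral_sub (hI _ hpw) (hI _ hp), intervalIntegral.integral_of_le zero_le_one]
  have hL : ∫ s in Set.Ioc (0 : ℝ) 1, (∫ q in B, D (p + s • w) q) w
      = ∫ s in Set.Ioc (0 : ℝ) 1, ∫ q in B, F (s, q) := by
    refine setIntegral_congr_fun measurableSet_Ioc fun s hs => ?_
    have hs' := hseg s (Set.Ioc_subset_Icc_self hs)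
    change (∫ q in B, D (p + s • w) q) w = ∫ q in B, F (s, q)
    rw [ContinuousLinearMap.integral_apply (hint1 _ hs')]
    refine integral_congr_ae ?_
    filter_upwards [ae_restrict_of_ae (ae_ne (p + s • w))] with q hq
    simp only [hF, hD'eq _ _ hq]
  rw [hL, hswap]
  refine integral_congr_ae ?_
  -- After the exchange of integrals, q is fixed off the line and the inner integral over s is the
  -- ordinary fundamental theorem of calculus.
  filter_upwards [ae_restrict_of_ae (measure_eq_zero_iff_ae_notMem.1 (volume_line p w))] with q hq
  have hne : ∀ s : ℝ, p + s • w ≠ q := fun s hs => hq ⟨s, hs.symm⟩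
  have hderiv : ∀ s : ℝ, HasDerivAt (fun s : ℝ => h (p + s • w) q) (F (s, q)) s := by
    intro s
    have h1 := (hasFDerivAt_left hC (hne s)).differentiableAt.hasFDerivAt
    have h2 : HasDerivAt (fun s : ℝ => p + s • w) w s := by
      simpa using ((hasDerivAt_id s).smul_const w).const_add p
    have h3 := h1.comp_hasDerivAt s h2
    simp only [hF, hD'eq _ _ (hne s)]
    exact h3
  have hcont : Continuous (fun s : ℝ => F (s, q)) := by
    have h1 : Continuous (fun s : ℝ => D (p + s • w) q) :=
      hDc.comp_continuous (f := fun s : ℝ => (p + s • w, q)) (by fun_prop) fun s => hne s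
    have h2 : (fun s : ℝ => F (s, q)) = fun s => D (p + s • w) q w := by
      funext s; simp only [hF, hD'eq _ _ (hne s)]
    rw [h2]
    exact h1.clm_apply continuous_const
  have := intervalIntegral.integral_eq_sub_of_hasDerivAt (a := 0) (b := 1)
    (fun s _ => hderiv s) (hcont.intervalIntegrable _ _)
  rw [intervalIntegral.integral_of_le zero_le_one] at this
  rw [this]
  simp

/-- Differentiation of a weakly singular integral with respect to the parameter. -/
theorem hasFDerivAt_singularIntegral
    (hC : ContDiffOn ℝ 1 (fun z : P3 × P3 => h z.1 z.2) {z | z.1 ≠ z.2})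
    {α β C : ℝ} (hα : -3 < α) (hβ : -3 < β) {A B : Set P3}
    (hA : Bornology.IsBounded A) (hAc : Convex ℝ A) (hB : IsCompact B) (hBc : Convex ℝ B)
    (hb : ∀ p ∈ A, ∀ q ∈ B, p ≠ q → ‖h p q‖ ≤ C * dist p q ^ β)
    (hb' : ∀ p ∈ A, ∀ q ∈ B, p ≠ q → ‖fderiv ℝ (fun p' => h p' q) p‖ ≤ C * dist p q ^ α)
    {p₀ : P3} (hp₀ : p₀ ∈ interior A) :
    HasFDerivAt (fun p => ∫ q in B, h p q) (∫ q in B, fderiv ℝ (fun p' => h p' q) p₀) p₀ := by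
  set V : P3 → P3 →L[ℝ] P3 := fun p => ∫ q in B, fderiv ℝ (fun p' => h p' q) p with hV
  have hVc : ContinuousOn V A :=
    continuousOn_singularIntegral hα (continuousOn_fderiv_left hC) hA hB hBc hb'
  have hVat : ContinuousAt V p₀ := hVc.continuousAt (mem_interior_iff_mem_nhds.1 hp₀)
  -- The increment is the mean of V along the segment applied to w, and V is continuous at p₀; so
  -- the error is at most c ‖w‖ for p close to p₀.
  refine HasFDerivAt.of_isLittleO (Asymptotics.isLittleO_iff.2 fun c hc => ?_)
  have hev := (Metric.continuousAt_iff.1 hVat) c hc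
  obtain ⟨ε, hε, hεV⟩ := hev
  obtain ⟨ε', hε', hεA⟩ := Metric.mem_nhds_iff.1 (mem_interior_iff_mem_nhds.1 hp₀)
  filter_upwards [Metric.ball_mem_nhds p₀ (lt_min hε hε')] with p hp
  have hpd : dist p p₀ < min ε ε' := hp
  set w := p - p₀ with hw
  have hpw : p = p₀ + w := by rw [hw]; abel
  have hwn : ‖w‖ = dist p p₀ := (dist_eq_norm p p₀).symm
  have hball : ∀ s ∈ Set.Icc (0 : ℝ) 1, dist (p₀ + s • w) p₀ < min ε ε' := by
    intro s hs
    rw [dist_eq_norm, add_sub_cancel_left, norm_smul, Real.norm_of_nonneg hs.1, hwn]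
    exact lt_of_le_of_lt (mul_le_of_le_one_left dist_nonneg hs.2) hpd
  have hmemA : ∀ s ∈ Set.Icc (0 : ℝ) 1, p₀ + s • w ∈ A := fun s hs =>
    hεA (lt_of_lt_of_le (hball s hs) (min_le_right _ _))
  have hA0 : p₀ ∈ A := interior_subset hp₀
  have hA1 : p₀ + w ∈ A := by simpa using hmemA 1 ⟨zero_le_one, le_rfl⟩
  have hsub := singularIntegral_sub hC hα hβ hA hAc hB hb hb' hA0 hA1
  have hVint : IntervalIntegrable (fun s : ℝ => V (p₀ + s • w) w) volume 0 1 := by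
    refine ContinuousOn.intervalIntegrable ?_
    rw [Set.uIcc_of_le zero_le_one]
    exact (hVc.comp (by fun_prop) hmemA).clm_apply continuousOn_const
  rw [hpw, hsub]
  have e : (∫ s in (0 : ℝ)..1, V (p₀ + s • w) w) - V p₀ w
      = ∫ s in (0 : ℝ)..1, (V (p₀ + s • w) w - V p₀ w) := by
    rw [intervalIntegral.integral_sub hVint (by simp)]
    simp
  change ‖(∫ s in (0 : ℝ)..1, V (p₀ + s • w) w) - V p₀ w‖ ≤ c * ‖w‖
  rw [e]
  have hle := intervalIntegral.norm_integral_le_of_norm_le_const (a := (0 : ℝ)) (b := 1)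
    (f := fun s => V (p₀ + s • w) w - V p₀ w) (C := c * ‖w‖) ?_
  · simpa using hle
  · intro s hs
    rw [Set.uIoc_of_le zero_le_one] at hs
    have h1 := hεV (lt_of_lt_of_le (hball s (Set.Ioc_subset_Icc_self hs)) (min_le_left _ _))
    rw [dist_eq_norm] at h1
    rw [← _root_.sub_apply]
    exact (ContinuousLinearMap.le_opNorm _ _).trans
      (mul_le_mul_of_nonneg_right h1.le (norm_nonneg _))

end Derivative

/-! ### Integration by parts on an element -/

namespace IsPolytope

variable {H : Finset (P3 × ℝ)} {K : Set P3}

lemma ae_mem_interior (hK : IsPolytope H K) : ∀ᵐ x ∂(volume.restrict K), x ∈ interior K := by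
  have h0 : ∀ᵐ x : P3, x ∉ frontier K :=
    measure_eq_zero_iff_ae_notMem.1 (hK.convex.addHaar_frontier volume)
  filter_upwards [ae_restrict_mem hK.isClosed.measurableSet, ae_restrict_of_ae h0] with x hx hxf
  by_contra hcon
  exact hxf (by rw [hK.isClosed.frontier_eq]; exact ⟨hx, hcon⟩)

lemma integrableOn_frontier_inner (hK : IsPolytope H K) {W : P3 → P3} (hW : ContinuousOn W K) :
    IntegrableOn (fun x => ⟪W x, outwardNormal K x⟫) (frontier K) μHE[2] := by
  have h1 : ∀ i, IntegrableOn (fun x => W x i * outwardNormal K x i) (frontier K) μHE[2] :=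
    fun i => hK.integrableOn_frontier_mul
      ((EuclideanSpace.proj (𝕜 := ℝ) i).continuous.comp_continuousOn hW) i
  have h2 : IntegrableOn (fun x => ∑ i, W x i * outwardNormal K x i) (frontier K) μHE[2] :=
    integrable_finsetSum _ fun i _ => h1 i
  refine h2.congr (Filter.Eventually.of_forall fun x => ?_)
  simp [PiLp.inner_apply, mul_comm]

/-- The divergence theorem. -/
theorem integral_divergence (hK : IsPolytope H K)
    {W : P3 → P3} {W' : P3 → P3 →L[ℝ] P3} (hW : ContinuousOn W K)
    (hW' : ContinuousOn W' K) (hd : ∀ x ∈ interior K, HasFDerivAt W (W' x) x) :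
    ∫ x in K, ∑ i, (W' x (EuclideanSpace.single i 1)) i
      = ∫ x in frontier K, ⟪W x, outwardNormal K x⟫ ∂μHE[2] := by
  have hproj : ∀ i : Fin 3, ContinuousOn (fun x => W x i) K := fun i =>
    (EuclideanSpace.proj (𝕜 := ℝ) i).continuous.comp_continuousOn hW
  have hproj' : ∀ i : Fin 3, ContinuousOn
      (fun x => (EuclideanSpace.proj i : P3 →L[ℝ] ℝ).comp (W' x)) K := fun i =>
    continuousOn_const.clm_comp hW'
  have key : ∀ i : Fin 3, ∫ x in K, (W' x (EuclideanSpace.single i 1)) i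
      = ∫ x in frontier K, W x i * outwardNormal K x i ∂μHE[2] := fun i =>
    hK.integral_partial_eq (hproj i) (hproj' i)
      (fun x hx => (EuclideanSpace.proj i : P3 →L[ℝ] ℝ).hasFDerivAt.comp x (hd x hx)) i
  rw [integral_finsetSum]
  · simp only [key]
    rw [← integral_finsetSum _ fun i _ => hK.integrableOn_frontier_mul (hproj i) i]
    refine integral_congr_ae (Filter.Eventually.of_forall fun x => ?_)
    simp [PiLp.inner_apply, mul_comm]
  · intro i _
    have := (hproj' i).clm_apply (continuousOn_const (c := EuclideanSpace.single i (1 : ℝ)))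
    exact this.integrableOn_compact hK.isCompact

/-- `div` uses the full derivative, which is known in the interior only; the boundary of K is a null
set. -/
lemma div_ae_eq (hK : IsPolytope H K) {U : P3 → P3} {U' : P3 → P3 →L[ℝ] P3}
    (hd : ∀ x ∈ interior K, HasFDerivAt U (U' x) x) :
    ∀ᵐ x ∂(volume.restrict K), div U x = ∑ i, (U' x (EuclideanSpace.single i 1)) i := by
  filter_upwards [hK.ae_mem_interior] with x hx
  rw [div, (hd x hx).fderiv]

lemma continuousOn_trace {U' : P3 → P3 →L[ℝ] P3} (hU' : ContinuousOn U' K) :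
    ContinuousOn (fun x => ∑ i, (U' x (EuclideanSpace.single i 1)) i) K := by
  refine continuousOn_finsetSum _ fun i _ => ?_
  exact (EuclideanSpace.proj (𝕜 := ℝ) i).continuous.comp_continuousOn
    (hU'.clm_apply continuousOn_const)

lemma integrableOn_div (hK : IsPolytope H K)
    {U : P3 → P3} {U' : P3 → P3 →L[ℝ] P3} (hU' : ContinuousOn U' K)
    (hd : ∀ x ∈ interior K, HasFDerivAt U (U' x) x) : IntegrableOn (div U) K :=
  ((continuousOn_trace hU').integrableOn_compact hK.isCompact).congr
    ((hK.div_ae_eq hd).mono fun _ hx => hx.symm)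

/-- Integration by parts. -/
theorem integral_parts (hK : IsPolytope H K) {φ : P3 → ℝ} {U : P3 → P3} {U' : P3 → P3 →L[ℝ] P3}
    (hφ : ContDiff ℝ 1 φ) (hU : ContinuousOn U K) (hU' : ContinuousOn U' K)
    (hd : ∀ x ∈ interior K, HasFDerivAt U (U' x) x) :
    ∫ x in K, ⟪∇ φ x, U x⟫ = - (∫ x in K, φ x * div U x)
      + ∫ x in frontier K, φ x * ⟪U x, outwardNormal K x⟫ ∂μHE[2] := by
  have hφd : ∀ x, HasFDerivAt φ (fderiv ℝ φ x) x := fun x =>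
    (hφ.differentiable one_ne_zero x).hasFDerivAt
  have hφ' : Continuous (fderiv ℝ φ) := hφ.continuous_fderiv one_ne_zero
  -- The divergence theorem for φU, whose divergence is φ div U + ∇φ·U.
  have h := hK.integral_divergence (W := fun x => φ x • U x)
    (W' := fun x => φ x • U' x + (fderiv ℝ φ x).smulRight (U x))
    (hφ.continuous.continuousOn.smul hU)
    ((hφ.continuous.continuousOn.smul hU').add
      ((ContinuousLinearMap.smulRightL ℝ P3 P3).continuous₂.comp_continuousOn
        (hφ'.continuousOn.prodMk hU)))
    (fun x hx => (hφd x).smul (hd x hx))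
  have e1 : ∀ x, ∑ i, ((φ x • U' x + (fderiv ℝ φ x).smulRight (U x))
      (EuclideanSpace.single i 1)) i
      = φ x * ∑ i, (U' x (EuclideanSpace.single i 1)) i + ⟪∇ φ x, U x⟫ := by
    intro x
    have e2 : ⟪∇ φ x, U x⟫ = ∑ i, fderiv ℝ φ x (EuclideanSpace.single i 1) * U x i := by
      rw [inner_gradient_left]
      conv_lhs => rw [← (EuclideanSpace.basisFun (Fin 3) ℝ).sum_repr (U x)]
      simp [mul_comm]
    rw [e2, Finset.mul_sum, ← Finset.sum_add_distrib]
    refine Finset.sum_congr rfl fun i _ => ?_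
    simp
  simp only [e1] at h
  have hgrad : Continuous (∇ φ) :=
    (InnerProductSpace.toDual ℝ P3).symm.continuous.comp hφ'
  rw [integral_add] at h
  · have e3 : ∫ x in K, φ x * div U x
        = ∫ x in K, φ x * ∑ i, (U' x (EuclideanSpace.single i 1)) i :=
      integral_congr_ae ((hK.div_ae_eq hd).mono fun x hx => by simp only [hx])
    rw [e3]
    simp only [real_inner_smul_left] at h
    linarith
  · exact (hφ.continuous.continuousOn.mul (continuousOn_trace hU')).integrableOn_compact
      hK.isCompact
  · exact (hgrad.continuousOn.inner hU).integrableOn_compact hK.isCompact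

end IsPolytope

/-! ### Interfaces of a mesh -/

namespace Mesh

variable {ι : Type*} (M : Mesh ι)

lemma interface_comm (R R' : ι) : M.interface R R' = M.interface R' R := by
  rw [interface, interface, Set.inter_comm]

/-- An element is the closure of its interior, so a point of R' interior to R would make the two
interiors meet. -/
lemma notMem_interior_of_mem {R R' : ι} (hne : R ≠ R') {x : P3} (hx' : x ∈ M.elem R') :
    x ∉ interior (M.elem R) := by
  intro hx
  have h1 : x ∈ closure (interior (M.elem R')) := by
    rw [(M.convex_elem R').closure_interior_eq_closure_of_nonempty_interior
      (M.nonempty_interior_elem R')]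
    exact subset_closure hx'
  obtain ⟨y, hy, hy'⟩ := mem_closure_iff.1 h1 _ isOpen_interior hx
  exact Set.disjoint_left.1 (M.disjoint_interior R R' hne) hy hy'

lemma inter_subset_frontier {R R' : ι} (hne : R ≠ R') :
    M.elem R ∩ M.elem R' ⊆ frontier (M.elem R) := fun x hx => by
  rw [(M.isClosed_elem R).frontier_eq]
  exact ⟨hx.1, M.notMem_interior_of_mem hne hx.2⟩

lemma interface_subset_frontier {R R' : ι} (hne : R ≠ R') :
    M.interface R R' ⊆ frontier (M.elem R) := fun _ hx => M.inter_subset_frontier hne hx.1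

lemma measurableSet_interface (R R' : ι) : MeasurableSet (M.interface R R') :=
  ((M.measurableSet_elem R).inter (M.measurableSet_elem R')).diff isClosed_frontier.measurableSet

/-- Where two elements meet at a point at which both have a unique normal, the normals are
opposite. -/
lemma normal_eq_neg {R R' : ι} (hne : R ≠ R') {x : P3} (hx : x ∈ M.elem R ∩ M.elem R')
    (hs : IsSmoothAt (M.elem R) x) (hs' : IsSmoothAt (M.elem R') x) :
    M.normal R' x = - M.normal R x := by
  -- A plane separates the disjoint interiors and passes through x. Its unit normal is outward for R
  -- and its negative is outward for R', and both outward normals are unique.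
  obtain ⟨f, c, hf, hf'⟩ := geometric_hahn_banach_open (M.convex_elem R).interior isOpen_interior
    (M.convex_elem R').interior (M.disjoint_interior R R' hne)
  have hcl : ∀ R, M.elem R ⊆ closure (interior (M.elem R)) := fun R => by
    rw [(M.convex_elem R).closure_interior_eq_closure_of_nonempty_interior
      (M.nonempty_interior_elem R)]
    exact subset_closure
  have h1 : ∀ y ∈ M.elem R, f y ≤ c := fun y hy =>
    closure_minimal (fun z hz => (hf z hz).le) (isClosed_le f.continuous continuous_const)
      (hcl R hy)
  have h2 : ∀ y ∈ M.elem R', c ≤ f y := fun y hy =>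
    closure_minimal hf' (isClosed_le continuous_const f.continuous) (hcl R' hy)
  have hxc : f x = c := le_antisymm (h1 x hx.1) (h2 x hx.2)
  set n := (InnerProductSpace.toDual ℝ P3).symm f with hn
  have hfn : ∀ y, ⟪n, y⟫ = f y := fun y => by rw [hn, InnerProductSpace.toDual_symm_apply]
  have hn0 : ‖n‖ ≠ 0 := by
    intro h0
    obtain ⟨y, hy⟩ := M.nonempty_interior_elem R
    have h3 := hf y hy
    rw [← hxc, ← hfn, ← hfn, norm_eq_zero.1 h0, inner_zero_left, inner_zero_left] at h3
    exact lt_irrefl _ h3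
  have hunit : ‖‖n‖⁻¹ • n‖ = 1 := by
    rw [norm_smul, norm_inv, norm_norm]; exact inv_mul_cancel₀ hn0
  have hpos : 0 ≤ ‖n‖⁻¹ := inv_nonneg.2 (norm_nonneg _)
  have e1 : M.normal R x = ‖n‖⁻¹ • n := by
    refine outwardNormal_eq hs hunit fun y hy => ?_
    rw [real_inner_smul_left, hfn, map_sub, hxc]
    exact mul_nonpos_of_nonneg_of_nonpos hpos (sub_nonpos.2 (h1 y hy))
  have e2 : M.normal R' x = -(‖n‖⁻¹ • n) := by
    refine outwardNormal_eq hs' (by rwa [norm_neg]) fun y hy => ?_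
    rw [inner_neg_left, real_inner_smul_left, hfn, map_sub, hxc]
    exact neg_nonpos.2 (mul_nonneg hpos (sub_nonneg.2 (h2 y hy)))
  rw [e1, e2]

lemma ae_isSmoothAt_interface {R R' : ι} (hne : R ≠ R') :
    ∀ᵐ x ∂(μHE[2] : Measure P3).restrict (M.interface R R'),
      IsSmoothAt (M.elem R) x ∧ IsSmoothAt (M.elem R') x := by
  obtain ⟨H, hH⟩ := M.exists_isPolytope R
  obtain ⟨H', hH'⟩ := M.exists_isPolytope R'
  refine Filter.Eventually.and ?_ ?_
  · exact ae_mono (Measure.restrict_mono (M.interface_subset_frontier hne) le_rfl) hH.ae_isSmoothAt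
  · rw [M.interface_comm]
    exact ae_mono (Measure.restrict_mono (M.interface_subset_frontier hne.symm) le_rfl)
      hH'.ae_isSmoothAt

lemma ae_normal_interface {R R' : ι} (hne : R ≠ R') :
    ∀ᵐ x ∂(μHE[2] : Measure P3).restrict (M.interface R R'),
      ‖M.normal R x‖ = 1 ∧ M.normal R' x = - M.normal R x := by
  filter_upwards [M.ae_isSmoothAt_interface hne, ae_restrict_mem (M.measurableSet_interface R R')]
    with x hx hmem
  exact ⟨(outwardNormal_spec hx.1).1, M.normal_eq_neg hne hmem.1 hx.1 hx.2⟩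

/-- At a smooth point common to three elements the normals would be pairwise opposite, which forces
n = −n. -/
lemma hausdorff_interface_inter {R R' R'' : ι} (h1 : R ≠ R') (h2 : R ≠ R'') (h3 : R' ≠ R'') :
    μHE[2] (M.interface R R' ∩ M.interface R R'') = 0 := by
  have a1 := (ae_restrict_iff' (M.measurableSet_interface R R')).1 (M.ae_isSmoothAt_interface h1)
  have a2 := (ae_restrict_iff' (M.measurableSet_interface R R'')).1 (M.ae_isSmoothAt_interface h2)
  rw [measure_eq_zero_iff_ae_notMem]
  filter_upwards [a1, a2] with x hx1 hx2 hx
  obtain ⟨s, s'⟩ := hx1 hx.1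
  obtain ⟨-, s''⟩ := hx2 hx.2
  have e1 := M.normal_eq_neg h1 hx.1.1 s s'
  have e2 := M.normal_eq_neg h2 hx.2.1 s s''
  have e3 := M.normal_eq_neg h3 ⟨hx.1.1.2, hx.2.1.2⟩ s' s''
  have hn := (outwardNormal_spec s).1
  have e4 : (2 : ℝ) • M.normal R x = 0 := by
    rw [two_smul]
    nth_rw 1 [← neg_neg (M.normal R x), ← e1, ← e3, e2]
    simp
  have e5 : M.normal R x = 0 := by simpa using e4
  have hn' : ‖M.normal R x‖ = 1 := hn
  rw [e5, norm_zero] at hn'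
  exact zero_ne_one hn'

variable [Fintype ι] [DecidableEq ι]

/-- A boundary point of R off Γ is interior to the domain. Points outside R arbitrarily close to it
then lie in the other elements, whose finite union is closed. Hanging nodes do no harm, since no
face matching is used. -/
lemma frontier_diff_bdry (R : ι) : frontier (M.elem R) \ M.bdry
    = ⋃ R' : (Finset.univ.erase R : Finset ι), M.interface R R' := by
  ext x
  simp only [Set.mem_iUnion, Subtype.exists, Finset.mem_erase, Finset.mem_univ, and_true]
  constructor
  · rintro ⟨hx, hxb⟩
    have hxR : x ∈ M.elem R := (M.isClosed_elem R).frontier_subset hx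
    have hsub : interior (M.elem R) ⊆ M.domain :=
      interior_mono (Set.subset_iUnion M.elem R)
    have hcl : x ∈ closure M.domain := by
      refine closure_mono hsub ?_
      rw [(M.convex_elem R).closure_interior_eq_closure_of_nonempty_interior
        (M.nonempty_interior_elem R)]
      exact subset_closure hxR
    have hxd : x ∈ M.domain := by
      by_contra hcon
      refine hxb ⟨hcl, ?_⟩
      rwa [domain, interior_interior]
    have hfin : IsClosed (⋃ R' ∈ (Finset.univ.erase R : Finset ι), M.elem R') :=
      isClosed_biUnion_finset fun R' _ => M.isClosed_elem R'
    have hmem : x ∈ ⋃ R' ∈ (Finset.univ.erase R : Finset ι), M.elem R' := by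
      rw [← hfin.closure_eq, mem_closure_iff]
      intro o ho hxo
      have hxc : x ∈ closure (M.elem R)ᶜ := by
        rw [frontier_eq_closure_inter_closure] at hx; exact hx.2
      obtain ⟨y, ⟨hyo, hyd⟩, hyR⟩ := mem_closure_iff.1 hxc (o ∩ M.domain)
        (ho.inter isOpen_interior) ⟨hxo, hxd⟩
      obtain ⟨R', hR'⟩ := Set.mem_iUnion.1 (interior_subset hyd : y ∈ M.closedDomain)
      refine ⟨y, hyo, Set.mem_iUnion₂.2 ⟨R', ?_, hR'⟩⟩
      refine Finset.mem_erase.2 ⟨fun he => hyR (he ▸ hR'), Finset.mem_univ _⟩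
    obtain ⟨R', hR', hxR'⟩ := Set.mem_iUnion₂.1 hmem
    exact ⟨R', (Finset.mem_erase.1 hR').1, ⟨hxR, hxR'⟩, hxb⟩
  · rintro ⟨R', hne, hx⟩
    exact ⟨M.interface_subset_frontier hne.symm hx, hx.2⟩

/-- The boundary integrals of all elements, split into the parts on `Γ` and on the interfaces. -/
lemma sum_integral_frontier {F : ι → P3 → ℝ}
    (hF : ∀ R, IntegrableOn (F R) (frontier (M.elem R)) μHE[2]) :
    ∑ R, ∫ x in frontier (M.elem R), F R x ∂μHE[2]
      = M.sumBdry F + M.sumInterfaces (fun R _ => F R) := by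
  rw [sumBdry, sumInterfaces, ← Finset.sum_add_distrib]
  refine Finset.sum_congr rfl fun R _ => ?_
  rw [← integral_inter_add_sdiff isClosed_frontier.measurableSet (hF R) (t := M.bdry)]
  congr 1
  rw [M.frontier_diff_bdry, integral_iUnion_ae, tsum_fintype]
  · exact Finset.sum_coe_sort _ (fun R' => ∫ x in M.interface R R', F R x ∂μHE[2])
  · exact fun R' => (M.measurableSet_interface R R').nullMeasurableSet
  · intro R' R'' hne
    exact M.hausdorff_interface_inter (Finset.ne_of_mem_erase R'.2).symm
      (Finset.ne_of_mem_erase R''.2).symm fun he => hne (Subtype.ext he)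
  · rw [← M.frontier_diff_bdry]
    exact (hF R).mono_set Set.sdiff_subset

lemma sumInterfaces_swap (F : ι → ι → P3 → ℝ) :
    M.sumInterfaces F = M.sumInterfaces (fun R R' => F R' R) := by
  have h : ∀ G : ι → ι → ℝ, ∑ R, ∑ R' ∈ Finset.univ.erase R, G R R'
      = ∑ R, ∑ R' ∈ Finset.univ.erase R, G R' R := by
    intro G
    refine Finset.sum_comm' fun R R' => ?_
    simp [eq_comm]
  rw [sumInterfaces, h]
  refine Finset.sum_congr rfl fun R _ => Finset.sum_congr rfl fun R' _ => ?_
  rw [M.interface_comm]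

lemma sumInterfaces_congr {F G : ι → ι → P3 → ℝ}
    (h : ∀ R R', R ≠ R' → ∀ᵐ x ∂(μHE[2] : Measure P3).restrict (M.interface R R'),
      F R R' x = G R R' x) : M.sumInterfaces F = M.sumInterfaces G := by
  refine Finset.sum_congr rfl fun R _ => Finset.sum_congr rfl fun R' hR' => ?_
  exact integral_congr_ae (h R R' (Finset.ne_of_mem_erase hR').symm)

lemma sumInterfaces_add {F G : ι → ι → P3 → ℝ}
    (hF : ∀ R R', R ≠ R' → IntegrableOn (F R R') (M.interface R R') μHE[2])
    (hG : ∀ R R', R ≠ R' → IntegrableOn (G R R') (M.interface R R') μHE[2]) :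
    M.sumInterfaces (fun R R' x => F R R' x + G R R' x)
      = M.sumInterfaces F + M.sumInterfaces G := by
  simp only [sumInterfaces, ← Finset.sum_add_distrib]
  refine Finset.sum_congr rfl fun R _ => Finset.sum_congr rfl fun R' hR' => ?_
  have hne := (Finset.ne_of_mem_erase hR').symm
  exact integral_add (hF R R' hne) (hG R R' hne)

lemma sumInterfaces_const_mul (c : ℝ) (F : ι → ι → P3 → ℝ) :
    M.sumInterfaces (fun R R' x => c * F R R' x) = c * M.sumInterfaces F := by
  simp only [sumInterfaces, Finset.mul_sum, integral_const_mul]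

/-- Interface sums only depend on the symmetrized integrand. -/
lemma two_mul_sumInterfaces {F : ι → ι → P3 → ℝ}
    (hF : ∀ R R', R ≠ R' → IntegrableOn (F R R') (M.interface R R') μHE[2]) :
    2 * M.sumInterfaces F = M.sumInterfaces (fun R R' x => F R R' x + F R' R x) := by
  rw [M.sumInterfaces_add hF fun R R' hne => by
    rw [M.interface_comm]; exact hF R' R hne.symm, ← M.sumInterfaces_swap, two_mul]

end Mesh

/-! ### Piecewise polynomials -/

/-- Evaluation of polynomials, as a linear map. -/
def evalPoly : MvPolynomial (Fin 3) ℝ →ₗ[ℝ] (P3 → ℝ) where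
  toFun P x := MvPolynomial.eval x.ofLp P
  map_add' P Q := by funext x; simp
  map_smul' c P := by funext x; simp [MvPolynomial.smul_eval]

/-- The space of polynomial functions of degree at most `k` in each variable. -/
def polySpace (k : ℕ) : Submodule ℝ (P3 → ℝ) :=
  (MvPolynomial.restrictDegree (Fin 3) ℝ k).map evalPoly

lemma mem_polySpace {k : ℕ} {g : P3 → ℝ} : g ∈ polySpace k ↔ IsQk k g := by
  constructor
  · rintro ⟨P, hP, rfl⟩
    exact ⟨P, hP, fun x => rfl⟩
  · rintro ⟨P, hP, h⟩
    exact ⟨P, hP, (funext h).symm⟩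

instance (k : ℕ) : FiniteDimensional ℝ (polySpace k) :=
  inferInstanceAs
    (FiniteDimensional ℝ ((MvPolynomial.restrictDegree (Fin 3) ℝ k).map evalPoly))

lemma isQk_zero (k : ℕ) : IsQk k 0 := mem_polySpace.1 (Submodule.zero_mem _)

lemma IsQk.sub {k : ℕ} {g h : P3 → ℝ} (hg : IsQk k g) (hh : IsQk k h) :
    IsQk k (fun x => g x - h x) :=
  mem_polySpace.1 (Submodule.sub_mem _ (mem_polySpace.2 hg) (mem_polySpace.2 hh))

lemma contDiff_eval (P : MvPolynomial (Fin 3) ℝ) (n : WithTop ℕ∞) :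
    ContDiff ℝ n (fun x : P3 => MvPolynomial.eval x.ofLp P) := by
  induction P using MvPolynomial.induction_on with
  | C a => simpa using contDiff_const
  | add p q hp hq => simpa using hp.add hq
  | mul_X p i hp =>
    have : ContDiff ℝ n (fun x : P3 => x i) := (EuclideanSpace.proj i : P3 →L[ℝ] ℝ).contDiff
    simpa using hp.mul this

lemma IsQk.contDiff {k : ℕ} {g : P3 → ℝ} (hg : IsQk k g) {n : WithTop ℕ∞} : ContDiff ℝ n g := by
  obtain ⟨P, -, hP⟩ := hg
  rw [funext hP]
  exact contDiff_eval P n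

lemma fderiv_eval (P : MvPolynomial (Fin 3) ℝ) (x : P3) (i : Fin 3) :
    fderiv ℝ (fun x : P3 => MvPolynomial.eval x.ofLp P) x (EuclideanSpace.single i 1)
      = MvPolynomial.eval x.ofLp (MvPolynomial.pderiv i P) := by
  have hd : ∀ P : MvPolynomial (Fin 3) ℝ,
      DifferentiableAt ℝ (fun x : P3 => MvPolynomial.eval x.ofLp P) x := fun P =>
    (contDiff_eval P 1).differentiable one_ne_zero x
  induction P using MvPolynomial.induction_on with
  | C a => simp
  | add p q hp hq =>
    simp only [map_add]
    rw [← hp, ← hq, fderiv_fun_add (hd p) (hd q)]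
    rfl
  | mul_X p j hp =>
    have hj : HasFDerivAt (fun x : P3 => x j) (EuclideanSpace.proj j : P3 →L[ℝ] ℝ) x :=
      (EuclideanSpace.proj j : P3 →L[ℝ] ℝ).hasFDerivAt
    simp only [map_mul, MvPolynomial.eval_X, Derivation.leibniz, map_add, smul_eq_mul]
    rw [← hp, ((hd p).hasFDerivAt.fun_mul hj).fderiv, MvPolynomial.pderiv_X]
    by_cases hij : j = i
    · subst hij; simp [mul_comm]
    · simp [hij, mul_comm]

/-- Hence the true gradient of a function in W_h is in W_h³, a candidate for the discrete gradient.
-/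
lemma pderiv_mem_restrictDegree {k : ℕ} {P : MvPolynomial (Fin 3) ℝ}
    (hP : P ∈ MvPolynomial.restrictDegree (Fin 3) ℝ k) (i : Fin 3) :
    MvPolynomial.pderiv i P ∈ MvPolynomial.restrictDegree (Fin 3) ℝ k := by
  rw [MvPolynomial.mem_restrictDegree] at hP
  rw [P.as_sum, map_sum]
  refine Submodule.sum_mem _ fun s hs => ?_
  rw [MvPolynomial.pderiv_monomial, MvPolynomial.mem_restrictDegree]
  intro t ht j
  have ht' := Finset.mem_singleton.1 (MvPolynomial.support_monomial_subset ht)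
  rw [ht']
  exact (Nat.sub_le _ _).trans (hP s hs j)

lemma gradient_apply {g : P3 → ℝ} (x : P3) (i : Fin 3) :
    (∇ g x) i = fderiv ℝ g x (EuclideanSpace.single i 1) := by
  have h := inner_gradient_left (𝕜 := ℝ) (f := g) (x := x) (y := EuclideanSpace.single i 1)
  rw [← h, EuclideanSpace.inner_single_right]
  simp

lemma IsQk.gradient {k : ℕ} {g : P3 → ℝ} (hg : IsQk k g) (i : Fin 3) :
    IsQk k (fun x => (∇ g x) i) := by
  obtain ⟨P, hP, h⟩ := hg
  refine ⟨_, pderiv_mem_restrictDegree hP i, fun x => ?_⟩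
  change (∇ g x) i = _
  rw [gradient_apply, funext h, fderiv_eval]

/-- Functions in a finite-dimensional space are determined linearly by finitely many values. -/
lemma exists_interpolation {X : Type*} (V : Submodule ℝ (X → ℝ)) [FiniteDimensional ℝ V] :
    ∃ (s : Finset X) (b : s → X → ℝ), (∀ j, b j ∈ V) ∧
      ∀ g ∈ V, g = fun x => ∑ j : s, g j * b j x := by
  classical
  let ev : (s : Finset X) → V →ₗ[ℝ] (s → ℝ) := fun s =>
    LinearMap.pi fun j => (LinearMap.proj (j : X)).comp V.subtype
  have hmem : ∀ s (g : V), g ∈ LinearMap.ker (ev s) ↔ ∀ j ∈ s, g.1 j = 0 := by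
    intro s g
    rw [LinearMap.mem_ker, funext_iff]
    exact ⟨fun h j hj => h ⟨j, hj⟩, fun h j => h j j.2⟩
  obtain ⟨s, hs⟩ : ∃ s, LinearMap.ker (ev s) = ⊥ := by
    -- Take a finite set of points whose evaluation kernel has minimal dimension. A nonzero g in
    -- this kernel would be removed by adding a point where g does not vanish.
    obtain ⟨s, hmin⟩ : ∃ s, ∀ s', Module.finrank ℝ (LinearMap.ker (ev s))
        ≤ Module.finrank ℝ (LinearMap.ker (ev s')) := by
      obtain ⟨s, hs⟩ := (Set.range_nonempty fun s => Module.finrank ℝ (LinearMap.ker (ev s))) |>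
        fun h => Nat.sInf_mem h
      refine ⟨s, fun s' => ?_⟩
      change (fun s => Module.finrank ℝ (LinearMap.ker (ev s))) s ≤ _
      rw [hs]
      exact Nat.sInf_le ⟨s', rfl⟩
    refine ⟨s, ?_⟩
    by_contra hne
    obtain ⟨g, hg, hg0⟩ := Submodule.exists_mem_ne_zero_of_ne_bot hne
    obtain ⟨x, hx⟩ : ∃ x, g.1 x ≠ 0 := by
      by_contra! hcon
      exact hg0 (Subtype.ext (funext hcon))
    have hlt : LinearMap.ker (ev (insert x s)) < LinearMap.ker (ev s) := by
      refine lt_of_le_of_ne (fun g' hg' => (hmem s g').2 fun j hj =>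
        (hmem _ g').1 hg' j (Finset.mem_insert_of_mem hj)) fun he => ?_
      rw [← he] at hg
      exact hx ((hmem _ g).1 hg x (Finset.mem_insert_self x s))
    exact absurd (hmin (insert x s)) (not_le.2 (Submodule.finrank_lt_finrank_of_lt hlt))
  obtain ⟨L, hL⟩ := (ev s).exists_leftInverse_of_injective hs
  refine ⟨s, fun j => (L (Pi.single j 1)).1, fun j => (L _).2, fun g hg => ?_⟩
  have h1 : L (ev s ⟨g, hg⟩) = ⟨g, hg⟩ := LinearMap.congr_fun hL ⟨g, hg⟩
  have h2 : ev s ⟨g, hg⟩ = ∑ j : s, g j • Pi.single j (1 : ℝ) := by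
    funext j
    simp only [Finset.sum_apply, Pi.smul_apply, smul_eq_mul, Pi.single_apply, mul_ite, mul_one,
      mul_zero, Finset.sum_ite_eq, Finset.mem_univ, if_true]
    rfl
  rw [h2, map_sum] at h1
  have h3 := congrArg Subtype.val h1
  funext x
  have h4 := congrFun h3 x
  simp only [map_smul, Submodule.coe_sum, Submodule.coe_smul, Finset.sum_apply, Pi.smul_apply,
    smul_eq_mul] at h4
  exact h4.symm

/-! ### Time derivatives -/

/-- Differentiability in time is assumed only pointwise. Since `F s` is determined by its values at
finitely many points, with interpolation functions independent of s, the integral is a finite linear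
combination of differentiable functions and no domination is needed. -/
lemma hasDerivWithinAt_integral_mul {k : ℕ} {K : Set P3} (hK : IsCompact K) {I : Set ℝ}
    {F F' : ℝ → P3 → ℝ} (hF : ∀ s ∈ I, IsQk k (F s)) (hF' : ∀ s ∈ I, IsQk k (F' s)) {t : ℝ}
    (ht : t ∈ I) (hd : ∀ x, HasDerivWithinAt (fun s => F s x) (F' t x) I t) {φ : P3 → ℝ}
    (hφ : Continuous φ) :
    HasDerivWithinAt (fun s => ∫ x in K, F s x * φ x) (∫ x in K, F' t x * φ x) I t := by
  obtain ⟨S, b, hb, hV⟩ := exists_interpolation (polySpace k)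
  have hint : ∀ j, IntegrableOn (fun x => b j x * φ x) K := fun j =>
    ((mem_polySpace.1 (hb j)).contDiff (n := 0) |>.continuous.mul
      hφ).continuousOn.integrableOn_compact hK
  have key : ∀ g, IsQk k g → ∫ x in K, g x * φ x = ∑ j : S, g j * ∫ x in K, b j x * φ x := by
    intro g hg
    have hg' := hV g (mem_polySpace.2 hg)
    simp only [← integral_const_mul]
    rw [← integral_finsetSum _ fun j _ => (hint j).const_mul _]
    refine integral_congr_ae (Filter.Eventually.of_forall fun x => ?_)
    change g x * φ x = _
    rw [congrFun hg' x, Finset.sum_mul]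
    simp only [mul_assoc]
  rw [key _ (hF' t ht)]
  refine HasDerivWithinAt.congr (f := fun s => ∑ j : S, F s j * ∫ x in K, b j x * φ x) ?_
    (fun s hs => key _ (hF s hs)) (key _ (hF t ht))
  exact HasDerivWithinAt.fun_sum fun j _ => (hd j).mul_const _

/-- Interpolating one of the two factors turns the integral into a finite sum of products, to which
the product rule and the previous lemma apply. -/
lemma hasDerivWithinAt_integral_mul_self {k : ℕ} {K : Set P3} (hK : IsCompact K) {I : Set ℝ}
    {F F' : ℝ → P3 → ℝ} (hF : ∀ s ∈ I, IsQk k (F s)) (hF' : ∀ s ∈ I, IsQk k (F' s)) {t : ℝ}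
    (ht : t ∈ I) (hd : ∀ x, HasDerivWithinAt (fun s => F s x) (F' t x) I t) :
    HasDerivWithinAt (fun s => ∫ x in K, F s x * F s x) (2 * ∫ x in K, F' t x * F t x) I t := by
  obtain ⟨S, b, hb, hV⟩ := exists_interpolation (polySpace k)
  have hcont : ∀ g, IsQk k g → Continuous g := fun g hg => hg.contDiff (n := 0) |>.continuous
  have hbc : ∀ j, Continuous (b j) := fun j => hcont _ (mem_polySpace.1 (hb j))
  have hint : ∀ j g, IsQk k g → IntegrableOn (fun x => b j x * g x) K := fun j g hg =>
    ((hbc j).mul (hcont g hg)).continuousOn.integrableOn_compact hK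
  have key : ∀ g h, IsQk k g → IsQk k h →
      ∫ x in K, h x * g x = ∑ j : S, h j * ∫ x in K, g x * b j x := by
    intro g h hg hh
    have hh' := hV h (mem_polySpace.2 hh)
    simp only [← integral_const_mul]
    rw [← integral_finsetSum _ fun j _ => (((hint j g hg).congr
      (Filter.Eventually.of_forall fun x => mul_comm _ _)).const_mul _)]
    refine integral_congr_ae (Filter.Eventually.of_forall fun x => ?_)
    change h x * g x = _
    rw [congrFun hh' x, Finset.sum_mul]
    refine Finset.sum_congr rfl fun j _ => ?_
    ring
  have hder : HasDerivWithinAt (fun s => ∑ j : S, F s j * ∫ x in K, F s x * b j x)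
      (∑ j : S, (F' t j * (∫ x in K, F t x * b j x) + F t j * ∫ x in K, F' t x * b j x)) I t :=
    HasDerivWithinAt.fun_sum fun j _ =>
      (hd j).mul (hasDerivWithinAt_integral_mul hK hF hF' ht hd (hbc j))
  have hval : 2 * ∫ x in K, F' t x * F t x
      = ∑ j : S, (F' t j * (∫ x in K, F t x * b j x) + F t j * ∫ x in K, F' t x * b j x) := by
    rw [Finset.sum_add_distrib, ← key _ _ (hF t ht) (hF' t ht), ← key _ _ (hF' t ht) (hF t ht),
      two_mul]
    congr 1
    exact integral_congr_ae (Filter.Eventually.of_forall fun x => mul_comm _ _)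
  rw [hval]
  exact hder.congr (fun s hs => key _ _ (hF s hs) (hF s hs)) (key _ _ (hF t ht) (hF t ht))

namespace Mesh

variable {ι : Type*} (M : Mesh ι)

section Time

variable [Fintype ι] {k : ℕ} {I : Set ℝ} {f f' : ℝ → ι → P3 → ℝ}

lemma hasDerivWithinAt_ip (hf : ∀ t ∈ I, M.InW k (f t)) (hf' : ∀ t ∈ I, M.InW k (f' t))
    (hd : ∀ t ∈ I, ∀ R x, HasDerivWithinAt (fun s => f s R x) (f' t R x) I t) {t : ℝ} (ht : t ∈ I)
    {φ : ι → P3 → ℝ} (hφ : M.InW k φ) :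
    HasDerivWithinAt (fun s => M.ip (f s) φ) (M.ip (f' t) φ) I t :=
  HasDerivWithinAt.fun_sum fun R _ => hasDerivWithinAt_integral_mul (M.isCompact_elem R)
    (F := fun s => f s R) (F' := fun s => f' s R) (fun s hs => hf s hs R) (fun s hs => hf' s hs R)
    ht (fun x => hd t ht R x) ((hφ R).contDiff (n := 0)).continuous

lemma hasDerivWithinAt_ip_self (hf : ∀ t ∈ I, M.InW k (f t)) (hf' : ∀ t ∈ I, M.InW k (f' t))
    (hd : ∀ t ∈ I, ∀ R x, HasDerivWithinAt (fun s => f s R x) (f' t R x) I t) {t : ℝ}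
    (ht : t ∈ I) : HasDerivWithinAt (fun s => M.ip (f s) (f s)) (2 * M.ip (f' t) (f t)) I t := by
  rw [ip, Finset.mul_sum]
  exact HasDerivWithinAt.fun_sum fun R _ => hasDerivWithinAt_integral_mul_self (M.isCompact_elem R)
    (F := fun s => f s R) (F' := fun s => f' s R) (fun s hs => hf s hs R) (fun s hs => hf' s hs R)
    ht (fun x => hd t ht R x)

end Time

/-! ### The discrete gradient of continuously differentiable functions -/

variable {M} {k : ℕ}

lemma InW.contDiff {g : ι → P3 → ℝ} (hg : M.InW k g) (R : ι) {n : WithTop ℕ∞} :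
    ContDiff ℝ n (g R) := (hg R).contDiff

lemma InW3.contDiff {V : ι → P3 → P3} (hV : M.InW3 k V) (R : ι) {n : WithTop ℕ∞} :
    ContDiff ℝ n (V R) := by
  rw [contDiff_euclidean]
  exact fun i => (hV i R).contDiff

lemma InW.gradient {g : ι → P3 → ℝ} (hg : M.InW k g) : M.InW3 k (fun R => ∇ (g R)) :=
  fun i R => (hg R).gradient i

variable [Fintype ι] [DecidableEq ι] (M)

/-- The default value 0 is also in W_h³, so smoothness of ∇_h g is available without proving that a
discrete gradient exists. -/
lemma dgrad_inW3 (k : ℕ) (u : P3) (g : ι → P3 → ℝ) : M.InW3 k (M.dgrad k u g) := by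
  rw [dgrad]
  split_ifs with h
  · exact h.choose_spec.1
  · exact fun i R => isQk_zero k

variable {M}

/-- Testing with G − G' gives ‖G − G'‖² = 0 in the mean, and continuity gives equality at every
point of each element. -/
lemma IsDiscreteGrad.eqOn {u : P3} {g : ι → P3 → ℝ} {G G' : ι → P3 → P3}
    (h : M.IsDiscreteGrad k u g G) (h' : M.IsDiscreteGrad k u g G') (R : ι) :
    Set.EqOn (G R) (G' R) (M.elem R) := by
  have hW : M.InW3 k (fun R x => G R x - G' R x) := fun i R => (h.1 i R).sub (h'.1 i R)
  have e := (h.2 _ hW).trans (h'.2 _ hW).symm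
  have hc : ∀ R, Continuous (G R) := fun R => (h.1.contDiff R (n := 0)).continuous
  have hc' : ∀ R, Continuous (G' R) := fun R => (h'.1.contDiff R (n := 0)).continuous
  have hcW : ∀ R, Continuous (fun x => G R x - G' R x) := fun R => (hc R).sub (hc' R)
  have hsum : ∑ R, ∫ x in M.elem R, ‖G R x - G' R x‖ ^ 2 = 0 := by
    have e2 : ∀ R, ∫ x in M.elem R, ‖G R x - G' R x‖ ^ 2
        = (∫ x in M.elem R, ⟪G R x, G R x - G' R x⟫)
          - ∫ x in M.elem R, ⟪G' R x, G R x - G' R x⟫ := by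
      intro R
      rw [← integral_sub]
      · refine integral_congr_ae (Filter.Eventually.of_forall fun x => ?_)
        simp only
        rw [← inner_sub_left, real_inner_self_eq_norm_sq]
      · exact ((hc R).inner (hcW R)).continuousOn.integrableOn_compact (M.isCompact_elem R)
      · exact ((hc' R).inner (hcW R)).continuousOn.integrableOn_compact (M.isCompact_elem R)
    simp only [e2, Finset.sum_sub_distrib]
    exact sub_eq_zero.2 e
  have h0 := (Finset.sum_eq_zero_iff_of_nonneg
    fun R _ => integral_nonneg fun x => by positivity).1 hsum R (Finset.mem_univ R)
  have hcn : Continuous (fun x => ‖G R x - G' R x‖ ^ 2) := (hcW R).norm.pow 2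
  rw [integral_eq_zero_iff_of_nonneg (fun x => by positivity)
    (hcn.continuousOn.integrableOn_compact (M.isCompact_elem R))] at h0
  have h1 : Set.EqOn (fun x => ‖G R x - G' R x‖ ^ 2) 0 (M.elem R) := by
    refine Measure.eqOn_of_ae_eq h0 hcn.continuousOn continuousOn_const ?_
    rw [(M.convex_elem R).closure_interior_eq_closure_of_nonempty_interior
      (M.nonempty_interior_elem R)]
    exact subset_closure
  intro x hx
  have h2 : ‖G R x - G' R x‖ ^ 2 = 0 := h1 hx
  exact sub_eq_zero.1 (norm_eq_zero.1 (pow_eq_zero_iff two_ne_zero |>.1 h2))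

/-- For a continuous function either choice in the alternating flux is the common trace, and the
defining identity is integration by parts on each element. -/
lemma isDiscreteGrad_gradient {g : ι → P3 → ℝ} (hg : M.InW k g) (hC : M.IsC1 g) (u : P3) :
    M.IsDiscreteGrad k u g (fun R => ∇ (g R)) := by
  refine ⟨hg.gradient, fun V hV => ?_⟩
  have hVc : ∀ R, Continuous (V R) := fun R => (hV.contDiff R (n := 0)).continuous
  have hint : ∀ R, IntegrableOn (fun x => g R x * ⟪V R x, M.normal R x⟫) (frontier (M.elem R))
      μHE[2] := by
    intro R
    obtain ⟨H, hH⟩ := M.exists_isPolytope R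
    have h1 := hH.integrableOn_frontier_inner (W := fun x => g R x • V R x)
      ((hg.contDiff R (n := 0)).continuous.smul (hVc R)).continuousOn
    simp only [real_inner_smul_left] at h1
    exact h1
  have hcongr : M.sumInterfaces (fun R R' x => M.altFlux u g R R' x * ⟪V R x, M.normal R x⟫)
      = M.sumInterfaces (fun R _ x => g R x * ⟪V R x, M.normal R x⟫) := by
    refine M.sumInterfaces_congr fun R R' _ => ?_
    filter_upwards [ae_restrict_mem (M.measurableSet_interface R R')] with x hx
    have := (hC R R' x hx.1).1
    rw [altFlux]
    split_ifs
    · rfl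
    · rw [this]
  rw [hcongr, ← M.sum_integral_frontier hint, ipv, ip, ← Finset.sum_neg_distrib,
    ← Finset.sum_add_distrib]
  refine Finset.sum_congr rfl fun R _ => ?_
  obtain ⟨H, hH⟩ := M.exists_isPolytope R
  refine hH.integral_parts (U' := fderiv ℝ (V R)) (hg.contDiff R) (hVc R).continuousOn ?_ ?_
  · exact ((hV.contDiff R (n := 1)).continuous_fderiv one_ne_zero).continuousOn
  · exact fun x _ => ((hV.contDiff R (n := 1)).differentiable one_ne_zero x).hasFDerivAt

/-- The discrete gradient of a continuously differentiable piecewise polynomial is its gradient. -/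
lemma dgrad_eq_gradient {g : ι → P3 → ℝ} (hg : M.InW k g) (hC : M.IsC1 g) (u : P3) (R : ι) {x : P3}
    (hx : x ∈ M.elem R) : M.dgrad k u g R x = ∇ (g R) x := by
  have hG := isDiscreteGrad_gradient hg hC u
  have hex : ∃ G, M.IsDiscreteGrad k u g G := ⟨_, hG⟩
  rw [dgrad, dif_pos hex]
  exact hex.choose_spec.eqOn hG R hx

end Mesh

/-! ### The collision tensor -/

lemma cross_apply_zero (a b : P3) : cross a b 0 = a 1 * b 2 - a 2 * b 1 := by
  simp [cross, cross_apply]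

lemma cross_apply_one (a b : P3) : cross a b 1 = a 2 * b 0 - a 0 * b 2 := by
  simp [cross, cross_apply]

lemma cross_apply_two (a b : P3) : cross a b 2 = a 0 * b 1 - a 1 * b 0 := by
  simp [cross, cross_apply]

lemma inner_cross_right (a b : P3) : ⟪cross a b, b⟫ = 0 := by
  rw [PiLp.inner_apply, Fin.sum_univ_three]
  simp only [RCLike.inner_apply, conj_trivial, cross_apply_zero, cross_apply_one, cross_apply_two]
  ring

lemma cross_neg_right (a b : P3) : cross a (-b) = - cross a b := by
  ext i
  fin_cases i <;> simp [cross, cross_apply] <;> ring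

lemma cross_zero_right (a : P3) : cross a 0 = 0 := by
  ext i
  fin_cases i <;> simp [cross, cross_apply]

lemma contDiff_cross {n : WithTop ℕ∞} {E : Type*} [NormedAddCommGroup E] [NormedSpace ℝ E]
    {a b : E → P3} (ha : ContDiff ℝ n a) (hb : ContDiff ℝ n b) :
    ContDiff ℝ n (fun x => cross (a x) (b x)) := by
  have ha' := contDiff_euclidean.1 ha
  have hb' := contDiff_euclidean.1 hb
  rw [contDiff_euclidean]
  intro i
  fin_cases i
  · simpa [cross_apply_zero] using ((ha' 1).mul (hb' 2)).sub ((ha' 2).mul (hb' 1))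
  · simpa [cross_apply_one] using ((ha' 2).mul (hb' 0)).sub ((ha' 0).mul (hb' 2))
  · simpa [cross_apply_two] using ((ha' 0).mul (hb' 1)).sub ((ha' 1).mul (hb' 0))

lemma tensorS_nonrelativistic_apply (v w y : P3) :
    tensorS .nonrelativistic v w y = ⟪v - w, v - w⟫ • y - ⟪v - w, y⟫ • (v - w) := rfl

lemma tensorS_relativistic_apply (v w y : P3) :
    tensorS .relativistic v w y = ⟪v - w, v - w⟫ • y - ⟪v - w, y⟫ • (v - w)
      - ⟪cross ((2 : ℝ)⁻¹ • (v + w)) (v - w), y⟫ • cross ((2 : ℝ)⁻¹ • (v + w)) (v - w) := rfl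

/-- With a = v − w, the first two terms give |a|² a − (a·a) a = 0, and z × a is orthogonal to a.
This is the algebraic reason for energy conservation. -/
lemma tensorS_apply_sub (rg : Regime) (v w : P3) : tensorS rg v w (v - w) = 0 := by
  cases rg
  · rw [tensorS_nonrelativistic_apply, sub_self]
  · rw [tensorS_relativistic_apply, sub_self, inner_cross_right, zero_smul, sub_zero]

/-- Exchanging v and w changes the signs of a and z × a, in which the tensor is quadratic. -/
lemma tensorS_symm (rg : Regime) (v w : P3) : tensorS rg v w = tensorS rg w v := by
  have h1 : v - w = -(w - v) := by abel
  have h2 : v + w = w + v := add_comm v w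
  ext1 y
  cases rg
  · rw [tensorS_nonrelativistic_apply, tensorS_nonrelativistic_apply, h1]
    generalize w - v = a
    simp only [inner_neg_left, inner_neg_right, neg_neg, neg_smul_neg]
  · rw [tensorS_relativistic_apply, tensorS_relativistic_apply, h1, h2, cross_neg_right]
    generalize w - v = a
    simp only [inner_neg_left, inner_neg_right, neg_neg, neg_smul_neg]

lemma inner_tensorS_left (rg : Regime) (v w x y : P3) :
    ⟪tensorS rg v w x, y⟫ = ⟪x, tensorS rg v w y⟫ := by
  cases rg
  · rw [tensorS_nonrelativistic_apply, tensorS_nonrelativistic_apply]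
    generalize v - w = a
    rw [inner_sub_left, inner_sub_right, real_inner_smul_left, real_inner_smul_left,
      real_inner_smul_right, real_inner_smul_right, real_inner_comm a x]
    ring
  · rw [tensorS_relativistic_apply, tensorS_relativistic_apply]
    generalize cross ((2 : ℝ)⁻¹ • (v + w)) (v - w) = b
    generalize v - w = a
    rw [inner_sub_left, inner_sub_right, inner_sub_left, inner_sub_right, real_inner_smul_left,
      real_inner_smul_left, real_inner_smul_left, real_inner_smul_right, real_inner_smul_right,
      real_inner_smul_right, real_inner_comm a x, real_inner_comm b x]
    ring

lemma contDiff_tensorS (rg : Regime) {n : WithTop ℕ∞} :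
    ContDiff ℝ n (fun z : P3 × P3 => tensorS rg z.1 z.2) := by
  have ha : ContDiff ℝ n (fun z : P3 × P3 => z.1 - z.2) := contDiff_fst.sub contDiff_snd
  have hz : ContDiff ℝ n (fun z : P3 × P3 => (2 : ℝ)⁻¹ • (z.1 + z.2)) :=
    (contDiff_fst.add contDiff_snd).const_smul _
  have hb := contDiff_cross hz ha
  rw [contDiff_clm_apply_iff]
  intro y
  have h1 : ContDiff ℝ n
      (fun z : P3 × P3 => ⟪z.1 - z.2, z.1 - z.2⟫ • y - ⟪z.1 - z.2, y⟫ • (z.1 - z.2)) :=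
    ((ha.inner ℝ ha).smul contDiff_const).sub ((ha.inner ℝ contDiff_const).smul ha)
  cases rg
  · exact h1
  · exact h1.sub ((hb.inner ℝ contDiff_const).smul hb)

/-- Every term is quadratic in a quantity that vanishes at v = w. The cross product term is kept in
both regimes for a uniform bound. -/
lemma norm_tensorS_le (rg : Regime) (v w : P3) :
    ‖tensorS rg v w‖ ≤ ‖v - w‖ * ‖v - w‖ + ‖v - w‖ * ‖v - w‖
      + ‖cross ((2 : ℝ)⁻¹ • (v + w)) (v - w)‖ * ‖cross ((2 : ℝ)⁻¹ • (v + w)) (v - w)‖ := by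
  have h1 : ‖⟪v - w, v - w⟫ • ContinuousLinearMap.id ℝ P3‖ ≤ ‖v - w‖ * ‖v - w‖ := by
    rw [norm_smul, real_inner_self_eq_norm_mul_norm, norm_mul, norm_norm]
    exact mul_le_of_le_one_right (by positivity) ContinuousLinearMap.norm_id_le
  have h2 : ∀ a : P3, ‖rankOne ℝ a a‖ = ‖a‖ * ‖a‖ := fun a => norm_rankOne a a
  cases rg
  · refine (norm_sub_le _ _).trans ?_
    rw [h2]
    have := mul_self_nonneg ‖cross ((2 : ℝ)⁻¹ • (v + w)) (v - w)‖
    linarith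
  · refine (norm_sub_le _ _).trans ?_
    rw [h2]
    refine add_le_add ?_ le_rfl
    refine (norm_sub_le _ _).trans ?_
    rw [h2]
    linarith

lemma tensorS_self (rg : Regime) (w : P3) : tensorS rg w w = 0 := by
  have h := norm_tensorS_le rg w w
  rw [sub_self, cross_zero_right, norm_zero] at h
  simpa using h

/-- The cross product is differentiable in v and vanishes at v = w, so it is O(|v − w|); hence the
tensor is O(|v − w|²). -/
lemma fderiv_tensorS_self (rg : Regime) (w : P3) : fderiv ℝ (fun v => tensorS rg v w) w = 0 := by
  have hz : ContDiff ℝ 1 (fun v : P3 => (2 : ℝ)⁻¹ • (v + w)) :=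
    (contDiff_id.add contDiff_const).const_smul _
  have ha : ContDiff ℝ 1 (fun v : P3 => v - w) := contDiff_id.sub contDiff_const
  have hb := (contDiff_cross hz ha).differentiable one_ne_zero w
  have hb0 : cross ((2 : ℝ)⁻¹ • (w + w)) (w - w) = 0 := by rw [sub_self, cross_zero_right]
  have hO : (fun v : P3 => cross ((2 : ℝ)⁻¹ • (v + w)) (v - w)) =O[nhds w] fun v => v - w := by
    have := hb.hasFDerivAt.isBigO_sub
    simpa only [hb0, sub_zero] using this
  have hid : (fun v : P3 => v - w) =O[nhds w] fun v => v - w := Asymptotics.isBigO_refl _ _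
  have hsmall : (fun v : P3 => ‖v - w‖) =o[nhds w] (fun _ => (1 : ℝ)) := by
    rw [Asymptotics.isLittleO_one_iff]
    have : Continuous (fun v : P3 => ‖v - w‖) := by fun_prop
    simpa using this.tendsto w
  have hsq : (fun v : P3 => ‖v - w‖ * ‖v - w‖) =o[nhds w] fun v => v - w := by
    have := hsmall.mul_isBigO hid.norm_norm
    simp only [one_mul] at this
    exact this.of_norm_right
  have hle : (fun v : P3 => tensorS rg v w) =O[nhds w] fun v : P3 => ‖v - w‖ * ‖v - w‖ := by
    refine (Asymptotics.IsBigO.of_bound 1 (Filter.Eventually.of_forall fun v => ?_)).trans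
      (((hid.norm_norm.mul hid.norm_norm).add (hid.norm_norm.mul hid.norm_norm)).add
        (hO.norm_norm.mul hO.norm_norm))
    rw [one_mul]
    exact (norm_tensorS_le rg v w).trans (le_abs_self _)
  have : HasFDerivAt (fun v => tensorS rg v w) (0 : P3 →L[ℝ] P3 →L[ℝ] P3) w := by
    refine HasFDerivAt.of_isLittleO ?_
    simpa [tensorS_self] using hle.trans_isLittleO hsq
  exact this.fderiv

/-- On bounded sets the tensor vanishes to second order, and its derivative to first order, on
the diagonal. -/
lemma exists_tensorS_bound (rg : Regime) (B : ℝ) : ∃ C : ℝ, 0 ≤ C ∧ ∀ v w : P3, ‖v‖ ≤ B → ‖w‖ ≤ B →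
    ‖tensorS rg v w‖ ≤ C * ‖v - w‖ ^ 2 ∧
      ‖fderiv ℝ (fun v' => tensorS rg v' w) v‖ ≤ C * ‖v - w‖ := by
  set D : P3 × P3 → P3 →L[ℝ] P3 →L[ℝ] P3 := fun z => fderiv ℝ (fun v' => tensorS rg v' z.2) z.1
    with hD
  have hDeq : D = fun z => (fderiv ℝ (fun z : P3 × P3 => tensorS rg z.1 z.2) z).comp
      (ContinuousLinearMap.inl ℝ P3 P3) := by
    funext z
    have h1 : DifferentiableAt ℝ (fun z : P3 × P3 => tensorS rg z.1 z.2) (z.1, z.2) :=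
      (contDiff_tensorS rg (n := 1)).differentiable one_ne_zero _
    have h2 : HasFDerivAt (fun v' : P3 => (v', z.2)) (ContinuousLinearMap.inl ℝ P3 P3) z.1 :=
      hasFDerivAt_prodMk_left z.1 z.2
    exact (h1.hasFDerivAt.comp z.1 h2).fderiv
  have hDc : ContDiff ℝ 1 D := by
    rw [hDeq]
    exact ((contDiff_tensorS rg (n := 2)).fderiv_right (m := 1) (by norm_num)).clm_comp
      contDiff_const
  -- The derivative D in v is C¹, hence Lipschitz on the ball of radius B, and it vanishes on the
  -- diagonal. This gives its first-order bound.
  obtain ⟨L, hL⟩ := LocallyLipschitzOn.exists_lipschitzOnWith_of_compact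
    ((isCompact_closedBall (0 : P3) B).prod (isCompact_closedBall (0 : P3) B))
    hDc.locallyLipschitz.locallyLipschitzOn
  have hder : ∀ v w : P3, ‖v‖ ≤ B → ‖w‖ ≤ B → ‖D (v, w)‖ ≤ L * ‖v - w‖ := by
    intro v w hv hw
    have h1 := hL.dist_le_mul (v, w) ⟨by simpa using hv, by simpa using hw⟩ (w, w)
      ⟨by simpa using hw, by simpa using hw⟩
    have h2 : D (w, w) = 0 := fderiv_tensorS_self rg w
    have h3 : dist (D (v, w)) (D (w, w)) = ‖D (v, w)‖ := by
      rw [h2]; exact dist_zero_right (E := P3 →L[ℝ] P3 →L[ℝ] P3) (D (v, w))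
    rw [h3, Prod.dist_eq, dist_self, dist_eq_norm v w] at h1
    simpa using h1
  refine ⟨L, L.coe_nonneg, fun v w hv hw => ⟨?_, hder v w hv hw⟩⟩
  -- Mean value inequality on a convex set around w on which the derivative is at most L ‖v − w‖.
  -- The second factor ‖v − w‖ is the length of the segment.
  have hmv := ((convex_closedBall (0 : P3) B).inter
    (convex_closedBall w ‖v - w‖)).norm_image_sub_le_of_norm_fderiv_le (𝕜 := ℝ) (f := fun v' => tensorS rg v' w) (C := L * ‖v - w‖) (x := w) (y := v) ?_ ?_ ?_ ?_
  · rw [tensorS_self, sub_zero] at hmv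
    calc _ ≤ _ := hmv
      _ = _ := by ring
  · intro x _
    exact ((contDiff_tensorS rg (n := 1)).comp
      (contDiff_id.prodMk contDiff_const)).differentiable one_ne_zero x
  · rintro x ⟨hx, hx'⟩
    refine (hder x w (by simpa using hx) hw).trans ?_
    refine mul_le_mul_of_nonneg_left ?_ L.coe_nonneg
    rw [← dist_eq_norm]
    exact hx'
  · exact ⟨by simpa using hw, by simp⟩
  · exact ⟨by simpa using hv, by simp [dist_eq_norm]⟩

/-! ### The kernel -/

lemma norm_fderiv_smul_le {E F : Type*} [NormedAddCommGroup E] [NormedSpace ℝ E]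
    [NormedAddCommGroup F] [NormedSpace ℝ F] {c : E → ℝ} {g : E → F} {g' : E →L[ℝ] F} {x : E}
    (hc : DifferentiableAt ℝ c x) (hg : HasFDerivAt g g' x) :
    ‖fderiv ℝ (fun y => c y • g y) x‖ ≤ |c x| * ‖g'‖ + ‖fderiv ℝ c x‖ * ‖g x‖ := by
  rw [(hc.hasFDerivAt.fun_smul hg).fderiv]
  refine (norm_add_le _ _).trans ?_
  rw [norm_smul, Real.norm_eq_abs, ContinuousLinearMap.norm_smulRight_apply]

namespace Mesh

variable {ι : Type*} [Fintype ι] [DecidableEq ι] {M : Mesh ι} {k : ℕ} {Λ : P3 → P3 → ℝ}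

lemma dgrad_eq_of_mem {e : ι → P3 → ℝ} (he : M.InW k e) (heC : M.IsC1 e) (u : P3) (R R' : ι)
    (x : P3) (hx : x ∈ M.elem R ∩ M.elem R') : M.dgrad k u e R x = M.dgrad k u e R' x := by
  rw [dgrad_eq_gradient he heC u R hx.1, dgrad_eq_gradient he heC u R' hx.2]
  exact (heC R R' x hx).2

lemma contDiffOn_kernel (hΛ : M.AdmissibleFactor Λ) (rg : Regime) (u : P3) (e : ι → P3 → ℝ)
    (R R' : ι) :
    ContDiffOn ℝ 1 (fun z : P3 × P3 => M.kernel rg k u Λ e R R' z.1 z.2) {z | z.1 ≠ z.2} := by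
  have hv : ∀ R, ContDiff ℝ 1 (M.dgrad k u e R) := fun R => (M.dgrad_inW3 k u e).contDiff R
  have hS : ContDiff ℝ 1 (fun z : P3 × P3 =>
      tensorS rg (M.dgrad k u e R z.1) (M.dgrad k u e R' z.2)) :=
    (contDiff_tensorS rg).comp (((hv R).comp contDiff_fst).prodMk ((hv R').comp contDiff_snd))
  exact hΛ.contDiffOn.smul hS.contDiffOn

lemma kernel_symm (hΛ : M.AdmissibleFactor Λ) (rg : Regime) (u : P3) (e : ι → P3 → ℝ)
    (R R' : ι) (p q : P3) : M.kernel rg k u Λ e R R' p q = M.kernel rg k u Λ e R' R q p := by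
  rw [kernel, kernel, hΛ.symm p q, tensorS_symm]

lemma inner_kernel_left (rg : Regime) (u : P3) (e : ι → P3 → ℝ) (R R' : ι) (p q x y : P3) :
    ⟪M.kernel rg k u Λ e R R' p q x, y⟫ = ⟪x, M.kernel rg k u Λ e R R' p q y⟫ := by
  simp only [kernel, _root_.smul_apply, real_inner_smul_left, real_inner_smul_right,
    inner_tensorS_left]

/-- The kernel annihilates the difference of the velocities. -/
lemma kernel_apply_sub (rg : Regime) (u : P3) (e : ι → P3 → ℝ) (R R' : ι) (p q : P3) :
    M.kernel rg k u Λ e R R' p q (M.dgrad k u e R p - M.dgrad k u e R' q) = 0 := by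
  rw [kernel, _root_.smul_apply, tensorS_apply_sub, smul_zero]

lemma exists_norm_dgrad_le (M : Mesh ι) (k : ℕ) (u : P3) (g : ι → P3 → ℝ) :
    ∃ B : ℝ, ∀ R, ∀ x ∈ M.elem R, ‖M.dgrad k u g R x‖ ≤ B ∧
      ‖fderiv ℝ (M.dgrad k u g R) x‖ ≤ B := by
  have h : ∀ R, ∃ B : ℝ, ∀ x ∈ M.elem R, ‖M.dgrad k u g R x‖ ≤ B ∧
      ‖fderiv ℝ (M.dgrad k u g R) x‖ ≤ B := by
    intro R
    have hc : ContDiff ℝ 1 (M.dgrad k u g R) := (M.dgrad_inW3 k u g).contDiff R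
    obtain ⟨B1, h1⟩ := (M.isCompact_elem R).exists_bound_of_continuousOn hc.continuous.continuousOn
    obtain ⟨B2, h2⟩ := (M.isCompact_elem R).exists_bound_of_continuousOn
      (hc.continuous_fderiv one_ne_zero).continuousOn
    exact ⟨max B1 B2, fun x hx => ⟨(h1 x hx).trans (le_max_left _ _),
      (h2 x hx).trans (le_max_right _ _)⟩⟩
  choose B hB using h
  obtain ⟨C, hC⟩ := (Set.finite_range B).bddAbove
  exact ⟨C, fun R x hx => ⟨(hB R x hx).1.trans (hC ⟨R, rfl⟩), (hB R x hx).2.trans (hC ⟨R, rfl⟩)⟩⟩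

/-- The kernel is weakly singular, and so is its derivative. -/
lemma exists_kernel_bound (hΛ : M.AdmissibleFactor Λ) (rg : Regime) (u : P3) {e : ι → P3 → ℝ}
    (he : M.InW k e) (heC : M.IsC1 e) :
    ∃ C α : ℝ, 0 ≤ C ∧ -3 < α ∧ ∀ R R', ∀ p ∈ M.elem R, ∀ q ∈ M.elem R', p ≠ q →
      ‖M.kernel rg k u Λ e R R' p q‖ ≤ C * dist p q ^ (α + 1) ∧
      ‖fderiv ℝ (fun p' => M.kernel rg k u Λ e R R' p' q) p‖ ≤ C * dist p q ^ α := by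
  obtain ⟨C, γ, hγ, hgrow⟩ := hΛ.growth
  obtain ⟨L, hL0, hL⟩ := M.exists_lipschitz
    (fun R => (M.dgrad_inW3 k u e).contDiff R (n := 1)) (dgrad_eq_of_mem he heC u)
  obtain ⟨B, hB⟩ := exists_norm_dgrad_le M k u e
  obtain ⟨T, hT0, hT⟩ := exists_tensorS_bound rg B
  -- The exponent is α = γ + 1 > −3. With d = dist p q, the kernel is bounded by d^γ · d² = d^(α+1).
  -- Its derivative has the contribution d^(γ−1) · d² from ∇Λ and d^γ · d from the tensor, both
  -- equal to d^α. The two summands of the constant belong to these contributions.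
  refine ⟨|C| * (T * L ^ 2) + |C| * (T * L * |B|), γ + 1, by positivity, by linarith,
    fun R R' p hp q hq hpq => ?_⟩
  set v := M.dgrad k u e R with hv
  set w := M.dgrad k u e R' q with hw
  have hd : 0 < dist p q := dist_pos.2 hpq
  set d := dist p q with hdd
  have hpD : p ∈ M.closedDomain := Set.mem_iUnion.2 ⟨R, hp⟩
  have hqD : q ∈ M.closedDomain := Set.mem_iUnion.2 ⟨R', hq⟩
  obtain ⟨g1, g2⟩ := hgrow p hpD q hqD hpq
  have g1' : |Λ p q| ≤ |C| * d ^ γ :=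
    g1.trans (mul_le_mul_of_nonneg_right (le_abs_self C) (by positivity))
  have g2' : ‖fderiv ℝ (fun p' => Λ p' q) p‖ ≤ |C| * d ^ (γ - 1) :=
    g2.trans (mul_le_mul_of_nonneg_right (le_abs_self C) (by positivity))
  obtain ⟨t1, t2⟩ := hT (v p) w (hB R p hp).1 (hB R' q hq).1
  have hvw : ‖v p - w‖ ≤ L * d := hL R R' p hp q hq
  have t1' : ‖tensorS rg (v p) w‖ ≤ T * L ^ 2 * d ^ 2 := by
    refine t1.trans ?_
    calc T * ‖v p - w‖ ^ 2 ≤ T * (L * d) ^ 2 := by gcongr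
      _ = T * L ^ 2 * d ^ 2 := by ring
  have hB0 : ‖fderiv ℝ v p‖ ≤ |B| := (hB R p hp).2.trans (le_abs_self B)
  have t2' : ‖(fderiv ℝ (fun v' => tensorS rg v' w) (v p)).comp (fderiv ℝ v p)‖
      ≤ T * L * |B| * d := by
    refine (ContinuousLinearMap.opNorm_comp_le _ _).trans ?_
    calc _ ≤ (T * ‖v p - w‖) * |B| := by gcongr
      _ ≤ (T * (L * d)) * |B| := by gcongr
      _ = T * L * |B| * d := by ring
  have r1 : d ^ (γ + 1 + 1) = d ^ γ * d ^ 2 := by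
    rw [add_assoc, Real.rpow_add hd]; norm_num
  have r2 : d ^ (γ + 1) = d ^ γ * d := by rw [Real.rpow_add hd, Real.rpow_one]
  have r3 : d ^ (γ - 1) * d ^ 2 = d ^ (γ + 1) := by
    have : γ + 1 = (γ - 1) + 2 := by ring
    rw [this, Real.rpow_add hd]; norm_num
  constructor
  · rw [kernel, norm_smul, Real.norm_eq_abs, r1]
    calc |Λ p q| * ‖tensorS rg (v p) w‖ ≤ (|C| * d ^ γ) * (T * L ^ 2 * d ^ 2) := by gcongr
      _ = |C| * (T * L ^ 2) * (d ^ γ * d ^ 2) := by ring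
      _ ≤ _ := by
        refine mul_le_mul_of_nonneg_right ?_ (by positivity)
        have : 0 ≤ |C| * (T * L * |B|) := by positivity
        linarith
  · have hΛd : DifferentiableAt ℝ (fun p' => Λ p' q) p := by
      have h1 : DifferentiableAt ℝ (fun z : P3 × P3 => Λ z.1 z.2) (p, q) :=
        (hΛ.contDiffOn.differentiableOn one_ne_zero).differentiableAt (isOpen_offDiag.mem_nhds hpq)
      exact h1.comp p (f := fun p' : P3 => (p', q)) (by fun_prop)
    have hvd : DifferentiableAt ℝ v p :=
      ((M.dgrad_inW3 k u e).contDiff R (n := 1)).differentiable one_ne_zero p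
    have hSd : DifferentiableAt ℝ (fun v' => tensorS rg v' w) (v p) :=
      ((contDiff_tensorS rg (n := 1)).comp
        (contDiff_id.prodMk contDiff_const)).differentiable one_ne_zero _
    have hcomp := hSd.hasFDerivAt.comp p hvd.hasFDerivAt
    refine (norm_fderiv_smul_le hΛd hcomp).trans ?_
    have e1 : |Λ p q| * ‖(fderiv ℝ (fun v' => tensorS rg v' w) (v p)).comp (fderiv ℝ v p)‖
        ≤ |C| * (T * L * |B|) * d ^ (γ + 1) := by
      rw [r2]
      calc _ ≤ (|C| * d ^ γ) * (T * L * |B| * d) := by gcongr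
        _ = _ := by ring
    have e2 : ‖fderiv ℝ (fun p' => Λ p' q) p‖ * ‖tensorS rg (v p) w‖
        ≤ |C| * (T * L ^ 2) * d ^ (γ + 1) := by
      rw [← r3]
      calc _ ≤ (|C| * d ^ (γ - 1)) * (T * L ^ 2 * d ^ 2) := by gcongr
        _ = _ := by ring
    rw [add_mul, add_comm (|C| * (T * L ^ 2) * d ^ (γ + 1))]
    exact add_le_add e1 e2

/-! ### The advection field -/

/-- The advection field is continuous up to the boundary of each element, and has in each element a
derivative that is continuous up to the boundary. -/
lemma exists_fderiv_advection (hΛ : M.AdmissibleFactor Λ) (rg : Regime) (u : P3)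
    {e : ι → P3 → ℝ} (he : M.InW k e) (heC : M.IsC1 e) (f : ι → P3 → ℝ) (R : ι) :
    ContinuousOn (M.advection rg k u Λ e f R) (M.elem R) ∧
    ∃ U' : P3 → P3 →L[ℝ] P3, ContinuousOn U' (M.elem R) ∧
      ∀ x ∈ interior (M.elem R), HasFDerivAt (M.advection rg k u Λ e f R) (U' x) x := by
  obtain ⟨C, α, hC0, hα, hb⟩ := exists_kernel_bound hΛ rg u he heC
  obtain ⟨B, hB⟩ := exists_norm_dgrad_le M k u f
  set h : ι → P3 → P3 → P3 := fun R' p q => M.kernel rg k u Λ e R R' p q (M.dgrad k u f R' q)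
    with hh
  have hker : ∀ R' p q, p ≠ q →
      DifferentiableAt ℝ (fun p' => M.kernel rg k u Λ e R R' p' q) p := by
    intro R' p q hpq
    have h1 : DifferentiableAt ℝ (fun z : P3 × P3 => M.kernel rg k u Λ e R R' z.1 z.2) (p, q) :=
      ((contDiffOn_kernel hΛ rg u e R R').differentiableOn one_ne_zero).differentiableAt
        (isOpen_offDiag.mem_nhds hpq)
    exact h1.comp p (f := fun p' : P3 => (p', q)) (by fun_prop)
  have hcd : ∀ R', ContDiffOn ℝ 1 (fun z : P3 × P3 => h R' z.1 z.2) {z | z.1 ≠ z.2} := fun R' =>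
    (contDiffOn_kernel hΛ rg u e R R').clm_apply
      (((M.dgrad_inW3 k u f).contDiff R').comp contDiff_snd).contDiffOn
  have hb1 : ∀ R', ∀ p ∈ M.elem R, ∀ q ∈ M.elem R', p ≠ q →
      ‖h R' p q‖ ≤ C * |B| * dist p q ^ (α + 1) := by
    intro R' p hp q hq hpq
    refine (ContinuousLinearMap.le_opNorm _ _).trans ?_
    calc _ ≤ (C * dist p q ^ (α + 1)) * |B| := by
          gcongr
          · exact (hb R R' p hp q hq hpq).1
          · exact (hB R' q hq).1.trans (le_abs_self B)
      _ = _ := by ring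
  have hb2 : ∀ R', ∀ p ∈ M.elem R, ∀ q ∈ M.elem R', p ≠ q →
      ‖fderiv ℝ (fun p' => h R' p' q) p‖ ≤ C * |B| * dist p q ^ α := by
    intro R' p hp q hq hpq
    have e1 := (hker R' p q hpq).hasFDerivAt.clm_apply
      (hasFDerivAt_const (M.dgrad k u f R' q) p)
    have e2 : fderiv ℝ (fun p' => h R' p' q) p
        = (fderiv ℝ (fun p' => M.kernel rg k u Λ e R R' p' q) p).flip (M.dgrad k u f R' q) := by
      refine e1.fderiv.trans ?_
      ext1 x
      simp
    rw [e2]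
    refine (ContinuousLinearMap.le_opNorm _ _).trans ?_
    rw [ContinuousLinearMap.opNorm_flip]
    calc _ ≤ (C * dist p q ^ α) * |B| := by
          gcongr
          · exact (hb R R' p hp q hq hpq).2
          · exact (hB R' q hq).1.trans (le_abs_self B)
      _ = _ := by ring
  have hbd := (M.isCompact_elem R).isBounded
  have hU : M.advection rg k u Λ e f R = fun p => ∑ R', ∫ q in M.elem R', h R' p q := rfl
  -- The derivative is defined by the differentiated kernel on the whole closed element, which gives
  -- its continuity up to the boundary.
  refine ⟨?_, fun p => ∑ R', ∫ q in M.elem R', fderiv ℝ (fun p' => h R' p' q) p, ?_, ?_⟩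
  · rw [hU]
    exact continuousOn_finsetSum _ fun R' _ =>
      continuousOn_singularIntegral (by linarith) (hcd R').continuousOn hbd
        (M.isCompact_elem R') (M.convex_elem R') (hb1 R')
  · exact continuousOn_finsetSum _ fun R' _ =>
      continuousOn_singularIntegral hα (continuousOn_fderiv_left (hcd R')) hbd
        (M.isCompact_elem R') (M.convex_elem R') (hb2 R')
  · intro x hx
    rw [hU]
    exact HasFDerivAt.fun_sum fun R' _ =>
      hasFDerivAt_singularIntegral (hcd R') hα (by linarith) hbd (M.convex_elem R)
        (M.isCompact_elem R') (M.convex_elem R') (hb1 R') (hb2 R') hx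

/-- U_h(p) depends on the element of p only through the discrete gradient of the energy, which is
single-valued because the discrete energy is C¹. -/
lemma advection_eq_of_mem {e : ι → P3 → ℝ} (he : M.InW k e) (heC : M.IsC1 e) (rg : Regime) (u : P3)
    (f : ι → P3 → ℝ) (R R' : ι) (x : P3) (hx : x ∈ M.elem R ∩ M.elem R') :
    M.advection rg k u Λ e f R x = M.advection rg k u Λ e f R' x := by
  simp only [advection, kernel, dgrad_eq_of_mem he heC u R R' x hx]

end Mesh

/-! ### Conservation -/

/-- Joint integrability, needed to exchange p and q. The diagonal is null for the product measure,
and the inner integrals of the norm are bounded uniformly in p. -/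
lemma integrable_prod_of_singular {h : P3 × P3 → ℝ} {α C : ℝ} (hα : -3 < α)
    (hc : ContinuousOn h {z | z.1 ≠ z.2}) {A B : Set P3} (hA : IsCompact A) (hB : IsCompact B)
    (hb : ∀ p ∈ A, ∀ q ∈ B, p ≠ q → ‖h (p, q)‖ ≤ C * dist p q ^ α) :
    Integrable h ((volume.restrict A).prod (volume.restrict B)) := by
  obtain ⟨N, hN0, hN⟩ := exists_integral_dist_rpow_le hα hA.isBounded hB.isBounded
  have hm : AEStronglyMeasurable h ((volume.restrict A).prod (volume.restrict B)) := by
    rw [Measure.prod_restrict]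
    refine AEStronglyMeasurable.restrict ?_
    have h1 := hc.aestronglyMeasurable (μ := (volume : Measure P3).prod (volume : Measure P3))
      isOpen_offDiag.measurableSet
    rwa [Measure.restrict_eq_self_of_ae_mem] at h1
    refine (Measure.measure_prod_null isOpen_offDiag.measurableSet.compl).2
      (Filter.Eventually.of_forall fun p => ?_)
    exact measure_mono_null (fun q hq => (not_not.1 hq).symm) (measure_singleton p)
  have : IsFiniteMeasure ((volume : Measure P3).restrict A) :=
    isFiniteMeasure_restrict.2 hA.measure_lt_top.ne
  have hcc : ContinuousOn (fun z : P3 × P3 => (fun p q => h (p, q)) z.1 z.2) {z | z.1 ≠ z.2} := hc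
  refine (integrable_prod_iff hm).2 ⟨?_, ?_⟩
  · filter_upwards [ae_restrict_mem hA.measurableSet] with p hp
    exact integrableOn_of_singular (h := fun p q => h (p, q)) hα hcc hB.isBounded hB.measurableSet
      (hb p hp)
  · refine Integrable.mono' (integrable_const (|C| * N)) hm.norm.integral_prod_right' ?_
    filter_upwards [ae_restrict_mem hA.measurableSet] with p hp
    rw [Real.norm_of_nonneg (integral_nonneg fun _ => norm_nonneg _)]
    refine (integral_norm_le_of_singular (h := fun p q => h (p, q)) (C := |C|) hcc (hN p hp).1
      hB.measurableSet fun q hq hpq => ?_).trans ?_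
    · exact (hb p hp q hq hpq).trans (mul_le_mul_of_nonneg_right (le_abs_self C) (by positivity))
    · exact mul_le_mul_of_nonneg_left (hN p hp).2 (abs_nonneg C)

namespace Mesh

variable {ι : Type*} [Fintype ι] [DecidableEq ι] {M : Mesh ι} {k : ℕ} {Λ : P3 → P3 → ℝ}

lemma integrable_kernel_pairing (hΛ : M.AdmissibleFactor Λ) (rg : Regime) (u : P3)
    {e : ι → P3 → ℝ} (he : M.InW k e) (heC : M.IsC1 e) (R R' : ι) {a : P3 × P3 → ℝ}
    {x y : P3 × P3 → P3} (ha : Continuous a) (hx : Continuous x) (hy : Continuous y) :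
    Integrable (fun z : P3 × P3 => a z * ⟪x z, M.kernel rg k u Λ e R R' z.1 z.2 (y z)⟫)
      ((volume.restrict (M.elem R)).prod (volume.restrict (M.elem R'))) := by
  obtain ⟨C, α, hC0, hα, hb⟩ := exists_kernel_bound hΛ rg u he heC
  obtain ⟨B, hB⟩ := ((M.isCompact_elem R).prod (M.isCompact_elem R')).exists_bound_of_continuousOn
    (f := fun z => |a z| * (‖x z‖ * ‖y z‖)) (by fun_prop)
  refine integrable_prod_of_singular (α := α + 1) (C := C * B) (by linarith) ?_
    (M.isCompact_elem R) (M.isCompact_elem R') ?_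
  · exact ha.continuousOn.mul (hx.continuousOn.inner
      ((contDiffOn_kernel hΛ rg u e R R').continuousOn.clm_apply hy.continuousOn))
  · intro p hp q hq hpq
    have h1 := (hb R R' p hp q hq hpq).1
    have h2 : |a (p, q)| * (‖x (p, q)‖ * ‖y (p, q)‖) ≤ B :=
      (le_abs_self _).trans (hB (p, q) ⟨hp, hq⟩)
    rw [Real.norm_eq_abs, abs_mul]
    calc |a (p, q)| * |⟪x (p, q), M.kernel rg k u Λ e R R' p q (y (p, q))⟫|
        ≤ |a (p, q)| * (‖x (p, q)‖ * (‖M.kernel rg k u Λ e R R' p q‖ * ‖y (p, q)‖)) := by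
          gcongr
          refine (abs_real_inner_le_norm _ _).trans ?_
          gcongr
          exact ContinuousLinearMap.le_opNorm _ _
      _ = ‖M.kernel rg k u Λ e R R' p q‖ * (|a (p, q)| * (‖x (p, q)‖ * ‖y (p, q)‖)) := by ring
      _ ≤ (C * dist p q ^ (α + 1)) * B := by gcongr
      _ = C * B * dist p q ^ (α + 1) := by ring

lemma integrableOn_kernel (hΛ : M.AdmissibleFactor Λ) (rg : Regime) (u : P3)
    {e : ι → P3 → ℝ} (he : M.InW k e) (heC : M.IsC1 e) (R R' : ι) {p : P3} (hp : p ∈ M.elem R) :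
    IntegrableOn (M.kernel rg k u Λ e R R' p) (M.elem R') := by
  obtain ⟨C, α, hC0, hα, hb⟩ := exists_kernel_bound hΛ rg u he heC
  exact integrableOn_of_singular (α := α + 1) (by linarith)
    (contDiffOn_kernel hΛ rg u e R R').continuousOn (M.isCompact_elem R').isBounded
    (M.measurableSet_elem R') fun q hq hpq => (hb R R' p hp q hq hpq).1

lemma inner_diffusion_apply (hΛ : M.AdmissibleFactor Λ) (rg : Regime) (u : P3)
    {e f : ι → P3 → ℝ} (he : M.InW k e) (heC : M.IsC1 e) (hf : M.InW k f) (R : ι) {p : P3}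
    (hp : p ∈ M.elem R) (x y : P3) :
    ⟪x, M.diffusion rg k u Λ e f R p y⟫
      = ∑ R', ∫ q in M.elem R', f R' q * ⟪x, M.kernel rg k u Λ e R R' p q y⟫ := by
  rw [diffusion, _root_.sum_apply, inner_sum]
  refine Finset.sum_congr rfl fun R' _ => ?_
  have hi : IntegrableOn (fun q => f R' q • M.kernel rg k u Λ e R R' p q) (M.elem R') :=
    (integrableOn_kernel hΛ rg u he heC R R' hp).continuousOn_smul
      (hf.contDiff R' (n := 0)).continuous.continuousOn (M.isCompact_elem R')
  rw [ContinuousLinearMap.integral_apply hi, ← integral_inner (hi.apply_continuousLinearMap y)]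
  simp only [_root_.smul_apply, real_inner_smul_right]

/-- The kernel is self-adjoint, so it can be moved onto the test vector, as in the diffusion term.
-/
lemma inner_advection (hΛ : M.AdmissibleFactor Λ) (rg : Regime) (u : P3)
    {e : ι → P3 → ℝ} (he : M.InW k e) (heC : M.IsC1 e) (f : ι → P3 → ℝ) (R : ι) {p : P3}
    (hp : p ∈ M.elem R) (y : P3) :
    ⟪M.advection rg k u Λ e f R p, y⟫
      = ∑ R', ∫ q in M.elem R', ⟪M.dgrad k u f R' q, M.kernel rg k u Λ e R R' p q y⟫ := by
  rw [advection, sum_inner]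
  refine Finset.sum_congr rfl fun R' _ => ?_
  have hG : Continuous (M.dgrad k u f R') := ((M.dgrad_inW3 k u f).contDiff R' (n := 0)).continuous
  obtain ⟨B, hB⟩ := (M.isCompact_elem R').exists_bound_of_continuousOn hG.continuousOn
  have hi : IntegrableOn (fun q => M.kernel rg k u Λ e R R' p q (M.dgrad k u f R' q))
      (M.elem R') := by
    have hK := integrableOn_kernel hΛ rg u he heC R R' hp
    refine Integrable.mono' (hK.norm.mul_const B)
      ((ContinuousLinearMap.id ℝ (P3 →L[ℝ] P3)).aestronglyMeasurable_comp₂ hK.1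
        hG.aestronglyMeasurable) ?_
    filter_upwards [ae_restrict_mem (M.measurableSet_elem R')] with q hq
    exact (ContinuousLinearMap.le_opNorm _ _).trans
      (mul_le_mul_of_nonneg_left (hB q hq) (norm_nonneg _))
  rw [real_inner_comm, ← integral_inner hi]
  refine integral_congr_ae (Filter.Eventually.of_forall fun q => ?_)
  exact (real_inner_comm _ _).trans (inner_kernel_left rg u e R R' p q _ y)

/-- Diffusion and advection balance when tested with a function whose gradient differences are
annihilated by the kernel. -/
theorem diffusion_eq_advection (hΛ : M.AdmissibleFactor Λ) (rg : Regime) (u : P3)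
    {e f φ : ι → P3 → ℝ} (he : M.InW k e) (heC : M.IsC1 e) (hf : M.InW k f) (hφ : M.InW k φ)
    (hφC : M.IsC1 φ)
    (hker : ∀ R R', ∀ p ∈ M.elem R, ∀ q ∈ M.elem R',
      M.kernel rg k u Λ e R R' p q (∇ (φ R) p - ∇ (φ R') q) = 0) :
    M.ipv (M.dgrad k u f) (fun R p => M.diffusion rg k u Λ e f R p (M.dgrad k u φ R p))
      = M.ipv (fun R p => f R p • M.advection rg k u Λ e f R p) (fun R => ∇ (φ R)) := by
  have hfc : ∀ R, Continuous (f R) := fun R => (hf.contDiff R (n := 0)).continuous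
  have hGc : ∀ R, Continuous (M.dgrad k u f R) := fun R =>
    ((M.dgrad_inW3 k u f).contDiff R (n := 0)).continuous
  have hgc : ∀ R, Continuous (∇ (φ R)) := fun R => (hφ.gradient.contDiff R (n := 0)).continuous
  have i1 : ∀ R R', Integrable (fun z : P3 × P3 => f R' z.2 *
      ⟪M.dgrad k u f R z.1, M.kernel rg k u Λ e R R' z.1 z.2 (∇ (φ R) z.1)⟫)
      ((volume.restrict (M.elem R)).prod (volume.restrict (M.elem R'))) := fun R R' =>
    integrable_kernel_pairing hΛ rg u he heC R R' (a := fun z => f R' z.2)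
      (x := fun z => M.dgrad k u f R z.1) (y := fun z => ∇ (φ R) z.1)
      ((hfc R').comp continuous_snd) ((hGc R).comp continuous_fst) ((hgc R).comp continuous_fst)
  have i2 : ∀ R R', Integrable (fun z : P3 × P3 => f R z.1 *
      ⟪M.dgrad k u f R' z.2, M.kernel rg k u Λ e R R' z.1 z.2 (∇ (φ R) z.1)⟫)
      ((volume.restrict (M.elem R)).prod (volume.restrict (M.elem R'))) := fun R R' =>
    integrable_kernel_pairing hΛ rg u he heC R R' (a := fun z => f R z.1)
      (x := fun z => M.dgrad k u f R' z.2) (y := fun z => ∇ (φ R) z.1)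
      ((hfc R).comp continuous_fst) ((hGc R').comp continuous_snd) ((hgc R).comp continuous_fst)
  have e1 : M.ipv (M.dgrad k u f)
      (fun R p => M.diffusion rg k u Λ e f R p (M.dgrad k u φ R p))
      = ∑ R, ∑ R', ∫ p in M.elem R, ∫ q in M.elem R', f R' q *
        ⟪M.dgrad k u f R p, M.kernel rg k u Λ e R R' p q (∇ (φ R) p)⟫ := by
    refine Finset.sum_congr rfl fun R _ => ?_
    rw [← integral_finsetSum _ fun R' _ => (i1 R R').integral_prod_left]
    refine setIntegral_congr_fun (M.measurableSet_elem R) fun p hp => ?_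
    simp only
    rw [dgrad_eq_gradient hφ hφC u R hp, inner_diffusion_apply hΛ rg u he heC hf R hp]
  have e2 : M.ipv (fun R p => f R p • M.advection rg k u Λ e f R p) (fun R => ∇ (φ R))
      = ∑ R, ∑ R', ∫ p in M.elem R, ∫ q in M.elem R', f R p *
        ⟪M.dgrad k u f R' q, M.kernel rg k u Λ e R R' p q (∇ (φ R) p)⟫ := by
    refine Finset.sum_congr rfl fun R _ => ?_
    rw [← integral_finsetSum _ fun R' _ => (i2 R R').integral_prod_left]
    refine setIntegral_congr_fun (M.measurableSet_elem R) fun p hp => ?_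
    simp only
    rw [real_inner_smul_left, inner_advection hΛ rg u he heC f R hp, Finset.mul_sum]
    simp only [integral_const_mul]
  -- Exchange the roles of p and q in the diffusion term. By symmetry of the kernel its integrand
  -- becomes f(p) ∇_h f(q)·Φ ∇φ(q), and `hker` lets ∇φ(p) replace ∇φ(q).
  rw [e1, e2, Finset.sum_comm]
  refine Finset.sum_congr rfl fun R _ => Finset.sum_congr rfl fun R' _ => ?_
  rw [integral_integral_swap (i1 R' R)]
  refine setIntegral_congr_fun (M.measurableSet_elem R) fun p hp =>
    setIntegral_congr_fun (M.measurableSet_elem R') fun q hq => ?_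
  have h := hker R R' p hp q hq
  rw [map_sub, sub_eq_zero] at h
  rw [kernel_symm hΛ, h]

end Mesh

/-! ### The upwind flux -/

namespace Mesh

variable {ι : Type*} {M : Mesh ι} {k : ℕ}

/-- Central flux plus |U·n| times half the jump. Both parts change sign when the interface is seen
from the other side. -/
lemma upwindFlux_eq (U : ι → P3 → P3) (f : ι → P3 → ℝ) (R R' : ι) (x : P3) :
    M.upwindFlux U f R R' x
      = ⟪U R x, M.normal R x⟫ * ((f R x + f R' x) / 2)
        + |⟪U R x, M.normal R x⟫| * ((f R x - f R' x) / 2) := by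
  rw [upwindFlux]
  split_ifs with h
  · rw [abs_of_pos h]; ring
  · rw [abs_of_nonpos (not_lt.1 h)]; ring

lemma ae_inner_normal_interface {U : ι → P3 → P3}
    (hU : ∀ R R', ∀ x ∈ M.elem R ∩ M.elem R', U R x = U R' x) {R R' : ι} (hne : R ≠ R') :
    ∀ᵐ x ∂(μHE[2] : Measure P3).restrict (M.interface R R'),
      ⟪U R' x, M.normal R' x⟫ = - ⟪U R x, M.normal R x⟫ := by
  filter_upwards [M.ae_normal_interface hne, ae_restrict_mem (M.measurableSet_interface R R')]
    with x hx hmem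
  rw [hx.2, inner_neg_right, hU R R' x hmem.1]

lemma integrableOn_frontier_flux {V : P3 → P3} {g : P3 → ℝ} {R : ι} (hV : ContinuousOn V (M.elem R))
    (hg : Continuous g) :
    IntegrableOn (fun x => g x * ⟪V x, M.normal R x⟫) (frontier (M.elem R)) μHE[2] := by
  obtain ⟨H, hH⟩ := M.exists_isPolytope R
  exact (hH.integrableOn_frontier_inner hV).continuousOn_mul_of_subset hg.continuousOn
    (M.isCompact_elem R) isClosed_frontier.measurableSet (M.isClosed_elem R).frontier_subset

lemma integrableOn_upwindFlux {U : ι → P3 → P3} (hU : ∀ R, ContinuousOn (U R) (M.elem R))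
    {f φ : ι → P3 → ℝ} (hf : M.InW k f) (hφ : M.InW k φ) {R R' : ι} (hne : R ≠ R') :
    IntegrableOn (fun x => M.upwindFlux U f R R' x * φ R x) (M.interface R R') μHE[2] := by
  have hfc : ∀ R, Continuous (f R) := fun R => (hf.contDiff R (n := 0)).continuous
  have hφc : ∀ R, Continuous (φ R) := fun R => (hφ.contDiff R (n := 0)).continuous
  have ha : IntegrableOn (fun x => ⟪U R x, M.normal R x⟫) (M.interface R R') μHE[2] := by
    have := (integrableOn_frontier_flux (g := fun _ => 1) (hU R) continuous_const).mono_set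
      (M.interface_subset_frontier hne)
    simpa only [one_mul] using this
  have hsub : M.interface R R' ⊆ M.elem R := fun x hx => hx.1.1
  have h1 := ha.mul_continuousOn_of_subset (g' := fun x => (f R x + f R' x) / 2 * φ R x)
    (by have := hfc R; have := hfc R'; have := hφc R; fun_prop)
    (M.measurableSet_interface R R') (M.isCompact_elem R) hsub
  have h2 := IntegrableOn.mul_continuousOn_of_subset (ha.abs) (g' := fun x => (f R x - f R' x) / 2 * φ R x)
    (by have := hfc R; have := hfc R'; have := hφc R; fun_prop)
    (M.measurableSet_interface R R') (M.isCompact_elem R) hsub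
  refine (h1.add h2).congr (Filter.Eventually.of_forall fun x => ?_)
  simp only [Pi.add_apply, upwindFlux_eq]
  ring

variable [Fintype ι] [DecidableEq ι]

/-- The upwind flux is single-valued, so that it cancels against continuous functions. -/
lemma sumInterfaces_upwindFlux_eq_zero {U : ι → P3 → P3}
    (hU : ∀ R, ContinuousOn (U R) (M.elem R))
    (hU' : ∀ R R', ∀ x ∈ M.elem R ∩ M.elem R', U R x = U R' x)
    {f φ : ι → P3 → ℝ} (hf : M.InW k f) (hφ : M.InW k φ) (hφC : M.IsC1 φ) :
    M.sumInterfaces (fun R R' x => M.upwindFlux U f R R' x * φ R x) = 0 := by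
  have h := M.two_mul_sumInterfaces fun R R' hne => integrableOn_upwindFlux hU hf hφ hne
  have h0 : M.sumInterfaces (fun R R' x => M.upwindFlux U f R R' x * φ R x
      + M.upwindFlux U f R' R x * φ R' x) = M.sumInterfaces fun _ _ _ => 0 := by
    refine M.sumInterfaces_congr fun R R' hne => ?_
    filter_upwards [ae_inner_normal_interface hU' hne,
      ae_restrict_mem (M.measurableSet_interface R R')] with x hx hmem
    rw [upwindFlux_eq, upwindFlux_eq, hx, abs_neg, (hφC R R' x hmem.1).1]
    ring
  rw [h0] at h
  simpa [sumInterfaces] using h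

/-- The energy balance of upwind advection. -/
lemma upwind_energy {U : ι → P3 → P3} {U' : ι → P3 → P3 →L[ℝ] P3}
    (hU : ∀ R, ContinuousOn (U R) (M.elem R)) (hU' : ∀ R, ContinuousOn (U' R) (M.elem R))
    (hd : ∀ R, ∀ x ∈ interior (M.elem R), HasFDerivAt (U R) (U' R x) x)
    (hUeq : ∀ R R', ∀ x ∈ M.elem R ∩ M.elem R', U R x = U R' x)
    {f : ι → P3 → ℝ} (hf : M.InW k f) :
    M.ipv (fun R p => f R p • U R p) (fun R => ∇ (f R))
        - M.sumInterfaces (fun R R' x => M.upwindFlux U f R R' x * f R x)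
      = - M.ip (fun R p => (1 / 2) * div (U R) p) (fun R p => (f R p) ^ 2)
        + M.sumBdry (fun R x => (1 / 2) * ⟪U R x, M.normal R x⟫ * (f R x) ^ 2)
        - (1 / 2) * M.sumInterfaces (fun R R' x => |⟪U R x, M.normal R x⟫| / 2
              * ⟪M.jump f R R' x, M.jump f R R' x⟫) := by
  have hfc : ∀ R, ContDiff ℝ 1 (f R) := fun R => hf.contDiff R
  -- Half the square, so that f∇f is a gradient and f U·∇f can be integrated by parts.
  have hsq : ∀ R, ContDiff ℝ 1 (fun x => (1 / 2) * f R x ^ 2) := fun R =>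
    contDiff_const.mul ((hfc R).pow 2)
  have hgrad : ∀ R x, ∇ (fun x => (1 / 2) * f R x ^ 2) x = f R x • ∇ (f R) x := by
    intro R x
    have h1 := (((hfc R).differentiable one_ne_zero x).hasFDerivAt.pow 2).const_mul (1 / 2)
    ext i
    rw [gradient_apply, h1.fderiv, PiLp.smul_apply, gradient_apply]
    simp only [smul_apply, smul_eq_mul, nsmul_eq_mul]
    norm_num
    ring
  have hfr : ∀ R, IntegrableOn (fun x => (1 / 2) * f R x ^ 2 * ⟪U R x, M.normal R x⟫)
      (frontier (M.elem R)) μHE[2] := fun R =>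
    integrableOn_frontier_flux (hU R) (hsq R).continuous
  have hparts : M.ipv (fun R p => f R p • U R p) (fun R => ∇ (f R))
      = - M.ip (fun R p => (1 / 2) * div (U R) p) (fun R p => (f R p) ^ 2)
        + ∑ R, ∫ x in frontier (M.elem R), (1 / 2) * f R x ^ 2 * ⟪U R x, M.normal R x⟫ ∂μHE[2] := by
    rw [ipv, ip, ← Finset.sum_neg_distrib, ← Finset.sum_add_distrib]
    refine Finset.sum_congr rfl fun R _ => ?_
    obtain ⟨H, hH⟩ := M.exists_isPolytope R
    have h := hH.integral_parts (hsq R) (hU R) (hU' R) (hd R)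
    have h1 : ∀ x, ⟪f R x • U R x, ∇ (f R) x⟫ = ⟪f R x • ∇ (f R) x, U R x⟫ := fun x => by
      rw [real_inner_smul_left, real_inner_smul_left, real_inner_comm]
    have h2 : ∀ x, (1 / 2) * div (U R) x * f R x ^ 2 = (1 / 2) * f R x ^ 2 * div (U R) x :=
      fun x => mul_right_comm _ _ _
    simp only [hgrad] at h
    simp only [h1, h2]
    exact h
  rw [hparts, M.sum_integral_frontier hfr]
  have hb : M.sumBdry (fun R x => (1 / 2) * f R x ^ 2 * ⟪U R x, M.normal R x⟫)
      = M.sumBdry (fun R x => (1 / 2) * ⟪U R x, M.normal R x⟫ * (f R x) ^ 2) := by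
    simp only [sumBdry, mul_right_comm]
  have hi1 : ∀ R R', R ≠ R' → IntegrableOn
      (fun x => (1 / 2) * f R x ^ 2 * ⟪U R x, M.normal R x⟫) (M.interface R R') μHE[2] :=
    fun R R' hne => (hfr R).mono_set (M.interface_subset_frontier hne)
  have hi2 : ∀ R R', R ≠ R' → IntegrableOn
      (fun x => (-1) * (M.upwindFlux U f R R' x * f R x)) (M.interface R R') μHE[2] :=
    fun R R' hne => (integrableOn_upwindFlux hU hf hf hne).const_mul _
  have hsum := M.sumInterfaces_add hi1 hi2
  rw [M.sumInterfaces_const_mul] at hsum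
  have htwo := M.two_mul_sumInterfaces fun R R' hne => (hi1 R R' hne).add (hi2 R R' hne)
  -- Let a = U·n⁻ and let f, f' be the traces. The two sides together give a(f² − f'²)/2 from the
  -- integration by parts and −a(f + f')(f − f')/2 from the central flux, which cancel. There
  -- remains −|a|(f − f')²/2. Symmetrizing doubles the sum, hence the factor 1/2 in the result.
  have hjump : M.sumInterfaces (fun R R' x =>
      ((1 / 2) * f R x ^ 2 * ⟪U R x, M.normal R x⟫ + (-1) * (M.upwindFlux U f R R' x * f R x))
      + ((1 / 2) * f R' x ^ 2 * ⟪U R' x, M.normal R' x⟫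
        + (-1) * (M.upwindFlux U f R' R x * f R' x)))
      = M.sumInterfaces (fun R R' x => (-1) * (|⟪U R x, M.normal R x⟫| / 2
              * ⟪M.jump f R R' x, M.jump f R R' x⟫)) := by
    refine M.sumInterfaces_congr fun R R' hne => ?_
    filter_upwards [ae_inner_normal_interface hUeq hne, M.ae_normal_interface hne] with x hx hn
    have hj : ⟪M.jump f R R' x, M.jump f R R' x⟫ = (f R x - f R' x) ^ 2 := by
      have : M.jump f R R' x = (f R x - f R' x) • M.normal R x := by
        rw [jump, hn.2, smul_neg, sub_smul, sub_eq_add_neg]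
      rw [this, real_inner_self_eq_norm_sq, norm_smul, hn.1, mul_one, Real.norm_eq_abs, sq_abs]
    rw [upwindFlux_eq, upwindFlux_eq, hx, abs_neg, hj]
    ring
  rw [M.sumInterfaces_const_mul] at hjump
  have htwo' := htwo.trans hjump
  have hsum' : M.sumInterfaces (fun R R' x => (1 / 2) * f R x ^ 2 * ⟪U R x, M.normal R x⟫
      + (-1) * (M.upwindFlux U f R R' x * f R x)) = _ := hsum
  rw [hb]
  have : 2 * (M.sumInterfaces (fun R _ x => (1 / 2) * f R x ^ 2 * ⟪U R x, M.normal R x⟫)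
      + (-1) * M.sumInterfaces (fun R R' x => M.upwindFlux U f R R' x * f R x)) = _ :=
    (congrArg (2 * ·) hsum'.symm).trans htwo'
  linarith

end Mesh

/-! ### Polynomial test functions -/

lemma isQk_const (k : ℕ) (c : ℝ) : IsQk k (fun _ => c) := by
  refine ⟨MvPolynomial.C c, (MvPolynomial.mem_restrictDegree _ _ _).2 fun s hs i => ?_, by simp⟩
  rw [Finset.mem_singleton.1 (MvPolynomial.support_monomial_subset hs)]
  exact Nat.zero_le _

lemma isQk_coord {k : ℕ} (hk : 1 ≤ k) (i : Fin 3) : IsQk k (fun p => p i) := by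
  refine ⟨MvPolynomial.X i, (MvPolynomial.mem_restrictDegree _ _ _).2 fun s hs j => ?_, by simp⟩
  rw [Finset.mem_singleton.1 (MvPolynomial.support_monomial_subset hs)]
  refine le_trans ?_ hk
  rw [Finsupp.single_apply]
  split_ifs <;> simp

lemma gradient_coord (i : Fin 3) (x : P3) :
    ∇ (fun p : P3 => p i) x = EuclideanSpace.single i 1 := by
  ext j
  rw [gradient_apply]
  have h : HasFDerivAt (fun p : P3 => p i) (EuclideanSpace.proj i : P3 →L[ℝ] ℝ) x :=
    (EuclideanSpace.proj i : P3 →L[ℝ] ℝ).hasFDerivAt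
  rw [h.fderiv]
  simp [eq_comm]

/-- For k = 0 the coordinates are not in W_h, so the projection need not reproduce them. Momentum
conservation then rests on the vanishing of all piecewise gradients. -/
lemma IsQk.gradient_eq_zero {g : P3 → ℝ} (hg : IsQk 0 g) (x : P3) : ∇ g x = 0 := by
  obtain ⟨P, hP, h⟩ := hg
  rw [MvPolynomial.mem_restrictDegree] at hP
  ext i
  have : MvPolynomial.pderiv i P = 0 := by
    rw [P.as_sum, map_sum]
    refine Finset.sum_eq_zero fun s hs => ?_
    rw [MvPolynomial.pderiv_monomial, Nat.le_zero.1 (hP s hs i)]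
    simp
  rw [gradient_apply, funext h, fderiv_eval, this]
  simp

/-! ### Conservation laws and energy identity for solutions of the scheme -/

namespace Mesh

variable {ι : Type*} [Fintype ι] [DecidableEq ι] {M : Mesh ι} {k : ℕ} {Λ : P3 → P3 → ℝ}

/-- Every continuously differentiable test function whose gradient differences are annihilated by
the kernel gives a conserved quantity. -/
theorem IsSolution.hasDerivWithinAt_ip_zero {rg : Regime} {u : P3} {e : ι → P3 → ℝ} {I : Set ℝ}
    {f f' : ℝ → ι → P3 → ℝ} (hf : M.IsSolution rg k u Λ e I f f') (hΛ : M.AdmissibleFactor Λ)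
    (he : M.InW k e) (heC : M.IsC1 e) {φ : ι → P3 → ℝ} (hφ : M.InW k φ) (hφC : M.IsC1 φ)
    (hker : ∀ R R', ∀ p ∈ M.elem R, ∀ q ∈ M.elem R',
      M.kernel rg k u Λ e R R' p q (∇ (φ R) p - ∇ (φ R') q) = 0) {t : ℝ} (ht : t ∈ I) :
    HasDerivWithinAt (fun s => M.ip (f s) φ) 0 I t := by
  have h := hf.weak_form t ht φ hφ
  -- The volume terms on the two sides of the weak form agree and the interface sum vanishes, so
  -- (∂_t f, φ) = 0.
  rw [diffusion_eq_advection hΛ rg u he heC (hf.mem t ht) hφ hφC hker,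
    sumInterfaces_upwindFlux_eq_zero
      (fun R => (exists_fderiv_advection hΛ rg u he heC (f t) R).1)
      (advection_eq_of_mem he heC rg u (f t)) (hf.mem t ht) hφ hφC] at h
  have h0 : M.ip (f' t) φ = 0 := by linarith
  have hd := M.hasDerivWithinAt_ip hf.mem hf.deriv_mem hf.hasDeriv ht hφ
  rwa [h0] at hd

/-- The discrete energy identity. -/
theorem IsSolution.energy_identity {rg : Regime} {u : P3} {e : ι → P3 → ℝ} {I : Set ℝ}
    {f f' : ℝ → ι → P3 → ℝ} (hf : M.IsSolution rg k u Λ e I f f') (hΛ : M.AdmissibleFactor Λ)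
    (he : M.InW k e) (heC : M.IsC1 e) {t : ℝ} (ht : t ∈ I) :
    M.ip (f' t) (f t)
      + M.ipv (M.dgrad k u (f t))
          (fun R p => M.diffusion rg k u Λ e (f t) R p (M.dgrad k u (f t) R p))
      + M.ip (fun R p => (1 / 2) * div (M.advection rg k u Λ e (f t) R) p)
          (fun R p => (f t R p) ^ 2)
      - M.sumBdry (fun R x => (1 / 2) * ⟪M.advection rg k u Λ e (f t) R x, M.normal R x⟫
          * (f t R x) ^ 2)
    = - ((1 / 2) * M.sumInterfaces (fun R R' x =>
        |⟪M.advection rg k u Λ e (f t) R x, M.normal R x⟫| / 2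
          * ⟪M.jump (f t) R R' x, M.jump (f t) R R' x⟫)) := by
  have hreg := exists_fderiv_advection hΛ rg u he heC (f t)
  choose hU U' hU' hd using hreg
  have h1 := hf.weak_form t ht (f t) (hf.mem t ht)
  have h2 := upwind_energy hU hU' hd (advection_eq_of_mem he heC rg u (f t)) (hf.mem t ht)
  linarith

end Mesh

end USP

end

theorem mainTheorem1 {ι : Type*} [Fintype ι] [DecidableEq ι] (M : USP.Mesh ι)
    (rg : USP.Regime) (k : ℕ) (u : USP.P3) (Λ : USP.P3 → USP.P3 → ℝ)
    (hΛ : M.AdmissibleFactor Λ) (Pr : M.C1Projection k)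
    (h_one : (fun _ => 1) ∈ Pr.dom) (h_mom : ∀ i : Fin 3, (fun p : USP.P3 => p i) ∈ Pr.dom)
    (h_en : USP.energy rg ∈ Pr.dom)
    (I : Set ℝ) (f f' : ℝ → ι → USP.P3 → ℝ)
    (hf : M.IsSolution rg k u Λ (Pr.toFun ⟨USP.energy rg, h_en⟩) I f f') :
    -- conservation of mass, momentum and energy
    (∀ t ∈ I,
      HasDerivWithinAt (fun s => M.ip (f s) (Pr.toFun ⟨fun _ => 1, h_one⟩)) 0 I t ∧
      (∀ i, HasDerivWithinAt (fun s => M.ip (f s) (Pr.toFun ⟨fun p => p i, h_mom i⟩)) 0 I t) ∧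
      HasDerivWithinAt (fun s => M.ip (f s) (Pr.toFun ⟨USP.energy rg, h_en⟩)) 0 I t) ∧
    -- the advection field is continuous on the closed domain and differentiable in each element
    -- with an integrable divergence, and the energy identity holds
    (∀ t ∈ I, ∀ U : ι → USP.P3 → USP.P3,
      U = M.advection rg k u Λ (Pr.toFun ⟨USP.energy rg, h_en⟩) (f t) →
      (∀ R R', ∀ x ∈ M.elem R ∩ M.elem R', U R x = U R' x) ∧
      (∀ R, ContinuousOn (U R) (M.elem R) ∧
        (∀ x ∈ interior (M.elem R), DifferentiableAt ℝ (U R) x) ∧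
        IntegrableOn (USP.div (U R)) (M.elem R)) ∧
      ∃ d : ℝ, HasDerivWithinAt (fun s => (1 / 2) * M.ip (f s) (f s)) d I t ∧
        d + M.ipv (M.dgrad k u (f t))
              (fun R p => M.diffusion rg k u Λ (Pr.toFun ⟨USP.energy rg, h_en⟩) (f t) R p
                (M.dgrad k u (f t) R p))
          + M.ip (fun R p => (1 / 2) * USP.div (U R) p) (fun R p => (f t R p) ^ 2)
          - M.sumBdry (fun R x => (1 / 2) * inner ℝ (U R x) (M.normal R x) * (f t R x) ^ 2)
        -- `sumInterfaces` visits every interface twice, hence the factor 1 / 2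
        = - ((1 / 2) * M.sumInterfaces (fun R R' x => |inner ℝ (U R x) (M.normal R x)| / 2
              * inner ℝ (M.jump (f t) R R' x) (M.jump (f t) R R' x))) ∧
        - ((1 / 2) * M.sumInterfaces (fun R R' x => |inner ℝ (U R x) (M.normal R x)| / 2
              * inner ℝ (M.jump (f t) R R' x) (M.jump (f t) R R' x))) ≤ 0) := by
  have he := Pr.mem ⟨USP.energy rg, h_en⟩
  have heC := Pr.isC1 ⟨USP.energy rg, h_en⟩
  constructor
  · refine fun t ht => ⟨?_, fun i => ?_, ?_⟩
    · have hW : M.InW k (fun _ _ => 1) := fun _ => USP.isQk_const k 1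
      have hC : M.IsC1 (fun _ _ => 1) := fun _ _ _ _ => ⟨rfl, rfl⟩
      rw [Pr.reproduces _ hW hC ⟨fun _ => 1, h_one⟩ fun _ _ _ => rfl]
      refine hf.hasDerivWithinAt_ip_zero hΛ he heC hW hC (fun R R' p _ q _ => ?_) ht
      simp [gradient_fun_const]
    · refine hf.hasDerivWithinAt_ip_zero hΛ he heC (Pr.mem _) (Pr.isC1 _)
        (fun R R' p _ q _ => ?_) ht
      -- For k ≥ 1 the coordinate is its own projection and has constant gradient; for k = 0 its
      -- projection is piecewise constant.
      rcases Nat.eq_zero_or_pos k with rfl | hk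
      · rw [(Pr.mem _ R).gradient_eq_zero, (Pr.mem _ R').gradient_eq_zero, sub_self, map_zero]
      · have hW : M.InW k (fun _ p => p i) := fun _ => USP.isQk_coord hk i
        have hC : M.IsC1 (fun _ p => p i) := fun _ _ _ _ => ⟨rfl, rfl⟩
        rw [Pr.reproduces _ hW hC ⟨fun p => p i, h_mom i⟩ fun _ _ _ => rfl,
          USP.gradient_coord, USP.gradient_coord, sub_self, map_zero]
    · refine hf.hasDerivWithinAt_ip_zero hΛ he heC he heC (fun R R' p hp q hq => ?_) ht
      -- The gradient of the projected energy is its discrete gradient, which is the velocity in the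
      -- kernel; so the gradient difference is the vector a that the tensor annihilates.
      rw [← USP.Mesh.dgrad_eq_gradient he heC u R hp, ← USP.Mesh.dgrad_eq_gradient he heC u R' hq]
      exact USP.Mesh.kernel_apply_sub rg u _ R R' p q
  · rintro t ht U rfl
    refine ⟨USP.Mesh.advection_eq_of_mem he heC rg u (f t), fun R => ?_, M.ip (f' t) (f t), ?_,
      hf.energy_identity hΛ he heC ht, ?_⟩
    · obtain ⟨hU, U', hU', hd⟩ := USP.Mesh.exists_fderiv_advection hΛ rg u he heC (f t) R
      obtain ⟨H, hH⟩ := M.exists_isPolytope R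
      exact ⟨hU, fun x hx => (hd x hx).differentiableAt, hH.integrableOn_div hU' hd⟩
    · have h := (M.hasDerivWithinAt_ip_self hf.mem hf.deriv_mem hf.hasDeriv ht).const_mul (1 / 2)
      rwa [← mul_assoc, one_div_mul_cancel two_ne_zero, one_mul] at h
    · rw [neg_nonpos]
      refine mul_nonneg (by norm_num) (Finset.sum_nonneg fun R _ => Finset.sum_nonneg fun R' _ =>
        MeasureTheory.integral_nonneg fun x => ?_)
      exact mul_nonneg (div_nonneg (abs_nonneg _) (by norm_num)) real_inner_self_nonneg
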